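/- **Setting.** Processes $p_1,\dots,p_n$ share a sorted linked list of nodes with fields $val$, $next$, $deleted$ (a boolean) and $vlock$ (a counter whose least significant bit is a lock). Initially there are only the nodes $head$ and $tail$, with $head.val=-\infty$, $tail.val=+\infty$, $head.next=tail$, both undeleted and with $vlock=0$. Below, $x.\mathrm{getVersion}()$ reads $x.vlock$ and clears its last bit, $x.\mathrm{tryLock}(a)$ is $\mathrm{CAS}(x.vlock,a,a+1)$, $x.\mathrm{lock}()$ repeats $a\gets x.\mathrm{getVersion}()$; $x.\mathrm{tryLock}(a)$ until success, and $x.\mathrm{unlock}()$ reads $a=x.vlock$ and performs $\mathrm{CAS}(x.vlock,a,a+1)$. Every primitive is atomic, new nodes are put at free addresses (with $deleted=\mathrm{false}$, $vlock=0$), and each process runs one operation at a time. The *Versioned List* implements $\mathrm{insert}(v)$, $\mathrm{remove}(v)$, $\mathrm{contains}(v)$, $v\in\mathbb Z$, as follows. - $\mathrm{contains}(v)$: $curr\gets head$; while $curr.val<v$ do $curr\gets curr.next$; return $(curr.val=v\wedge\neg curr.deleted)$. - $\mathrm{traverse}(v)$: $prev\gets curr\gets head$; while $curr.val<v$ do $prev\gets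 curr$, $curr\gets curr.next$; return $prev$. - $\mathrm{validate}(v,prev)$: (a) $pVer\gets prev.\mathrm{getVersion}()$; if $prev.deleted$ return $\bot$; $curr\gets prev.next$; while $curr.val<v$ do: $pVer\gets curr.\mathrm{getVersion}()$, if $curr.deleted$ go to (a), $prev\gets curr$, $curr\gets curr.next$. Return $(prev,pVer,curr)$. - $\mathrm{insert}(v)$: (b) $prev\gets\mathrm{traverse}(v)$; (c) $r\gets\mathrm{validate}(v,prev)$; if $r=\bot$ go to (b), else $(prev,pVer,curr)\gets r$; if $curr.deleted$ go to (c); if $curr.val=v$ return false; create a node $X$ with $X.val=v$, $X.next=curr$; if $prev.\mathrm{tryLock}(pVer)$ fails go to (c); $prev.next\gets X$; $prev.\mathrm{unlock}()$; return true. - $\mathrm{remove}(v)$: (b) and (c) as in $\mathrm{insert}$; if $curr.val\ne v$ or $curr.deleted$ return false; if $prev.\mathrm{tryLock}(pVer)$ fails go to (c); $curr.\mathrm{lock}()$; $curr.deleted\gets\mathrm{true}$; $prev.next\gets curr.next$; $curr.\mathrm{unlock}()$; $prev.\mathrm{unlock}()$; return true. The sequential implementation $LL$ of the set uses only the fields $val$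 and $next$, from the same initial list. Each of its operations with argument $v$ starts with $prev\gets head$, $curr\gets prev.next$, and, while $(tval\gets curr.val)<v$, does $prev\gets curr$, $curr\gets curr.next$. Then $\mathrm{insert}(v)$, if $tval\ne v$, creates a node $X$ with value $v$ and next node $curr$ and writes $prev.next\gets X$; $\mathrm{remove}(v)$, if $tval=v$, reads $tnext\gets curr.next$ and writes $prev.next\gets tnext$. The responses are $tval\ne v$ for $\mathrm{insert}$ and $tval=v$ for $\mathrm{remove}$ and $\mathrm{contains}$. The *history* of a finite execution $\alpha$ of the Versioned List is its subsequence that consists of all invocations and responses of operations and of those reads of $val$ and $next$ fields, writes of $next$ fields and node creations that take effect, as follows. An operation that starts a new traversal from $head$ drops its earlier reads, writes and creations; an operation that reads again a field that it has read before (as it does when it validates, retries, or tests a value again) drops its events from the earlier retained read of this field on; the reads of $head.val$, which $LL$ does not perform, are omitted. The *schedule* $\sigma$ of the history is obtained by forgetting the values returned by reads and by high-level operations (arguments of invocations, writes and node creations are kept). A schedule is *accepted* if it comes from some finite execution. For an operation $\pi$, $\sigma|\pi$ is the subsequence of the events of $\pi$. **Theorem (Correctness).** For every $n$, every schedule accepted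 by the Versioned List is correct. That is, for every finite execution $\alpha$, with history $H$ and schedule $\sigma$: 1. the high-level history (invocations and responses) of $H$ is linearizable with respect to the set type on $\mathbb Z$, initially empty: adding responses to some of the incomplete operations and removing the other incomplete ones gives a complete history $\tilde H$, for which there is a sequential history $S$, consistent with the specification of the set type, that has the same events of each process as $\tilde H$ and preserves the real-time precedence order of the operations of $\tilde H$; 2. $\sigma$ is locally serializable with respect to $LL$: for every operation $\pi$ of $\sigma$ there are a sequential history $S$ of $LL$, whose last operation may be incomplete, and an operation of $S$ whose events in the schedule of $S$ are exactly $\sigma|\pi$. Moreover, $S$ can be chosen as a sequence of complete inserts followed by that single operation. -/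

import Mathlib

/-! ### The set type -/

/-- Operations of the integer set type. -/
inductive SetOp where
  | insert (v : ℤ)
  | remove (v : ℤ)
  | contains (v : ℤ)
  deriving DecidableEq

namespace SetOp

/-- The state of the set after the operation. -/
def next : SetOp → Set ℤ → Set ℤ
  | insert v, q => q ∪ {v}
  | remove v, q => q \ {v}
  | contains _, q => q

/-- The condition under which the operation, applied in state `q`, returns `true`. -/
def succeeds : SetOp → Set ℤ → Prop
  | insert v, q => v ∉ q
  | remove v, q => v ∈ q
  | contains v, q => v ∈ q

/-- A sequence of operations with their responses respects the sequential specification of the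
set type, from state `q` on. -/
def Legal : Set ℤ → List (SetOp × Bool) → Prop
  | _, [] => True
  | q, (o, b) :: l => (b = true ↔ o.succeeds q) ∧ Legal (o.next q) l

end SetOp

/-! ### Events -/

/-- Addresses of list nodes. -/
abbrev Addr := ℕ

/-- The sentinel node at the front of the list. -/
def Addr.head : Addr := 0

/-- The sentinel node at the end of the list. -/
def Addr.tail : Addr := 1

/-- Values of nodes: integers, with `⊥` for minus infinity and `⊤` for plus infinity. -/
abbrev NodeVal := WithBot (WithTop ℤ)

/-- The value of a node that stores the integer `v`. -/
def intVal (v : ℤ) : NodeVal := ((v : WithTop ℤ) : WithBot (WithTop ℤ))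

/-- Events: invocations and responses of high-level operations, and atomic primitives on the
fields of the nodes, together with their responses. -/
inductive Event where
  | inv (o : SetOp)
  | resp (b : Bool)
  /-- read of `x.val`, returning `w` -/
  | readVal (x : Addr) (w : NodeVal)
  /-- read of `x.next`, returning `y` -/
  | readNext (x y : Addr)
  /-- write of `y` to `x.next` -/
  | writeNext (x y : Addr)
  /-- creation of a node at address `x`, with value `v` and next node `y` -/
  | create (x : Addr) (v : ℤ) (y : Addr)
  /-- read of `x.deleted`, returning `b` -/
  | readDel (x : Addr) (b : Bool)
  /-- write of `b` to `x.deleted` -/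
  | writeDel (x : Addr) (b : Bool)
  /-- read of `x.vlock`, returning `w` -/
  | readLock (x : Addr) (w : ℕ)
  /-- compare-and-swap of `x.vlock` from `a` to `b`; `ok` says whether it succeeded -/
  | casLock (x : Addr) (a b : ℕ) (ok : Bool)
  deriving DecidableEq

/-! ### The sequential implementation `LL` -/

/-- The part of the shared memory that the sequential implementation uses: the fields `val` and
`next` of the nodes, and the set of addresses at which there is a node. -/
structure Mem where
  val : Addr → NodeVal
  next : Addr → Addr
  alloc : Set Addr

/-- The empty list: `head` and `tail` only (`tail.next` is never accessed). -/
def Mem.initial : Mem where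
  val := fun x => if x = Addr.head then ⊥ else ⊤
  next := fun _ => Addr.tail
  alloc := {Addr.head, Addr.tail}

namespace LL

/-- Local states: the next thing to be done, with the local variables that are still needed. -/
inductive Loc where
  /-- no operation is in progress -/
  | idle
  /-- `curr ← read(prev.next)` -/
  | readNext (o : SetOp) (prev : Addr)
  /-- `tval ← read(curr.val)` and the test that follows -/
  | readVal (o : SetOp) (prev curr : Addr)
  /-- `X ← new-node(v, curr)` -/
  | create (v : ℤ) (prev curr : Addr)
  /-- `tnext ← read(curr.next)` -/
  | readTnext (prev curr : Addr)
  /-- `write(prev.next, y)` -/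
  | write (prev y : Addr)
  /-- return `b` -/
  | ret (b : Bool)

/-- The argument of an operation. -/
def arg : SetOp → ℤ
  | .insert v => v
  | .remove v => v
  | .contains v => v

/-- What is done after the loop ended at `curr`, where `found` says whether `tval = v`. -/
def afterLoop : SetOp → Addr → Addr → Bool → Loc
  | .insert v, prev, curr, false => .create v prev curr
  | .insert _, _, _, true => .ret false
  | .remove _, prev, curr, true => .readTnext prev curr
  | .remove _, _, _, false => .ret false
  | .contains _, _, _, b => .ret b

/-- Steps of an operation after its invocation. A new node may be put at any free address. -/
inductive LStep : Loc → Mem → Event → Loc → Mem → Prop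
  | readNext (o prev m) :
      LStep (.readNext o prev) m (.readNext prev (m.next prev)) (.readVal o prev (m.next prev)) m
  | readVal_lt (o prev curr m) (h : m.val curr < intVal (arg o)) :
      LStep (.readVal o prev curr) m (.readVal curr (m.val curr)) (.readNext o curr) m
  | readVal_ge (o prev curr m) (h : ¬ m.val curr < intVal (arg o)) :
      LStep (.readVal o prev curr) m (.readVal curr (m.val curr))
        (afterLoop o prev curr (decide (m.val curr = intVal (arg o)))) m
  | create (v prev curr m) (x : Addr) (h : x ∉ m.alloc) :
      LStep (.create v prev curr) m (.create x v curr) (.write prev x)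
        { val := Function.update m.val x (intVal v)
          next := Function.update m.next x curr
          alloc := insert x m.alloc }
  | readTnext (prev curr m) :
      LStep (.readTnext prev curr) m (.readNext curr (m.next curr)) (.write prev (m.next curr)) m
  | write (prev y m) :
      LStep (.write prev y) m (.writeNext prev y) (.ret true)
        { m with next := Function.update m.next prev y }
  | ret (b m) : LStep (.ret b) m (.resp b) .idle m

/-- Sequential executions of `LL` from the empty list, and the state that they lead to. Every
event is labelled with the number of the operation to which it belongs; `k` is the number of
operations invoked so far. -/
inductive Exec : List (ℕ × Event) → Loc → Mem → ℕ → Prop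
  | initial : Exec [] .idle Mem.initial 0
  | invoke {S m k} (o : SetOp) (h : Exec S .idle m k) :
      Exec (S ++ [(k + 1, .inv o)]) (.readNext o Addr.head) m (k + 1)
  | step {S l m k e l' m'} (h : Exec S l m k) (hs : LStep l m e l' m') :
      Exec (S ++ [(k, e)]) l' m' k

/-- `S` is a (sequential) history of `LL`; its last operation may be incomplete. -/
def IsHistory (S : List (ℕ × Event)) : Prop := ∃ l m k, Exec S l m k

end LL

/-! ### The Versioned List -/

/-- The shared memory of the Versioned List. The field `vlock` is a counter whose least
significant bit says whether the node is locked. -/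
structure VMem extends Mem where
  deleted : Addr → Bool
  vlock : Addr → ℕ

def VMem.initial : VMem where
  toMem := Mem.initial
  deleted := fun _ => false
  vlock := fun _ => 0

namespace VL

/-- The two kinds of update operations. -/
inductive Kind where
  | ins
  | rem

/-- Local states of a process: the next thing to be done, with the local variables that are still
needed. -/
inductive Loc where
  /-- no operation is in progress -/
  | idle
  /-- `contains(v)`: loop test `curr.val < v` -/
  | cTest (v : ℤ) (curr : Addr)
  /-- `contains(v)`: `curr ← curr.next` -/
  | cNext (v : ℤ) (curr : Addr)
  /-- `contains(v)`: test `curr.val = v` of the last line -/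
  | cVal (v : ℤ) (curr : Addr)
  /-- `contains(v)`: read of `curr.deleted` in the last line -/
  | cDel (curr : Addr)
  /-- `waitfreeTraversal(v)`: loop test `curr.val < v` -/
  | tTest (k : Kind) (v : ℤ) (prev curr : Addr)
  /-- `waitfreeTraversal(v)`: `prev ← curr`, `curr ← curr.next` -/
  | tNext (k : Kind) (v : ℤ) (curr : Addr)
  /-- `validate(v, prev)`, first line: `pVer ← prev.vlock.getVersion()` -/
  | vVer (k : Kind) (v : ℤ) (prev : Addr)
  /-- `validate`: test of `prev.deleted` -/
  | vDel (k : Kind) (v : ℤ) (prev : Addr) (pVer : ℕ)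
  /-- `validate`: `curr ← prev.next` -/
  | vNext (k : Kind) (v : ℤ) (prev : Addr) (pVer : ℕ)
  /-- `validate`: loop test `curr.val < v` -/
  | vTest (k : Kind) (v : ℤ) (prev : Addr) (pVer : ℕ) (curr : Addr)
  /-- `validate`, in the loop: `pVer ← curr.vlock.getVersion()` -/
  | vCurrVer (k : Kind) (v : ℤ) (prev curr : Addr)
  /-- `validate`, in the loop: test of `curr.deleted` -/
  | vCurrDel (k : Kind) (v : ℤ) (prev : Addr) (pVer : ℕ) (curr : Addr)
  /-- `validate`, in the loop: `prev ← curr`, `curr ← curr.next` -/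
  | vCurrNext (k : Kind) (v : ℤ) (pVer : ℕ) (curr : Addr)
  /-- `insert(v)`: test of `curr.deleted` -/
  | iDel (v : ℤ) (prev : Addr) (pVer : ℕ) (curr : Addr)
  /-- `insert(v)`: test `curr.val = v` -/
  | iVal (v : ℤ) (prev : Addr) (pVer : ℕ) (curr : Addr)
  /-- `insert(v)`: creation of the new node -/
  | iCreate (v : ℤ) (prev : Addr) (pVer : ℕ) (curr : Addr)
  /-- `insert(v)`: `prev.vlock.tryLockAtVersion(pVer)` -/
  | iLock (v : ℤ) (prev : Addr) (pVer : ℕ) (newNode : Addr)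
  /-- `insert(v)`: `prev.next ← newNode` -/
  | iWrite (prev newNode : Addr)
  /-- `remove(v)`: test `curr.val ≠ v` -/
  | rVal (v : ℤ) (prev : Addr) (pVer : ℕ) (curr : Addr)
  /-- `remove(v)`: test of `curr.deleted` -/
  | rDel (v : ℤ) (prev : Addr) (pVer : ℕ) (curr : Addr)
  /-- `remove(v)`: `prev.vlock.tryLockAtVersion(pVer)` -/
  | rLock (v : ℤ) (prev : Addr) (pVer : ℕ) (curr : Addr)
  /-- `curr.vlock.lockAtCurrentVersion()`: `ver ← getVersion()` -/
  | rSpinVer (prev curr : Addr)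
  /-- `curr.vlock.lockAtCurrentVersion()`: `tryLockAtVersion(ver)` -/
  | rSpinLock (prev curr : Addr) (ver : ℕ)
  /-- `remove(v)`: `curr.deleted ← true` -/
  | rMark (prev curr : Addr)
  /-- `remove(v)`: read of `curr.next` in `prev.next ← curr.next` -/
  | rNext (prev curr : Addr)
  /-- `remove(v)`: write of `prev.next` in `prev.next ← curr.next` -/
  | rWrite (prev curr next : Addr)
  /-- `x.vlock.unlockAndIncrementVersion()`: `val ← lockValue.read()`; the nodes in `xs` are to be
  unlocked afterwards -/
  | unlockRead (x : Addr) (xs : List Addr)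
  /-- `x.vlock.unlockAndIncrementVersion()`: `lockValue.CAS(val, val + 1)` -/
  | unlockCas (x : Addr) (xs : List Addr) (val : ℕ)
  /-- return `b` -/
  | ret (b : Bool)

/-- Local state at the call of `waitfreeTraversal(v)`, from an update operation. -/
def traversal (k : Kind) (v : ℤ) : Loc := .tTest k v Addr.head Addr.head

/-- Local state after the invocation of an operation. -/
def start : SetOp → Loc
  | .insert v => traversal .ins v
  | .remove v => traversal .rem v
  | .contains v => .cTest v Addr.head

/-- Local state after `validate` returned `⟨prev, pVer, curr⟩`. -/
def afterValidate : Kind → ℤ → Addr → ℕ → Addr → Loc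
  | .ins, v, prev, pVer, curr => .iDel v prev pVer curr
  | .rem, v, prev, pVer, curr => .rVal v prev pVer curr

/-- Local state after a node was unlocked, when the nodes in the list remain to be unlocked. -/
def afterUnlock : List Addr → Loc
  | [] => .ret true
  | x :: xs => .unlockRead x xs

/-- The version in a value of the lock counter: its least significant bit is masked. -/
def version (w : ℕ) : ℕ := 2 * (w / 2)

/-- The memory after `x.vlock` was set to `w`. -/
def setLock (m : VMem) (x : Addr) (w : ℕ) : VMem :=
  { m with vlock := Function.update m.vlock x w }

/-- The memory after `x.next` was set to `y`. -/
def setNext (m : VMem) (x y : Addr) : VMem :=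
  { m with next := Function.update m.next x y }

/-- The memory after a node with value `v` and next node `y` was created at address `x`. -/
def createNode (m : VMem) (x : Addr) (v : ℤ) (y : Addr) : VMem where
  val := Function.update m.val x (intVal v)
  next := Function.update m.next x y
  alloc := insert x m.alloc
  deleted := Function.update m.deleted x false
  vlock := Function.update m.vlock x 0

/-- Steps of an operation after its invocation. Every step applies one primitive, creates a node,
or responds. A new node may be put at any free address. -/
inductive LStep : Loc → VMem → Event → Loc → VMem → Prop
  -- contains
  | cTest_lt (v curr m) (h : m.val curr < intVal v) :
      LStep (.cTest v curr) m (.readVal curr (m.val curr)) (.cNext v curr) m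
  | cTest_ge (v curr m) (h : ¬ m.val curr < intVal v) :
      LStep (.cTest v curr) m (.readVal curr (m.val curr)) (.cVal v curr) m
  | cNext (v curr m) :
      LStep (.cNext v curr) m (.readNext curr (m.next curr)) (.cTest v (m.next curr)) m
  | cVal_eq (v curr m) (h : m.val curr = intVal v) :
      LStep (.cVal v curr) m (.readVal curr (m.val curr)) (.cDel curr) m
  | cVal_ne (v curr m) (h : m.val curr ≠ intVal v) :
      LStep (.cVal v curr) m (.readVal curr (m.val curr)) (.ret false) m
  | cDel (curr m) :
      LStep (.cDel curr) m (.readDel curr (m.deleted curr)) (.ret (!m.deleted curr)) m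
  -- waitfreeTraversal
  | tTest_lt (k v prev curr m) (h : m.val curr < intVal v) :
      LStep (.tTest k v prev curr) m (.readVal curr (m.val curr)) (.tNext k v curr) m
  | tTest_ge (k v prev curr m) (h : ¬ m.val curr < intVal v) :
      LStep (.tTest k v prev curr) m (.readVal curr (m.val curr)) (.vVer k v prev) m
  | tNext (k v curr m) :
      LStep (.tNext k v curr) m (.readNext curr (m.next curr)) (.tTest k v curr (m.next curr)) m
  -- validate
  | vVer (k v prev m) :
      LStep (.vVer k v prev) m (.readLock prev (m.vlock prev))
        (.vDel k v prev (version (m.vlock prev))) m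
  | vDel_true (k v prev pVer m) (h : m.deleted prev = true) :
      LStep (.vDel k v prev pVer) m (.readDel prev true) (traversal k v) m
  | vDel_false (k v prev pVer m) (h : m.deleted prev = false) :
      LStep (.vDel k v prev pVer) m (.readDel prev false) (.vNext k v prev pVer) m
  | vNext (k v prev pVer m) :
      LStep (.vNext k v prev pVer) m (.readNext prev (m.next prev))
        (.vTest k v prev pVer (m.next prev)) m
  | vTest_lt (k v prev pVer curr m) (h : m.val curr < intVal v) :
      LStep (.vTest k v prev pVer curr) m (.readVal curr (m.val curr)) (.vCurrVer k v prev curr) m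
  | vTest_ge (k v prev pVer curr m) (h : ¬ m.val curr < intVal v) :
      LStep (.vTest k v prev pVer curr) m (.readVal curr (m.val curr))
        (afterValidate k v prev pVer curr) m
  | vCurrVer (k v prev curr m) :
      LStep (.vCurrVer k v prev curr) m (.readLock curr (m.vlock curr))
        (.vCurrDel k v prev (version (m.vlock curr)) curr) m
  | vCurrDel_true (k v prev pVer curr m) (h : m.deleted curr = true) :
      LStep (.vCurrDel k v prev pVer curr) m (.readDel curr true) (.vVer k v prev) m
  | vCurrDel_false (k v prev pVer curr m) (h : m.deleted curr = false) :
      LStep (.vCurrDel k v prev pVer curr) m (.readDel curr false) (.vCurrNext k v pVer curr) m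
  | vCurrNext (k v pVer curr m) :
      LStep (.vCurrNext k v pVer curr) m (.readNext curr (m.next curr))
        (.vTest k v curr pVer (m.next curr)) m
  -- insert
  | iDel_true (v prev pVer curr m) (h : m.deleted curr = true) :
      LStep (.iDel v prev pVer curr) m (.readDel curr true) (.vVer .ins v prev) m
  | iDel_false (v prev pVer curr m) (h : m.deleted curr = false) :
      LStep (.iDel v prev pVer curr) m (.readDel curr false) (.iVal v prev pVer curr) m
  | iVal_eq (v prev pVer curr m) (h : m.val curr = intVal v) :
      LStep (.iVal v prev pVer curr) m (.readVal curr (m.val curr)) (.ret false) m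
  | iVal_ne (v prev pVer curr m) (h : m.val curr ≠ intVal v) :
      LStep (.iVal v prev pVer curr) m (.readVal curr (m.val curr)) (.iCreate v prev pVer curr) m
  | iCreate (v prev pVer curr m) (x : Addr) (h : x ∉ m.alloc) :
      LStep (.iCreate v prev pVer curr) m (.create x v curr) (.iLock v prev pVer x)
        (createNode m x v curr)
  | iLock_ok (v prev pVer newNode m) (h : m.vlock prev = pVer) :
      LStep (.iLock v prev pVer newNode) m (.casLock prev pVer (pVer + 1) true)
        (.iWrite prev newNode) (setLock m prev (pVer + 1))
  | iLock_fail (v prev pVer newNode m) (h : m.vlock prev ≠ pVer) :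
      LStep (.iLock v prev pVer newNode) m (.casLock prev pVer (pVer + 1) false)
        (.vVer .ins v prev) m
  | iWrite (prev newNode m) :
      LStep (.iWrite prev newNode) m (.writeNext prev newNode) (.unlockRead prev [])
        (setNext m prev newNode)
  -- remove
  | rVal_ne (v prev pVer curr m) (h : m.val curr ≠ intVal v) :
      LStep (.rVal v prev pVer curr) m (.readVal curr (m.val curr)) (.ret false) m
  | rVal_eq (v prev pVer curr m) (h : m.val curr = intVal v) :
      LStep (.rVal v prev pVer curr) m (.readVal curr (m.val curr)) (.rDel v prev pVer curr) m
  | rDel_true (v prev pVer curr m) (h : m.deleted curr = true) :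
      LStep (.rDel v prev pVer curr) m (.readDel curr true) (.ret false) m
  | rDel_false (v prev pVer curr m) (h : m.deleted curr = false) :
      LStep (.rDel v prev pVer curr) m (.readDel curr false) (.rLock v prev pVer curr) m
  | rLock_ok (v prev pVer curr m) (h : m.vlock prev = pVer) :
      LStep (.rLock v prev pVer curr) m (.casLock prev pVer (pVer + 1) true)
        (.rSpinVer prev curr) (setLock m prev (pVer + 1))
  | rLock_fail (v prev pVer curr m) (h : m.vlock prev ≠ pVer) :
      LStep (.rLock v prev pVer curr) m (.casLock prev pVer (pVer + 1) false)
        (.vVer .rem v prev) m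
  | rSpinVer (prev curr m) :
      LStep (.rSpinVer prev curr) m (.readLock curr (m.vlock curr))
        (.rSpinLock prev curr (version (m.vlock curr))) m
  | rSpinLock_ok (prev curr ver m) (h : m.vlock curr = ver) :
      LStep (.rSpinLock prev curr ver) m (.casLock curr ver (ver + 1) true)
        (.rMark prev curr) (setLock m curr (ver + 1))
  | rSpinLock_fail (prev curr ver m) (h : m.vlock curr ≠ ver) :
      LStep (.rSpinLock prev curr ver) m (.casLock curr ver (ver + 1) false)
        (.rSpinVer prev curr) m
  | rMark (prev curr m) :
      LStep (.rMark prev curr) m (.writeDel curr true) (.rNext prev curr)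
        { m with deleted := Function.update m.deleted curr true }
  | rNext (prev curr m) :
      LStep (.rNext prev curr) m (.readNext curr (m.next curr))
        (.rWrite prev curr (m.next curr)) m
  | rWrite (prev curr next m) :
      LStep (.rWrite prev curr next) m (.writeNext prev next) (.unlockRead curr [prev])
        (setNext m prev next)
  -- unlockAndIncrementVersion
  | unlockRead (x xs m) :
      LStep (.unlockRead x xs) m (.readLock x (m.vlock x)) (.unlockCas x xs (m.vlock x)) m
  | unlockCas_ok (x xs val m) (h : m.vlock x = val) :
      LStep (.unlockCas x xs val) m (.casLock x val (val + 1) true) (afterUnlock xs)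
        (setLock m x (val + 1))
  | unlockCas_fail (x xs val m) (h : m.vlock x ≠ val) :
      LStep (.unlockCas x xs val) m (.casLock x val (val + 1) false) (afterUnlock xs) m
  -- response
  | ret (b m) : LStep (.ret b) m (.resp b) .idle m

end VL

/-- An operation is named by the process that performs it and its rank among the operations of
this process. -/
abbrev OpId (n : ℕ) := Fin n × ℕ

namespace VL

/-- A configuration: the shared memory, and for each process its local state and the number of
operations that it has invoked. -/
structure Config (n : ℕ) where
  mem : VMem
  loc : Fin n → Loc
  count : Fin n → ℕ

def Config.initial (n : ℕ) : Config n where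
  mem := VMem.initial
  loc := fun _ => .idle
  count := fun _ => 0

/-- Executions of the Versioned List by `n` processes, and the configurations they lead to. Every
event is labelled with the operation to which it belongs. -/
inductive Exec {n : ℕ} : List (OpId n × Event) → Config n → Prop
  | initial : Exec [] (Config.initial n)
  | invoke {α c} (p : Fin n) (o : SetOp) (h : Exec α c) (hp : c.loc p = .idle) :
      Exec (α ++ [((p, c.count p + 1), .inv o)])
        { mem := c.mem
          loc := Function.update c.loc p (start o)
          count := Function.update c.count p (c.count p + 1) }
  | step {α c e l m} (p : Fin n) (h : Exec α c) (hs : LStep (c.loc p) c.mem e l m) :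
      Exec (α ++ [((p, c.count p), e)])
        { mem := m
          loc := Function.update c.loc p l
          count := c.count }

/-- `α` is a finite execution of the Versioned List by `n` processes. -/
def IsExecution {n : ℕ} (α : List (OpId n × Event)) : Prop := ∃ c, Exec α c

end VL

/-! ### High-level histories and linearizability -/

/-- High-level events: invocations and responses. -/
inductive HLEvent where
  | inv (o : SetOp)
  | resp (b : Bool)
  deriving DecidableEq

/-- The high-level event in an event, if there is one. -/
def Event.toHL : Event → Option HLEvent
  | .inv o => some (.inv o)
  | .resp b => some (.resp b)
  | _ => none

/-- The high-level history of a sequence of events. -/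
def highLevel {I : Type} (H : List (I × Event)) : List (I × HLEvent) :=
  H.filterMap fun a => a.2.toHL.map fun e => (a.1, e)

namespace HL

variable {n : ℕ}

/-- `π` has an invocation in `H`. -/
def Invoked (H : List (OpId n × HLEvent)) (π : OpId n) : Prop := ∃ o, (π, HLEvent.inv o) ∈ H

/-- `π` has a response in `H`. -/
def Responded (H : List (OpId n × HLEvent)) (π : OpId n) : Prop := ∃ b, (π, HLEvent.resp b) ∈ H

/-- `π` precedes `ρ` in `H`: the response of `π` occurs before the invocation of `ρ`. -/
def Precedes (H : List (OpId n × HLEvent)) (π ρ : OpId n) : Prop :=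
  ∃ b o, [(π, HLEvent.resp b), (ρ, HLEvent.inv o)].Sublist H

open Classical in
/-- `K` is a completion of `H`: responses `R` to some incomplete operations of `H` are added, and
the other incomplete operations are removed. -/
def IsCompletion (H K : List (OpId n × HLEvent)) : Prop :=
  ∃ R : List (OpId n × Bool),
    (R.map Prod.fst).Nodup ∧
    (∀ a ∈ R, Invoked H a.1 ∧ ¬ Responded H a.1) ∧
    K = (H ++ R.map fun a => (a.1, HLEvent.resp a.2)).filter fun a =>
      decide (Responded (H ++ R.map fun a => (a.1, HLEvent.resp a.2)) a.1)

/-- The complete sequential high-level history in which the operations listed in `L` are performed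
one after the other, with the given responses. -/
def sequential (L : List (OpId n × SetOp × Bool)) : List (OpId n × HLEvent) :=
  L.flatMap fun a => [(a.1, HLEvent.inv a.2.1), (a.1, HLEvent.resp a.2.2)]

/-- Two high-level histories are equivalent: every process sees the same events. -/
def Equivalent (H K : List (OpId n × HLEvent)) : Prop :=
  ∀ p : Fin n, H.filter (fun a => decide (a.1.1 = p)) = K.filter (fun a => decide (a.1.1 = p))

/-- Linearizability of a high-level history with respect to the set type, initially empty. -/
def Linearizable (H : List (OpId n × HLEvent)) : Prop :=
  ∃ K, IsCompletion H K ∧ ∃ L : List (OpId n × SetOp × Bool),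
    Equivalent K (sequential L) ∧
    (∀ π ρ, Precedes K π ρ → Precedes (sequential L) π ρ) ∧
    SetOp.Legal ∅ (L.map Prod.snd)

end HL

/-! ### Histories and schedules -/

/-- Both events are reads of the same `val` or `next` field. -/
def Event.sameRead : Event → Event → Bool
  | .readVal x _, .readVal y _ => x == y
  | .readNext x _, .readNext y _ => x == y
  | _, _ => false

def Event.isInv : Event → Bool
  | .inv _ => true
  | _ => false

/-- If the operation `π` has in `H` a read of the field that `e` reads, remove the first such read
and all later events of `π`. -/
def retract {I : Type} [DecidableEq I] (π : I) (e : Event) : List (I × Event) → List (I × Event)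
  | [] => []
  | a :: H =>
    if a.1 = π ∧ a.2.sameRead e = true then H.filter (fun b => decide (b.1 ≠ π))
    else a :: retract π e H

/-- How the next event `a` of an execution changes its history `H`.
* Accesses to the fields `deleted` and `vlock` do not belong to the history.
* The value of `head` is read when, and only when, a traversal from `head` is started. This read
  has no counterpart in the sequential implementation; all previous reads, writes and creations of
  the same operation belong to an aborted attempt and are dropped.
* When an operation reads a field again, its events from the earlier read of this field on are
  superseded by the new read. -/
def record {I : Type} [DecidableEq I] (H : List (I × Event)) (a : I × Event) : List (I × Event) :=
  match a.2 with
  | .inv _ => H ++ [a]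
  | .resp _ => H ++ [a]
  | .writeNext _ _ => H ++ [a]
  | .create _ _ _ => H ++ [a]
  | .readVal x _ =>
    if x = Addr.head then H.filter (fun b => decide (b.1 ≠ a.1) || b.2.isInv)
    else retract a.1 a.2 H ++ [a]
  | .readNext _ _ => retract a.1 a.2 H ++ [a]
  | .readDel _ _ => H
  | .writeDel _ _ => H
  | .readLock _ _ => H
  | .casLock _ _ _ _ => H

/-- The history of an execution: the subsequence of the invocations, the responses and those reads,
writes (of `val` and `next` fields) and node creations that take effect. -/
def history {I : Type} [DecidableEq I] (α : List (I × Event)) : List (I × Event) :=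
  α.foldl record []

/-- Events of a schedule: the events of a history without the responses of reads and of high-level
operations. -/
inductive SEvent where
  | inv (o : SetOp)
  | resp
  | readVal (x : Addr)
  | readNext (x : Addr)
  | writeNext (x y : Addr)
  | create (x : Addr) (v : ℤ) (y : Addr)
  deriving DecidableEq

/-- Forget the responses. -/
def Event.toSched : Event → Option SEvent
  | .inv o => some (.inv o)
  | .resp _ => some .resp
  | .readVal x _ => some (.readVal x)
  | .readNext x _ => some (.readNext x)
  | .writeNext x y => some (.writeNext x y)
  | .create x v y => some (.create x v y)
  | _ => none

/-- The schedule of a history. Two histories have the same schedule if and only if they agree on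
the order of reads, writes, node creations, invocations and responses, but not necessarily on the
values returned. -/
def schedule {I : Type} (H : List (I × Event)) : List (I × SEvent) :=
  H.filterMap fun a => a.2.toSched.map fun e => (a.1, e)

/-- The events of the operation `π` in the schedule `σ`. -/
def opEvents {I : Type} [DecidableEq I] (σ : List (I × SEvent)) (π : I) : List SEvent :=
  (σ.filter fun a => decide (a.1 = π)).map Prod.snd

/-- Local serializability with respect to `LL`: for each operation `π` of the schedule there is a
history `S` of `LL` in which some operation `k` has the same events. -/
def LocallySerializable {n : ℕ} (σ : List (OpId n × SEvent)) : Prop :=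
  ∀ π : OpId n, (∃ e, (π, e) ∈ σ) →
    ∃ S, LL.IsHistory S ∧ ∃ k, opEvents (schedule S) k = opEvents σ π

/-- Local serializability with respect to `LL`, where the history of `LL` is of the form
`S₀ ++ T`: a sequence `S₀` of complete insert operations is followed by a single operation, with
events `T`, that has the same events as `π`. -/
def LocallySerializableAfterInserts {n : ℕ} (σ : List (OpId n × SEvent)) : Prop :=
  ∀ π : OpId n, (∃ e, (π, e) ∈ σ) →
    ∃ S₀ T k, LL.IsHistory (S₀ ++ T) ∧
      (∀ a ∈ S₀, a.1 ≠ k ∧ (∃ b, (a.1, Event.resp b) ∈ S₀) ∧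
        ∀ o, a.2 = Event.inv o → ∃ v, o = SetOp.insert v) ∧
      (∀ a ∈ T, a.1 = k) ∧
      (schedule T).map Prod.snd = opEvents σ π

/-- A history `H` has a correct schedule: its high-level history is linearizable with respect to
the set type, and its schedule is locally serializable with respect to `LL`. -/
def IsCorrect {n : ℕ} (H : List (OpId n × Event)) : Prop :=
  HL.Linearizable (highLevel H) ∧ LocallySerializable (schedule H)

/-!
The Versioned List is linearizable, and its operations look like sequential ones, for the following
reasons.

*Locks and versions.* A process changes the field `next` or `deleted` of a linked node only while it
holds the lock of the node, and a node that is locked, or that has been locked and released, has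
another value of `vlock` than before. So if `tryLock(pVer)` succeeds on `prev`, nothing that was
read from `prev` after its version has changed: `prev` is undeleted, and its successor is still
`curr`. This is part of the invariant `Inv` of the configurations. Its memory part `MemInv` says
that along `next` pointers values increase, and that each node that was linked once and is not
marked can be reached from `head`. A marked node can be reached only while the process that has
marked it is about to unlink it (`Inv.marking`).

*Linearization points.* The list represents the set of the values of its unmarked reachable nodes.
A successful insert takes effect when it links the new node, a successful remove when it marks the
node; no other event changes the set (`absSet_step`). An unlinked node keeps its successor.
Therefore each link `x.next = y` that an operation reads did exist in the list at some moment since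
the invocation, even if `x` has been unlinked since (`Touched.edge`). Hence there is a moment
between the invocation and the response at which a response that reports "no change" is right: a
gap between the values of `x` and `y` shows that the value was missing when the link existed, a mark
shows that it was missing some time after the node was in the list, and a node without mark has its
value in the set when this is read (`LocHist.step`). Linearization points in this sense yield a
linearization (`HL.linearizable_of_points`): at every time, the operation that changes the set, if
there is one, is followed by the operations that do not.

*Local serializability.* The values of nodes never change and increase along links, so the nodes
that remain in the events of an operation, after the superseded reads are dropped, are distinct.
They need not have formed a list at any time, and this does not matter, since a schedule does not
contain the values that reads return: for given distinct nodes, sequential inserts, in reverse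
order and with increasing values that are chosen freely below the argument of the operation, create
a list of these nodes, which the sequential operation then traverses
(`LL.exists_after_path`). The value of the last node can be chosen such that the operation ends as
prescribed (`LL.realizable_read`, `LL.realizable_insert`, `LL.realizable_remove`). It remains to
follow the events that an operation retains through its local states (`LocSched.step`). Since
only reads, writes and creations are dropped, a history has the same invocations and responses as
the execution.
-/

/-! ### Reachability in the list -/

namespace VL

theorem intVal_lt {v w : ℤ} : intVal v < intVal w ↔ v < w := by
  simp [intVal]

theorem intVal_inj {v w : ℤ} : intVal v = intVal w ↔ v = w := by
  simp [intVal]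

theorem bot_lt_intVal (v : ℤ) : (⊥ : NodeVal) < intVal v := WithBot.bot_lt_coe _

theorem top_ne_intVal (v : ℤ) : (⊤ : NodeVal) ≠ intVal v := by
  intro h
  have h' : ((⊤ : WithTop ℤ) : NodeVal) = ((v : WithTop ℤ) : NodeVal) := h
  exact WithTop.top_ne_coe (WithBot.coe_injective h')

/-- The node `x` can be reached from `head` along the `next` pointers `nx`. -/
def Reach (nx : Addr → Addr) (x : Addr) : Prop := ∃ k : ℕ, nx^[k] Addr.head = x

theorem Reach.head {nx : Addr → Addr} : Reach nx Addr.head := ⟨0, rfl⟩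

theorem Reach.next {nx : Addr → Addr} {x : Addr} (h : Reach nx x) : Reach nx (nx x) := by
  obtain ⟨k, rfl⟩ := h
  exact ⟨k + 1, Function.iterate_succ_apply' _ _ _⟩

@[elab_as_elim]
theorem Reach.induct {nx : Addr → Addr} {P : Addr → Prop} (h0 : P Addr.head)
    (h1 : ∀ y, Reach nx y → P y → P (nx y)) {x : Addr} (h : Reach nx x) : P x := by
  obtain ⟨k, rfl⟩ := h
  induction k with
  | zero => exact h0
  | succ k ih =>
    rw [Function.iterate_succ_apply']
    exact h1 _ ⟨k, rfl⟩ ih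

/-- Linking a node `y`, whose successor is that of `prev`, behind `prev` loses no node. -/
theorem reach_of_link {nx : Addr → Addr} {prev y x : Addr} (hy : nx y = nx prev) (hne : y ≠ prev)
    (h : Reach nx x) : Reach (Function.update nx prev y) x := by
  refine h.induct Reach.head fun z _ ih => ?_
  by_cases hz : z = prev
  · subst hz
    have h2 := ih.next.next
    simpa [hne, hy] using h2
  · have h2 := ih.next
    simpa [hz] using h2

/-- Linking a node `y` behind `prev` makes no other node than `y` reachable. -/
theorem reach_link {nx : Addr → Addr} {prev y x : Addr} (hy : nx y = nx prev) (hne : y ≠ prev)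
    (hp : Reach nx prev) (h : Reach (Function.update nx prev y) x) : Reach nx x ∨ x = y := by
  refine h.induct (Or.inl Reach.head) fun z _ ih => ?_
  by_cases hz : z = prev
  · subst hz; simp
  · rw [Function.update_of_ne hz]
    rcases ih with ih | rfl
    · exact Or.inl ih.next
    · exact Or.inl (hy ▸ hp.next)

/-- The invariant of the shared memory. The set `pub` contains the nodes that have been linked into
the list at some time (and possibly unlinked since). -/
structure MemInv (m : VMem) (pub : Set Addr) : Prop where
  head_alloc : Addr.head ∈ m.alloc
  tail_alloc : Addr.tail ∈ m.alloc
  val_head : m.val Addr.head = ⊥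
  val_tail : m.val Addr.tail = ⊤
  next_tail : m.next Addr.tail = Addr.tail
  next_alloc : ∀ x ∈ m.alloc, m.next x ∈ m.alloc
  sorted : ∀ x ∈ m.alloc, x ≠ Addr.tail → m.val x < m.val (m.next x)
  pub_alloc : ∀ x ∈ pub, x ∈ m.alloc
  head_pub : Addr.head ∈ pub
  next_pub : ∀ x ∈ pub, m.next x ∈ pub
  pub_reach : ∀ x ∈ pub, m.deleted x = false → Reach m.next x

namespace MemInv

variable {m : VMem} {pub : Set Addr} (M : MemInv m pub)
include M

theorem reach_pub {x : Addr} (h : Reach m.next x) : x ∈ pub :=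
  h.induct M.head_pub fun y _ hy => M.next_pub y hy

theorem reach_alloc {x : Addr} (h : Reach m.next x) : x ∈ m.alloc := M.pub_alloc x (M.reach_pub h)

theorem ne_tail_of_lt {x : Addr} {v : ℤ} (h : m.val x < intVal v) : x ≠ Addr.tail := by
  rintro rfl
  rw [M.val_tail] at h
  exact not_top_lt h

theorem ne_tail_of_eq {x : Addr} {v : ℤ} (h : m.val x = intVal v) : x ≠ Addr.tail := by
  rintro rfl
  rw [M.val_tail] at h
  exact top_ne_intVal v h

theorem ne_head_of_not_lt {x : Addr} {v : ℤ} (h : ¬ m.val x < intVal v) : x ≠ Addr.head := by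
  rintro rfl
  rw [M.val_head] at h
  exact h (bot_lt_intVal v)

theorem ne_head_of_gt {x : Addr} {w : NodeVal} (h : w < m.val x) : x ≠ Addr.head := by
  rintro rfl
  rw [M.val_head] at h
  exact not_lt_bot h

theorem val_le_next {x : Addr} (hx : x ∈ m.alloc) : m.val x ≤ m.val (m.next x) := by
  by_cases h : x = Addr.tail
  · subst h; rw [M.next_tail]
  · exact (M.sorted x hx h).le

theorem val_mono {i j : ℕ} (h : i ≤ j) :
    m.val (m.next^[i] Addr.head) ≤ m.val (m.next^[j] Addr.head) := by
  induction j, h using Nat.le_induction with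
  | base => exact le_rfl
  | succ j _ ih =>
    refine ih.trans ?_
    rw [Function.iterate_succ_apply']
    exact M.val_le_next (M.reach_alloc ⟨j, rfl⟩)

/-- No reachable value lies strictly between those of a reachable node and its successor. -/
theorem gap {a b : Addr} (ha : Reach m.next a) (hb : Reach m.next b) (h : m.val a < m.val b) :
    m.val (m.next a) ≤ m.val b := by
  obtain ⟨i, rfl⟩ := ha
  obtain ⟨j, rfl⟩ := hb
  rw [← Function.iterate_succ_apply' m.next]
  apply M.val_mono
  by_contra hij
  exact absurd (M.val_mono (show j ≤ i by omega)) (not_le.mpr h)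

theorem reach_inj {a b : Addr} (ha : Reach m.next a) (hb : Reach m.next b)
    (h : m.val a = m.val b) : a = b := by
  have key : ∀ i j : ℕ, i ≤ j → m.val (m.next^[i] Addr.head) = m.val (m.next^[j] Addr.head) →
      m.next^[i] Addr.head = m.next^[j] Addr.head := by
    intro i j hij hv
    by_cases ht : m.next^[i] Addr.head = Addr.tail
    · obtain ⟨d, rfl⟩ := Nat.exists_eq_add_of_le' hij
      rw [Function.iterate_add_apply, ht]
      clear hv hij
      induction d with
      | zero => rfl
      | succ d ih => rw [Function.iterate_succ_apply, M.next_tail, ← ih]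
    · rcases hij.eq_or_lt with rfl | hlt
      · rfl
      · have h1 := M.sorted _ (M.reach_alloc ⟨i, rfl⟩) ht
        rw [← Function.iterate_succ_apply' m.next] at h1
        exact absurd (h1.trans_le (M.val_mono hlt)) (by rw [hv]; exact lt_irrefl _)
  obtain ⟨i, rfl⟩ := ha
  obtain ⟨j, rfl⟩ := hb
  rcases le_total i j with hij | hij
  · exact key i j hij h
  · exact (key j i hij h.symm).symm

theorem pred_unique {a b : Addr} (ha : Reach m.next a) (hb : Reach m.next b)
    (h : m.next a = m.next b) (ht : a ≠ Addr.tail) (ht' : b ≠ Addr.tail) : a = b := by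
  have h1 := M.sorted a (M.reach_alloc ha) ht
  have h2 := M.sorted b (M.reach_alloc hb) ht'
  rcases lt_trichotomy (m.val a) (m.val b) with hl | he | hl
  · have := M.gap ha hb hl
    rw [h] at this
    exact absurd h2 (not_lt.mpr this)
  · exact M.reach_inj ha hb he
  · have := M.gap hb ha hl
    rw [← h] at this
    exact absurd h1 (not_lt.mpr this)

/-- Unlinking `curr` makes no other node than `curr` unreachable. -/
theorem reach_of_unlink {prev curr x : Addr} (hp : Reach m.next prev) (hc : m.next prev = curr)
    (hpt : prev ≠ Addr.tail) (hct : curr ≠ Addr.tail) (h : Reach m.next x) (hx : x ≠ curr) :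
    Reach (Function.update m.next prev (m.next curr)) x := by
  have hpc : m.val prev < m.val curr := hc ▸ M.sorted _ (M.reach_alloc hp) hpt
  have hcr : Reach m.next curr := hc ▸ hp.next
  have hcn : m.val curr < m.val (m.next curr) := M.sorted _ (M.reach_alloc hcr) hct
  have hc0 : curr ≠ Addr.head := M.ne_head_of_gt hpc
  have key : (x = curr → Reach (Function.update m.next prev (m.next curr)) prev) ∧
      (x ≠ curr → Reach (Function.update m.next prev (m.next curr)) x) := by
    refine h.induct ⟨fun h => absurd h.symm hc0, fun _ => Reach.head⟩ fun y hy ih => ?_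
    by_cases hyc : y = curr
    · have h2 := (ih.1 hyc).next
      rw [Function.update_self] at h2
      subst hyc
      refine ⟨fun h3 => ?_, fun _ => h2⟩
      rw [h3] at hcn
      exact absurd hcn (lt_irrefl _)
    · have hy' := ih.2 hyc
      by_cases hyp : y = prev
      · subst hyp
        exact ⟨fun _ => hy', fun h3 => absurd hc h3⟩
      · refine ⟨fun h3 => ?_, fun _ => ?_⟩
        · have hyt : y ≠ Addr.tail := by
            rintro rfl
            rw [M.next_tail] at h3
            exact hct h3.symm
          exact absurd (M.pred_unique hy hp (h3.trans hc.symm) hyt hpt) hyp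
        · have h2 := hy'.next
          rwa [Function.update_of_ne hyp] at h2
  exact key.2 hx

theorem reach_unlink {prev curr x : Addr} (hp : Reach m.next prev) (hc : m.next prev = curr)
    (hpt : prev ≠ Addr.tail) (hct : curr ≠ Addr.tail)
    (h : Reach (Function.update m.next prev (m.next curr)) x) : Reach m.next x ∧ x ≠ curr := by
  have hpc : m.val prev < m.val curr := hc ▸ M.sorted _ (M.reach_alloc hp) hpt
  have hcr : Reach m.next curr := hc ▸ hp.next
  have hcn : m.val curr < m.val (m.next curr) := M.sorted _ (M.reach_alloc hcr) hct
  have hc0 : curr ≠ Addr.head := M.ne_head_of_gt hpc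
  refine h.induct ⟨Reach.head, hc0.symm⟩ fun y _ ih => ?_
  by_cases hyp : y = prev
  · subst hyp
    rw [Function.update_self]
    refine ⟨hcr.next, fun h3 => ?_⟩
    rw [h3] at hcn
    exact absurd hcn (lt_irrefl _)
  · rw [Function.update_of_ne hyp]
    refine ⟨ih.1.next, fun h3 => ?_⟩
    have hyt : y ≠ Addr.tail := by
      rintro rfl
      rw [M.next_tail] at h3
      exact hct h3.symm
    exact hyp (M.pred_unique ih.1 hp (h3.trans hc.symm) hyt hpt)

end MemInv

/-- The set that the list represents. -/
def absSet (m : VMem) : Set ℤ :=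
  {v | ∃ x, Reach m.next x ∧ m.deleted x = false ∧ m.val x = intVal v}

theorem MemInv.notMem_absSet_of_gap {m : VMem} {pub : Set Addr} (M : MemInv m pub) {x : Addr}
    {v : ℤ} (hx : Reach m.next x) (h1 : m.val x < intVal v) (h2 : intVal v < m.val (m.next x)) :
    v ∉ absSet m := by
  rintro ⟨y, hy, -, hv⟩
  rw [← hv] at h1 h2
  exact absurd h2 (not_lt.mpr (M.gap hx hy h1))

theorem MemInv.notMem_absSet_of_deleted {m : VMem} {pub : Set Addr} (M : MemInv m pub) {x : Addr}
    {v : ℤ} (hx : Reach m.next x) (hd : m.deleted x = true) (hv : m.val x = intVal v) :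
    v ∉ absSet m := by
  rintro ⟨y, hy, hd', hv'⟩
  obtain rfl := M.reach_inj hx hy (hv.trans hv'.symm)
  simp [hd] at hd'

end VL

/-! ### Executions with ghost variables -/

namespace VL

/-- Whether the event `e` of an operation `o` is the one at which a successful update takes
effect: the link of a new node, or the marking of a node. -/
def isEffect : SetOp → Event → Bool
  | .insert _, .writeNext _ _ => true
  | .remove _, .writeDel _ _ => true
  | _, _ => false

/-- The nodes that have been linked, after the event `e`. -/
def pubAfter : Event → Set Addr → Set Addr
  | .writeNext _ y, pub => insert y pub
  | _, pub => pub

/-- A configuration with ghost variables. The time of a configuration is the number of events that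
lead to it. -/
structure GState (n : ℕ) where
  mem : VMem
  loc : Fin n → Loc
  count : Fin n → ℕ
  /-- the nodes that have been linked into the list -/
  pub : Set Addr
  /-- the high-level operation that is invoked by an operation -/
  op : OpId n → SetOp
  /-- the time after the invocation of an operation -/
  since : OpId n → ℕ
  /-- the time before the event at which an update takes effect -/
  eff : OpId n → Option ℕ
  /-- the response of an operation (`true` as soon as it has taken effect) -/
  ret : OpId n → Bool
  /-- the time before the response of an operation -/
  fin : OpId n → Option ℕ

/-- The current operation of a process. -/
abbrev GState.cur {n : ℕ} (s : GState n) (p : Fin n) : OpId n := (p, s.count p)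

def GState.initial (n : ℕ) : GState n where
  mem := VMem.initial
  loc := fun _ => .idle
  count := fun _ => 0
  pub := {Addr.head, Addr.tail}
  op := fun _ => .contains 0
  since := fun _ => 0
  eff := fun _ => none
  ret := fun _ => false
  fin := fun _ => none

/-- The response ghost variable after the event `e` of an operation `o`. -/
def retAfter (o : SetOp) (e : Event) (b : Bool) : Bool :=
  match e with
  | .resp b' => b'
  | e => isEffect o e || b

/-- The time before the response, after the event `e` at time `i`. -/
def finAfter (e : Event) (i : ℕ) (r : Option ℕ) : Option ℕ :=
  match e with
  | .resp _ => some i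
  | _ => r

/-- The configuration after the invocation of `o` by `p` at time `i`. -/
def GState.afterInvoke {n : ℕ} (i : ℕ) (s : GState n) (p : Fin n) (o : SetOp) : GState n :=
  { s with
    loc := Function.update s.loc p (start o)
    count := Function.update s.count p (s.count p + 1)
    op := Function.update s.op (p, s.count p + 1) o
    since := Function.update s.since (p, s.count p + 1) (i + 1) }

/-- The configuration after an event `e` of `p` at time `i`, which leads to the local state `l` and
the memory `m`. -/
def GState.afterStep {n : ℕ} (i : ℕ) (s : GState n) (p : Fin n) (e : Event) (l : Loc) (m : VMem) :
    GState n where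
  mem := m
  loc := Function.update s.loc p l
  count := s.count
  pub := pubAfter e s.pub
  op := s.op
  since := s.since
  eff := Function.update s.eff (s.cur p)
    (if isEffect (s.op (s.cur p)) e = true then some i else s.eff (s.cur p))
  ret := Function.update s.ret (s.cur p) (retAfter (s.op (s.cur p)) e (s.ret (s.cur p)))
  fin := Function.update s.fin (s.cur p)
    (finAfter e i (s.fin (s.cur p)))

/-- Steps at time `i`. -/
inductive GStep {n : ℕ} (i : ℕ) : GState n → OpId n × Event → GState n → Prop
  | invoke (s : GState n) (p : Fin n) (o : SetOp) (hp : s.loc p = .idle) :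
      GStep i s ((p, s.count p + 1), .inv o) (s.afterInvoke i p o)
  | step (s : GState n) (p : Fin n) (e : Event) (l : Loc) (m : VMem)
      (hs : LStep (s.loc p) s.mem e l m) :
      GStep i s (s.cur p, e) (s.afterStep i p e l m)

/-- The sequence `g` of configurations belongs to the execution. -/
inductive IsTrace {n : ℕ} (g : ℕ → GState n) : List (OpId n × Event) → Prop
  | nil (h : g 0 = GState.initial n) : IsTrace g []
  | snoc {α : List (OpId n × Event)} {a : OpId n × Event} (h : IsTrace g α)
      (hs : GStep α.length (g α.length) a (g (α.length + 1))) : IsTrace g (α ++ [a])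

theorem IsTrace.congr {n : ℕ} {g g' : ℕ → GState n} {α : List (OpId n × Event)}
    (h : IsTrace g α) (hg : ∀ i ≤ α.length, g' i = g i) : IsTrace g' α := by
  induction h with
  | nil h => exact .nil ((hg 0 le_rfl).trans h)
  | snoc h hs ih =>
    simp only [List.length_append, List.length_singleton] at hg
    refine .snoc (ih fun i hi => hg i (by omega)) ?_
    rwa [hg _ (by omega), hg _ le_rfl]

theorem exists_trace {n : ℕ} {α : List (OpId n × Event)} {c : Config n} (h : Exec α c) :
    ∃ g : ℕ → GState n, IsTrace g α ∧ (g α.length).mem = c.mem ∧ (g α.length).loc = c.loc ∧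
      (g α.length).count = c.count := by
  have extend : ∀ {α : List (OpId n × Event)} {g : ℕ → GState n} {a : OpId n × Event}
      {s : GState n}, IsTrace g α → GStep α.length (g α.length) a s →
      ∃ g' : ℕ → GState n, IsTrace g' (α ++ [a]) ∧ g' (α ++ [a]).length = s := by
    intro α g a s hg hs
    refine ⟨Function.update g (α.length + 1) s, .snoc (hg.congr fun i hi => ?_) ?_, by simp⟩
    · rw [Function.update_of_ne (by omega)]
    · rwa [Function.update_self, Function.update_of_ne (by omega)]
  induction h with
  | initial => exact ⟨fun _ => GState.initial n, .nil rfl, rfl, rfl, rfl⟩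
  | @invoke β c p o h hp ih =>
    obtain ⟨g, hg, h1, h2, h3⟩ := ih
    have hs := GStep.invoke (i := β.length) (g _) p o (by rw [h2]; exact hp)
    rw [h3] at hs
    obtain ⟨g', hg', he⟩ := extend hg hs
    exact ⟨g', hg', by rw [he]; simp [GState.afterInvoke, h1, h2, h3]⟩
  | @step β c e l m p h hs ih =>
    obtain ⟨g, hg, h1, h2, h3⟩ := ih
    have hs' := GStep.step (i := β.length) (g _) p _ _ _ (by rw [h1, h2]; exact hs)
    rw [GState.cur, h3] at hs'
    obtain ⟨g', hg', he⟩ := extend hg hs'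
    exact ⟨g', hg', by rw [he]; simp [GState.afterStep, h2, h3]⟩

/-! ### The local invariant -/

/-- The operation of the given kind. -/
def opOf : Kind → ℤ → SetOp
  | .ins, v => .insert v
  | .rem, v => .remove v

/-- The nodes that a process has locked. -/
def holds : Loc → List Addr
  | .iWrite prev _ => [prev]
  | .rSpinVer prev _ => [prev]
  | .rSpinLock prev _ _ => [prev]
  | .rMark prev curr => [prev, curr]
  | .rNext prev curr => [prev, curr]
  | .rWrite prev curr _ => [prev, curr]
  | .unlockRead x xs => x :: xs
  | .unlockCas x xs _ => x :: xs
  | _ => []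

/-- The node that a process has created and will try to link. -/
def priv : Loc → Option Addr
  | .iLock _ _ _ x => some x
  | .iWrite _ x => some x
  | _ => none

/-- `x` was linked, and its value is below `v`. -/
def Below (m : VMem) (pub : Set Addr) (v : ℤ) (x : Addr) : Prop := x ∈ pub ∧ m.val x < intVal v

/-- `w` is a version that `x` had at some time. -/
def Ver (m : VMem) (x : Addr) (w : ℕ) : Prop := Even w ∧ w ≤ m.vlock x

/-- What is known after a successful validation: if the version of `prev` is still `pVer`, then
`prev` is undeleted and its successor is `curr`. -/
def Valid (m : VMem) (pub : Set Addr) (v : ℤ) (prev : Addr) (pVer : ℕ) (curr : Addr) : Prop :=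
  Below m pub v prev ∧ Ver m prev pVer ∧ curr ∈ pub ∧ ¬ m.val curr < intVal v ∧
    (m.vlock prev = pVer → m.deleted prev = false ∧ m.next prev = curr)

/-- What is known to a `remove` that has locked `prev`. -/
def Locked (m : VMem) (pub : Set Addr) (o : SetOp) (prev curr : Addr) : Prop :=
  ∃ v, o = .remove v ∧ Below m pub v prev ∧ curr ∈ pub ∧ m.val curr = intVal v ∧
    m.deleted prev = false ∧ m.next prev = curr

/-- The local invariant of a process that performs `o`. -/
def LocInv (m : VMem) (pub : Set Addr) (o : SetOp) : Loc → Prop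
  | .idle => True
  | .cTest v curr => o = .contains v ∧ curr ∈ pub
  | .cNext v curr => o = .contains v ∧ Below m pub v curr
  | .cVal v curr => o = .contains v ∧ curr ∈ pub ∧ ¬ m.val curr < intVal v
  | .cDel curr => ∃ v, o = .contains v ∧ curr ∈ pub ∧ m.val curr = intVal v
  | .tTest k v prev curr => o = opOf k v ∧ Below m pub v prev ∧ curr ∈ pub
  | .tNext k v curr => o = opOf k v ∧ Below m pub v curr
  | .vVer k v prev => o = opOf k v ∧ Below m pub v prev
  | .vDel k v prev pVer => o = opOf k v ∧ Below m pub v prev ∧ Ver m prev pVer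
  | .vNext k v prev pVer => o = opOf k v ∧ Below m pub v prev ∧ Ver m prev pVer ∧
      (m.vlock prev = pVer → m.deleted prev = false)
  | .vTest k v prev pVer curr => o = opOf k v ∧ Below m pub v prev ∧ Ver m prev pVer ∧
      curr ∈ pub ∧ (m.vlock prev = pVer → m.deleted prev = false ∧ m.next prev = curr)
  | .vCurrVer k v prev curr => o = opOf k v ∧ Below m pub v prev ∧ Below m pub v curr
  | .vCurrDel k v prev pVer curr =>
      o = opOf k v ∧ Below m pub v prev ∧ Below m pub v curr ∧ Ver m curr pVer
  | .vCurrNext k v pVer curr => o = opOf k v ∧ Below m pub v curr ∧ Ver m curr pVer ∧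
      (m.vlock curr = pVer → m.deleted curr = false)
  | .iDel v prev pVer curr => o = .insert v ∧ Valid m pub v prev pVer curr
  | .iVal v prev pVer curr => o = .insert v ∧ Valid m pub v prev pVer curr
  | .iCreate v prev pVer curr =>
      o = .insert v ∧ Valid m pub v prev pVer curr ∧ m.val curr ≠ intVal v
  | .iLock v prev pVer x => o = .insert v ∧ Below m pub v prev ∧ Ver m prev pVer ∧
      x ∈ m.alloc ∧ x ∉ pub ∧ m.val x = intVal v ∧ m.deleted x = false ∧
      (m.vlock prev = pVer → m.deleted prev = false ∧ m.next x = m.next prev)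
  | .iWrite prev x => ∃ v, o = .insert v ∧ Below m pub v prev ∧
      x ∈ m.alloc ∧ x ∉ pub ∧ m.val x = intVal v ∧ m.deleted x = false ∧
      m.deleted prev = false ∧ m.next x = m.next prev
  | .rVal v prev pVer curr => o = .remove v ∧ Valid m pub v prev pVer curr
  | .rDel v prev pVer curr =>
      o = .remove v ∧ Valid m pub v prev pVer curr ∧ m.val curr = intVal v
  | .rLock v prev pVer curr =>
      o = .remove v ∧ Valid m pub v prev pVer curr ∧ m.val curr = intVal v
  | .rSpinVer prev curr => Locked m pub o prev curr
  | .rSpinLock prev curr ver => Locked m pub o prev curr ∧ Even ver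
  | .rMark prev curr => Locked m pub o prev curr
  | .rNext prev curr => Locked m pub o prev curr ∧ m.deleted curr = true
  | .rWrite prev curr y => Locked m pub o prev curr ∧ m.deleted curr = true ∧ m.next curr = y
  | .unlockRead x xs => (x :: xs).Nodup ∧ ∀ y ∈ x :: xs, y ∈ pub
  | .unlockCas x xs w => (x :: xs).Nodup ∧ (∀ y ∈ x :: xs, y ∈ pub) ∧ m.vlock x = w
  | .ret _ => True

/-- What the steps of the other processes may do to the memory from the point of view of a process
that has locked the nodes in `H` and created the node in `X`: a field of a linked node is changed
only while some other process holds the lock of the node. -/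
structure Env (m : VMem) (pub : Set Addr) (m' : VMem) (pub' : Set Addr) (H : List Addr)
    (X : Option Addr) : Prop where
  alloc_sub : ∀ x ∈ m.alloc, x ∈ m'.alloc
  pub_sub : ∀ x ∈ pub, x ∈ pub'
  val_eq : ∀ x ∈ m.alloc, m'.val x = m.val x
  lock_le : ∀ x ∈ m.alloc, m.vlock x ≤ m'.vlock x
  lock_eq : ∀ x ∈ m.alloc, x ∈ H → m'.vlock x = m.vlock x
  field_eq : ∀ x ∈ m.alloc, (m'.next x = m.next x ∧ m'.deleted x = m.deleted x) ∨
    (Odd (m.vlock x) ∧ x ∉ H ∧ x ∈ pub)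
  priv_notMem : ∀ x ∈ X, x ∉ pub'

section Frame

variable {m m' : VMem} {pub pub' : Set Addr} {H : List Addr} {X : Option Addr} {v : ℤ} {o : SetOp}
  {prev curr : Addr} {w : ℕ}

theorem Env.fields (E : Env m pub m' pub' H X) {x : Addr} (ha : x ∈ m.alloc) (hx : Ver m x w)
    (h : m'.vlock x = w) :
    m.vlock x = w ∧ m'.next x = m.next x ∧ m'.deleted x = m.deleted x := by
  have h1 := E.lock_le x ha
  have h2 : m.vlock x = w := le_antisymm (h ▸ h1) hx.2
  refine ⟨h2, (E.field_eq x ha).resolve_right fun h3 => ?_⟩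
  rw [h2] at h3
  exact (Nat.not_odd_iff_even.mpr hx.1) h3.1

theorem Env.fields_priv (E : Env m pub m' pub' H X) {x : Addr} (ha : x ∈ m.alloc) (hx : x ∉ pub) :
    m'.next x = m.next x ∧ m'.deleted x = m.deleted x :=
  (E.field_eq x ha).resolve_right fun h => hx h.2.2

theorem Env.fields_held (E : Env m pub m' pub' H X) {x : Addr} (ha : x ∈ m.alloc) (hx : x ∈ H) :
    m'.next x = m.next x ∧ m'.deleted x = m.deleted x :=
  (E.field_eq x ha).resolve_right fun h => h.2.1 hx

variable (M : MemInv m pub) (E : Env m pub m' pub' H X)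
include M E

theorem Below.frame (h : Below m pub v curr) : Below m' pub' v curr :=
  ⟨E.pub_sub _ h.1, by rw [E.val_eq _ (M.pub_alloc _ h.1)]; exact h.2⟩

theorem Ver.frame (hc : curr ∈ pub) (h : Ver m curr w) : Ver m' curr w :=
  ⟨h.1, h.2.trans (E.lock_le _ (M.pub_alloc _ hc))⟩

theorem Valid.frame (h : Valid m pub v prev w curr) : Valid m' pub' v prev w curr := by
  obtain ⟨h1, h2, h3, h4, h5⟩ := h
  refine ⟨h1.frame M E, h2.frame M E h1.1, E.pub_sub _ h3, ?_, fun h => ?_⟩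
  · rwa [E.val_eq _ (M.pub_alloc _ h3)]
  · obtain ⟨h6, h7, h8⟩ := E.fields (M.pub_alloc _ h1.1) h2 h
    rw [h7, h8]; exact h5 h6

theorem Locked.frame (h : Locked m pub o prev curr) (hp : prev ∈ H) :
    Locked m' pub' o prev curr := by
  obtain ⟨v, h1, h2, h3, h4, h5, h6⟩ := h
  obtain ⟨h7, h8⟩ := E.fields_held (M.pub_alloc _ h2.1) hp
  exact ⟨v, h1, h2.frame M E, E.pub_sub _ h3, by rwa [E.val_eq _ (M.pub_alloc _ h3)],
    by rwa [h8], by rwa [h7]⟩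

omit E in
/-- The local invariant is stable under the steps of the other processes. -/
theorem LocInv.frame {l : Loc} (E : Env m pub m' pub' (holds l) (priv l))
    (h : LocInv m pub o l) : LocInv m' pub' o l := by
  have PA := M.pub_alloc
  cases l with
  | idle => trivial
  | cTest v curr => exact ⟨h.1, E.pub_sub _ h.2⟩
  | cNext v curr => exact ⟨h.1, h.2.frame M E⟩
  | cVal v curr => exact ⟨h.1, E.pub_sub _ h.2.1, by rw [E.val_eq _ (PA _ h.2.1)]; exact h.2.2⟩
  | cDel curr =>
    obtain ⟨v, h1, h2, h3⟩ := h
    exact ⟨v, h1, E.pub_sub _ h2, by rwa [E.val_eq _ (PA _ h2)]⟩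
  | tTest k v prev curr => exact ⟨h.1, h.2.1.frame M E, E.pub_sub _ h.2.2⟩
  | tNext k v curr => exact ⟨h.1, h.2.frame M E⟩
  | vVer k v prev => exact ⟨h.1, h.2.frame M E⟩
  | vDel k v prev pVer => exact ⟨h.1, h.2.1.frame M E, h.2.2.frame M E h.2.1.1⟩
  | vNext k v prev pVer =>
    obtain ⟨h1, h2, h3, h4⟩ := h
    refine ⟨h1, h2.frame M E, h3.frame M E h2.1, fun h => ?_⟩
    obtain ⟨h6, h7, h8⟩ := E.fields (PA _ h2.1) h3 h
    rw [h8]; exact h4 h6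
  | vTest k v prev pVer curr =>
    obtain ⟨h1, h2, h3, h4, h5⟩ := h
    refine ⟨h1, h2.frame M E, h3.frame M E h2.1, E.pub_sub _ h4, fun h => ?_⟩
    obtain ⟨h6, h7, h8⟩ := E.fields (PA _ h2.1) h3 h
    rw [h7, h8]; exact h5 h6
  | vCurrVer k v prev curr => exact ⟨h.1, h.2.1.frame M E, h.2.2.frame M E⟩
  | vCurrDel k v prev pVer curr =>
    exact ⟨h.1, h.2.1.frame M E, h.2.2.1.frame M E, h.2.2.2.frame M E h.2.2.1.1⟩
  | vCurrNext k v pVer curr =>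
    obtain ⟨h1, h2, h3, h4⟩ := h
    refine ⟨h1, h2.frame M E, h3.frame M E h2.1, fun h => ?_⟩
    obtain ⟨h6, h7, h8⟩ := E.fields (PA _ h2.1) h3 h
    rw [h8]; exact h4 h6
  | iDel v prev pVer curr => exact ⟨h.1, h.2.frame M E⟩
  | iVal v prev pVer curr => exact ⟨h.1, h.2.frame M E⟩
  | iCreate v prev pVer curr =>
    exact ⟨h.1, h.2.1.frame M E, by rw [E.val_eq _ (PA _ h.2.1.2.2.1)]; exact h.2.2⟩
  | iLock v prev pVer x =>
    obtain ⟨h1, h2, h3, h4, h5, h6, h7, h8⟩ := h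
    obtain ⟨hn, hd⟩ := E.fields_priv h4 h5
    refine ⟨h1, h2.frame M E, h3.frame M E h2.1, E.alloc_sub _ h4, E.priv_notMem x rfl,
      by rwa [E.val_eq _ h4], by rwa [hd], fun h => ?_⟩
    obtain ⟨k1, k2, k3⟩ := E.fields (PA _ h2.1) h3 h
    rw [k2, k3, hn]; exact h8 k1
  | iWrite prev x =>
    obtain ⟨v, h1, h2, h4, h5, h6, h7, h8, h9⟩ := h
    obtain ⟨hn, hd⟩ := E.fields_priv h4 h5
    obtain ⟨hn', hd'⟩ := E.fields_held (PA _ h2.1) (by simp [holds])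
    exact ⟨v, h1, h2.frame M E, E.alloc_sub _ h4, E.priv_notMem x rfl,
      by rwa [E.val_eq _ h4], by rwa [hd], by rwa [hd'], by rwa [hn, hn']⟩
  | rVal v prev pVer curr => exact ⟨h.1, h.2.frame M E⟩
  | rDel v prev pVer curr =>
    exact ⟨h.1, h.2.1.frame M E, by rw [E.val_eq _ (PA _ h.2.1.2.2.1)]; exact h.2.2⟩
  | rLock v prev pVer curr =>
    exact ⟨h.1, h.2.1.frame M E, by rw [E.val_eq _ (PA _ h.2.1.2.2.1)]; exact h.2.2⟩
  | rSpinVer prev curr => exact Locked.frame M E h (by simp [holds])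
  | rSpinLock prev curr ver => exact ⟨h.1.frame M E (by simp [holds]), h.2⟩
  | rMark prev curr => exact Locked.frame M E h (by simp [holds])
  | rNext prev curr =>
    obtain ⟨v, h1, h2, h3, h4⟩ := h.1
    obtain ⟨hn, hd⟩ := E.fields_held (PA _ h3) (by simp [holds])
    exact ⟨h.1.frame M E (by simp [holds]), by rw [hd]; exact h.2⟩
  | rWrite prev curr y =>
    obtain ⟨v, h1, h2, h3, h4⟩ := h.1
    obtain ⟨hn, hd⟩ := E.fields_held (PA _ h3) (by simp [holds])
    exact ⟨h.1.frame M E (by simp [holds]), by rw [hd]; exact h.2.1, by rw [hn]; exact h.2.2⟩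
  | unlockRead x xs => exact ⟨h.1, fun y hy => E.pub_sub _ (h.2 y hy)⟩
  | unlockCas x xs w =>
    refine ⟨h.1, fun y hy => E.pub_sub _ (h.2.1 y hy), ?_⟩
    rw [E.lock_eq x (PA _ (h.2.1 x (by simp))) (by simp [holds])]; exact h.2.2
  | ret b => trivial

end Frame

end VL

/-! ### Preservation of the invariants -/

namespace VL

theorem even_version (w : ℕ) : Even (version w) := ⟨w / 2, by unfold version; omega⟩

theorem version_le (w : ℕ) : version w ≤ w := by unfold version; omega

theorem ver_version (m : VMem) (x : Addr) : Ver m x (version (m.vlock x)) :=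
  ⟨even_version _, version_le _⟩

/-- The process is about to unlink the node `x`, which it has marked. -/
def Marking (x : Addr) : Loc → Prop
  | .rNext _ curr => curr = x
  | .rWrite _ curr _ => curr = x
  | _ => False

section Step

variable {m m' : VMem} {pub : Set Addr} {o : SetOp} {l l' : Loc} {e : Event}

theorem MemInv.congr (M : MemInv m pub) (ha : m'.alloc = m.alloc) (hv : m'.val = m.val)
    (hn : m'.next = m.next) (hd : ∀ x, m'.deleted x = false → m.deleted x = false) :
    MemInv m' pub := by
  constructor
  · rw [ha]; exact M.head_alloc
  · rw [ha]; exact M.tail_alloc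
  · rw [hv]; exact M.val_head
  · rw [hv]; exact M.val_tail
  · rw [hn]; exact M.next_tail
  · rw [ha, hn]; exact M.next_alloc
  · rw [ha, hv, hn]; exact M.sorted
  · rw [ha]; exact M.pub_alloc
  · exact M.head_pub
  · rw [hn]; exact M.next_pub
  · rw [hn]; exact fun x hx h => M.pub_reach x hx (hd x h)

theorem reach_congr {nx nx' : Addr → Addr} {x : Addr} (hr : Reach nx x)
    (h : ∀ y, Reach nx y → nx' y = nx y) : Reach nx' x := by
  refine hr.induct Reach.head fun y hy ih => ?_
  rw [← h y hy]
  exact ih.next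

theorem reach_createNode {x y : Addr} {v : ℤ} {curr : Addr} (M : MemInv m pub) (hx : x ∉ m.alloc) :
    Reach (createNode m x v curr).next y ↔ Reach m.next y := by
  have h1 : ∀ z, Reach m.next z → (createNode m x v curr).next z = m.next z := fun z hz =>
    Function.update_of_ne (fun h : z = x => hx (h ▸ M.reach_alloc hz)) _ _
  refine ⟨fun h => ?_, fun h => reach_congr h h1⟩
  refine h.induct Reach.head fun z _ ih => ?_
  rw [h1 z ih]
  exact ih.next

theorem MemInv.createNode {x : Addr} {v : ℤ} {curr : Addr} (M : MemInv m pub) (hx : x ∉ m.alloc)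
    (hc : curr ∈ m.alloc) (hv : intVal v < m.val curr) : MemInv (createNode m x v curr) pub := by
  have hne : ∀ {y}, y ∈ m.alloc → y ≠ x := fun hy h => hx (h ▸ hy)
  have A : ∀ {y}, y ∈ (VL.createNode m x v curr).alloc → y = x ∨ y ∈ m.alloc := fun h => h
  have V : ∀ {y}, y ∈ m.alloc → (VL.createNode m x v curr).val y = m.val y := fun hy =>
    Function.update_of_ne (hne hy) _ _
  have N : ∀ {y}, y ∈ m.alloc → (VL.createNode m x v curr).next y = m.next y := fun hy =>
    Function.update_of_ne (hne hy) _ _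
  have D : ∀ {y}, y ∈ m.alloc → (VL.createNode m x v curr).deleted y = m.deleted y := fun hy =>
    Function.update_of_ne (hne hy) _ _
  have Vx : (VL.createNode m x v curr).val x = intVal v := Function.update_self _ _ _
  have Nx : (VL.createNode m x v curr).next x = curr := Function.update_self _ _ _
  constructor
  · exact Or.inr M.head_alloc
  · exact Or.inr M.tail_alloc
  · rw [V M.head_alloc]; exact M.val_head
  · rw [V M.tail_alloc]; exact M.val_tail
  · rw [N M.tail_alloc]; exact M.next_tail
  · intro y hy
    rcases A hy with rfl | hy
    · rw [Nx]; exact Or.inr hc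
    · rw [N hy]; exact Or.inr (M.next_alloc y hy)
  · intro y hy h1
    rcases A hy with rfl | hy
    · rw [Nx, Vx, V hc]; exact hv
    · rw [N hy, V hy, V (M.next_alloc y hy)]; exact M.sorted y hy h1
  · exact fun y hy => Or.inr (M.pub_alloc y hy)
  · exact M.head_pub
  · intro y hy
    rw [N (M.pub_alloc y hy)]; exact M.next_pub y hy
  · intro y hy hd
    rw [D (M.pub_alloc y hy)] at hd
    exact (reach_createNode M hx).mpr (M.pub_reach y hy hd)

/-- The new node `x` is linked between `prev` and its successor. -/
theorem MemInv.link {prev x : Addr} {v : ℤ} (M : MemInv m pub) (hp : Below m pub v prev)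
    (hx : x ∈ m.alloc) (hxp : x ∉ pub) (hv : m.val x = intVal v) (hd : m.deleted prev = false)
    (hn : m.next x = m.next prev) : MemInv (setNext m prev x) (insert x pub) := by
  have hr := M.pub_reach prev hp.1 hd
  have hpt := M.ne_tail_of_lt hp.2
  have hxt := M.ne_tail_of_eq hv
  have hne : x ≠ prev := fun h => hxp (h ▸ hp.1)
  have N : ∀ {y}, y ≠ prev → (setNext m prev x).next y = m.next y := fun hy =>
    Function.update_of_ne hy _ _
  have Np : (setNext m prev x).next prev = x := Function.update_self _ _ _
  constructor
  · exact M.head_alloc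
  · exact M.tail_alloc
  · exact M.val_head
  · exact M.val_tail
  · rw [N hpt.symm]; exact M.next_tail
  · intro y hy
    by_cases h : y = prev
    · subst h; rw [Np]; exact hx
    · rw [N h]; exact M.next_alloc y hy
  · intro y hy h1
    by_cases h : y = prev
    · subst h
      rw [Np]
      change m.val y < m.val x
      rw [hv]; exact hp.2
    · rw [N h]; exact M.sorted y hy h1
  · rintro y (rfl | hy)
    · exact hx
    · exact M.pub_alloc y hy
  · exact Or.inr M.head_pub
  · intro y hy
    by_cases h : y = prev
    · subst h; rw [Np]; exact Or.inl rfl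
    · rw [N h]
      rcases hy with rfl | hy
      · rw [hn]; exact Or.inr (M.next_pub _ hp.1)
      · exact Or.inr (M.next_pub y hy)
  · intro y hy hdy
    rcases hy with rfl | hy
    · have h1 := (reach_of_link hn hne hr).next
      rw [Function.update_self] at h1
      exact h1
    · exact reach_of_link hn hne (M.pub_reach y hy hdy)

theorem Locked.reach (h : Locked m pub o l₁ l₂) (M : MemInv m pub) :
    Reach m.next l₁ ∧ m.next l₁ = l₂ ∧ l₁ ≠ Addr.tail ∧ l₂ ≠ Addr.tail ∧ m.val l₁ < m.val l₂ := by
  obtain ⟨v, h1, h2, h3, h4, h5, h6⟩ := h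
  exact ⟨M.pub_reach _ h2.1 h5, h6, M.ne_tail_of_lt h2.2, M.ne_tail_of_eq h4, h4 ▸ h2.2⟩

/-- The node `curr`, which has been marked, is unlinked. -/
theorem MemInv.unlink {prev curr : Addr} (M : MemInv m pub) (h : Locked m pub o prev curr)
    (hd : m.deleted curr = true) : MemInv (setNext m prev (m.next curr)) pub := by
  obtain ⟨hr, hc, hpt, hct, hlt⟩ := h.reach M
  have hca := M.reach_alloc (hc ▸ hr.next)
  have N : ∀ {y}, y ≠ prev → (setNext m prev (m.next curr)).next y = m.next y := fun hy =>
    Function.update_of_ne hy _ _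
  have Np : (setNext m prev (m.next curr)).next prev = m.next curr := Function.update_self _ _ _
  constructor
  · exact M.head_alloc
  · exact M.tail_alloc
  · exact M.val_head
  · exact M.val_tail
  · rw [N hpt.symm]; exact M.next_tail
  · intro y hy
    by_cases h : y = prev
    · subst h; rw [Np]; exact M.next_alloc _ hca
    · rw [N h]; exact M.next_alloc y hy
  · intro y hy h1
    by_cases h : y = prev
    · subst h; rw [Np]
      exact hlt.trans (M.sorted _ hca hct)
    · rw [N h]; exact M.sorted y hy h1
  · exact M.pub_alloc
  · exact M.head_pub
  · intro y hy
    by_cases h : y = prev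
    · subst h; rw [Np, ← hc]; exact M.next_pub _ (M.next_pub _ hy)
    · rw [N h]; exact M.next_pub y hy
  · intro y hy hdy
    refine M.reach_of_unlink hr hc hpt hct (M.pub_reach y hy hdy) ?_
    rintro rfl
    have : m.deleted y = false := hdy
    simp [hd] at this

variable (M : MemInv m pub) (h : LocInv m pub o l) (hs : LStep l m e l' m')
include M h hs

theorem MemInv.step : MemInv m' (pubAfter e pub) := by
  cases hs with
  | iLock_ok | rLock_ok | rSpinLock_ok | unlockCas_ok => exact M.congr rfl rfl rfl fun _ => id
  | iCreate v prev pVer curr m x hx =>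
    obtain ⟨-, h1, h2⟩ := h
    exact M.createNode hx (M.pub_alloc _ h1.2.2.1) (lt_of_le_of_ne (not_lt.mp h1.2.2.2.1) h2.symm)
  | iWrite prev x m =>
    obtain ⟨v, -, h1, h2, h3, h4, h5, h6, h7⟩ := h
    exact M.link h1 h2 h3 h4 h6 h7
  | rMark prev curr m =>
    refine M.congr rfl rfl rfl fun x hx => ?_
    by_cases hxc : x = curr
    · subst hxc; simp at hx
    · simpa [hxc] using hx
  | rWrite prev curr y m =>
    obtain ⟨h1, h2, rfl⟩ := h
    have h3 : m.next curr ∈ pub := by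
      obtain ⟨v, -, -, h4, -⟩ := h1
      exact M.next_pub _ h4
    have := M.unlink h1 h2
    rwa [← Set.insert_eq_of_mem h3] at this
  | _ => exact M

theorem LocInv.step : LocInv m' (pubAfter e pub) o l' := by
  cases hs with
  | cTest_lt v curr m h' => exact ⟨h.1, h.2, h'⟩
  | cTest_ge v curr m h' => exact ⟨h.1, h.2, h'⟩
  | cNext v curr m => exact ⟨h.1, M.next_pub _ h.2.1⟩
  | cVal_eq v curr m h' => exact ⟨v, h.1, h.2.1, h'⟩
  | cVal_ne v curr m h' => trivial
  | cDel curr m => trivial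
  | tTest_lt k v prev curr m h' => exact ⟨h.1, h.2.2, h'⟩
  | tTest_ge k v prev curr m h' => exact ⟨h.1, h.2.1⟩
  | tNext k v curr m => exact ⟨h.1, h.2, M.next_pub _ h.2.1⟩
  | vVer k v prev m => exact ⟨h.1, h.2, ver_version _ _⟩
  | vDel_true k v prev pVer m h' =>
    exact ⟨h.1, ⟨M.head_pub, by rw [M.val_head]; exact bot_lt_intVal v⟩, M.head_pub⟩
  | vDel_false k v prev pVer m h' => exact ⟨h.1, h.2.1, h.2.2, fun _ => h'⟩
  | vNext k v prev pVer m =>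
    exact ⟨h.1, h.2.1, h.2.2.1, M.next_pub _ h.2.1.1, fun hv => ⟨h.2.2.2 hv, rfl⟩⟩
  | vTest_lt k v prev pVer curr m h' => exact ⟨h.1, h.2.1, h.2.2.2.1, h'⟩
  | vTest_ge k v prev pVer curr m h' =>
    cases k with
    | ins => exact ⟨h.1, h.2.1, h.2.2.1, h.2.2.2.1, h', h.2.2.2.2⟩
    | rem => exact ⟨h.1, h.2.1, h.2.2.1, h.2.2.2.1, h', h.2.2.2.2⟩
  | vCurrVer k v prev curr m => exact ⟨h.1, h.2.1, h.2.2, ver_version _ _⟩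
  | vCurrDel_true k v prev pVer curr m h' => exact ⟨h.1, h.2.1⟩
  | vCurrDel_false k v prev pVer curr m h' => exact ⟨h.1, h.2.2.1, h.2.2.2, fun _ => h'⟩
  | vCurrNext k v pVer curr m =>
    exact ⟨h.1, h.2.1, h.2.2.1, M.next_pub _ h.2.1.1, fun hv => ⟨h.2.2.2 hv, rfl⟩⟩
  | iDel_true v prev pVer curr m h' => exact ⟨h.1, h.2.1⟩
  | iDel_false v prev pVer curr m h' => exact h
  | iVal_eq v prev pVer curr m h' => trivial
  | iVal_ne v prev pVer curr m h' => exact ⟨h.1, h.2, h'⟩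
  | iCreate v prev pVer curr m x hx =>
    obtain ⟨h1, ⟨h2, h3, h4, h5, h6⟩, h7⟩ := h
    have hpx : prev ≠ x := fun h => hx (h ▸ M.pub_alloc _ h2.1)
    refine ⟨h1, ⟨h2.1, ?_⟩, ⟨h3.1, ?_⟩, Or.inl rfl, fun h => hx (M.pub_alloc _ h),
      Function.update_self _ _ _, Function.update_self _ _ _, ?_⟩
    · change Function.update m.val x _ prev < _
      rw [Function.update_of_ne hpx]; exact h2.2
    · change _ ≤ Function.update m.vlock x _ prev
      rw [Function.update_of_ne hpx]; exact h3.2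
    · change Function.update m.vlock x _ prev = _ → Function.update m.deleted x _ prev = _ ∧
        Function.update m.next x _ x = Function.update m.next x _ prev
      rw [Function.update_of_ne hpx, Function.update_of_ne hpx, Function.update_of_ne hpx,
        Function.update_self]
      exact fun h => ⟨(h6 h).1, (h6 h).2.symm⟩
  | iLock_ok v prev pVer x m h' =>
    obtain ⟨h1, h2, h3, h4, h5, h6, h7, h8⟩ := h
    exact ⟨v, h1, h2, h4, h5, h6, h7, h8 h'⟩
  | iLock_fail v prev pVer x m h' => exact ⟨h.1, h.2.1⟩
  | iWrite prev x m =>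
    obtain ⟨v, h1, h2, h3⟩ := h
    exact ⟨by simp, by simpa [pubAfter] using Or.inr h2.1⟩
  | rVal_ne v prev pVer curr m h' => trivial
  | rVal_eq v prev pVer curr m h' => exact ⟨h.1, h.2, h'⟩
  | rDel_true v prev pVer curr m h' => trivial
  | rDel_false v prev pVer curr m h' => exact h
  | rLock_ok v prev pVer curr m h' =>
    obtain ⟨h1, ⟨h2, h3, h4, h5, h6⟩, h7⟩ := h
    exact ⟨v, h1, h2, h4, h7, h6 h'⟩
  | rLock_fail v prev pVer curr m h' => exact ⟨h.1, h.2.1.1⟩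
  | rSpinVer prev curr m => exact ⟨h, even_version _⟩
  | rSpinLock_ok prev curr ver m h' => exact h.1
  | rSpinLock_fail prev curr ver m h' => exact h.1
  | rMark prev curr m =>
    obtain ⟨-, -, -, -, hlt⟩ := Locked.reach h M
    obtain ⟨v, h1, h2, h3, h4, h5, h6⟩ := h
    have hne : prev ≠ curr := fun h => absurd hlt (h ▸ lt_irrefl _)
    refine ⟨⟨v, h1, h2, h3, h4, ?_, h6⟩, Function.update_self _ _ _⟩
    change Function.update m.deleted _ _ _ = _
    rw [Function.update_of_ne hne]; exact h5
  | rNext prev curr m => exact ⟨h.1, h.2, rfl⟩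
  | rWrite prev curr y m =>
    obtain ⟨-, -, -, -, hlt⟩ := h.1.reach M
    obtain ⟨⟨v, h1, h2, h3, h4, h5, h6⟩, h7, h8⟩ := h
    have hne : prev ≠ curr := fun h => absurd hlt (h ▸ lt_irrefl _)
    exact ⟨by simp [hne.symm], by simpa [pubAfter] using ⟨Or.inr h3, Or.inr h2.1⟩⟩
  | unlockRead x xs m => exact ⟨h.1, h.2, rfl⟩
  | unlockCas_ok x xs w m h' =>
    obtain ⟨h1, h2, h3⟩ := h
    cases xs with
    | nil => trivial
    | cons y ys => exact ⟨h1.of_cons, fun z hz => h2 z (List.mem_cons_of_mem _ hz)⟩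
  | unlockCas_fail x xs w m h' => exact absurd h.2.2 h'
  | ret b m => trivial

omit M in
/-- A lock that is taken was free before: the process has read an even value of the counter. -/
theorem holds_step (hl : ∀ x ∈ holds l, Odd (m.vlock x)) :
    ∀ x ∈ holds l', Odd (m'.vlock x) ∧ (x ∈ holds l ∨ Even (m.vlock x)) := by
  intro z hz
  cases hs with
  | vTest_ge k v prev pVer curr m h' => cases k <;> simp [afterValidate, holds] at hz
  | iLock_ok v prev pVer x m h' =>
    simp only [holds, List.mem_singleton] at hz
    subst hz
    exact ⟨by simpa [setLock] using h.2.2.1.1.add_one, Or.inr (h' ▸ h.2.2.1.1)⟩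
  | rLock_ok v prev pVer curr m h' =>
    simp only [holds, List.mem_singleton] at hz
    subst hz
    exact ⟨by simpa [setLock] using h.2.1.2.1.1.add_one, Or.inr (h' ▸ h.2.1.2.1.1)⟩
  | rSpinLock_ok prev curr ver m h' =>
    have hp := hl prev (by simp [holds])
    have hc : Even (m.vlock curr) := h' ▸ h.2
    have hne : prev ≠ curr := fun h => Nat.not_even_iff_odd.mpr hp (h ▸ hc)
    simp only [holds, List.mem_cons, List.not_mem_nil, or_false] at hz
    rcases hz with rfl | rfl
    · exact ⟨by simpa [setLock, hne] using hp, Or.inl (by simp [holds])⟩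
    · exact ⟨by simpa [setLock] using h.2.add_one, Or.inr hc⟩
  | unlockCas_ok x xs w m h' =>
    have hz' : z ∈ xs := by
      cases xs with
      | nil => simp [afterUnlock, holds] at hz
      | cons y ys => exact hz
    have hne : z ≠ x := fun h3 => (List.nodup_cons.mp h.1).1 (h3 ▸ hz')
    have hz2 : z ∈ holds (.unlockCas x xs w) := List.mem_cons_of_mem _ hz'
    exact ⟨by simpa [setLock, hne] using hl z hz2, Or.inl hz2⟩
  | unlockCas_fail x xs w m h' => exact absurd h.2.2 h'
  | iWrite prev x m =>
    simp only [holds, List.mem_singleton] at hz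
    subst hz
    exact ⟨hl z (by simp [holds]), Or.inl (by simp [holds])⟩
  | rMark prev curr m => exact ⟨hl z hz, Or.inl hz⟩
  | rWrite prev curr m =>
    have hz' : z ∈ [prev, curr] := by
      simp only [holds, List.mem_cons, List.not_mem_nil, or_false] at hz ⊢
      exact hz.symm
    exact ⟨hl z hz', Or.inl hz'⟩
  | rSpinVer | rSpinLock_fail | rNext | unlockRead => exact ⟨hl z hz, Or.inl hz⟩
  | _ => simp [holds, traversal] at hz

omit M h in
theorem priv_step : ∀ x ∈ priv l', x ∈ priv l ∨ x ∉ m.alloc := by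
  intro z hz
  cases hs with
  | vTest_ge k v prev pVer curr m h' => cases k <;> simp [afterValidate, priv] at hz
  | unlockCas_ok x xs w m h' => cases xs <;> simp [afterUnlock, priv] at hz
  | unlockCas_fail x xs w m h' => cases xs <;> simp [afterUnlock, priv] at hz
  | iLock_ok v prev pVer x m h' => exact Or.inl hz
  | iCreate v prev pVer curr m x hx =>
    simp only [priv, Option.mem_def, Option.some.injEq] at hz
    exact Or.inr (hz ▸ hx)
  | _ => simp [priv, traversal] at hz

/-- If a node is marked and reachable, then some process is about to unlink it: either this was so
before, or the process that takes the step has just marked the node. -/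
theorem marking_step {x : Addr} (hr : Reach m'.next x) (hd : m'.deleted x = true) :
    Marking x l' ∨ (Reach m.next x ∧ m.deleted x = true ∧ ¬ Marking x l) := by
  cases hs with
  | iCreate v prev pVer curr m y hy =>
    have h1 := (reach_createNode M hy).mp hr
    have hne : x ≠ y := fun h => hy (h ▸ M.reach_alloc h1)
    exact Or.inr ⟨h1, by simpa [createNode, hne] using hd, id⟩
  | iWrite prev y m =>
    obtain ⟨v, -, h1, h2, h3, h4, h5, h6, h7⟩ := h
    have hne : y ≠ prev := fun h => h3 (h ▸ h1.1)
    rcases reach_link h7 hne (M.pub_reach _ h1.1 h6) hr with h8 | rfl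
    · exact Or.inr ⟨h8, hd, id⟩
    · have hd' : m.deleted x = true := hd
      simp [h5] at hd'
  | rMark prev curr m =>
    by_cases hx : x = curr
    · exact Or.inl hx.symm
    · exact Or.inr ⟨hr, by simpa [hx] using hd, id⟩
  | rNext prev curr m =>
    by_cases hx : curr = x
    · exact Or.inl hx
    · exact Or.inr ⟨hr, hd, hx⟩
  | rWrite prev curr y m =>
    obtain ⟨h1, h2, rfl⟩ := h
    obtain ⟨k1, k2, k3, k4, -⟩ := h1.reach M
    obtain ⟨h5, h6⟩ := M.reach_unlink k1 k2 k3 k4 hr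
    exact Or.inr ⟨h5, hd, h6.symm⟩
  | _ => exact Or.inr ⟨hr, hd, id⟩

/-- A step of a process changes the fields of linked nodes only under their locks; so it cannot
interfere with the nodes `H` that another process has locked and the node `X` that it has
created. -/
theorem env_step {H : List Addr} {X : Option Addr} (hl : ∀ x ∈ holds l, Odd (m.vlock x))
    (hH : ∀ x ∈ H, Odd (m.vlock x) ∧ x ∉ holds l)
    (hX : ∀ x ∈ X, x ∉ pub ∧ x ∉ priv l) : Env m pub m' (pubAfter e pub) H X := by
  have env_refl : Env m pub m pub H X :=
    ⟨fun _ => id, fun _ => id, fun _ _ => rfl, fun _ _ => le_rfl, fun _ _ _ => rfl,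
      fun _ _ => Or.inl ⟨rfl, rfl⟩, fun x hx => (hX x hx).1⟩
  have env_lock : ∀ x w, m.vlock x = w → x ∉ H → Env m pub (setLock m x (w + 1)) pub H X := by
    intro x w hw hx
    refine ⟨fun _ => id, fun _ => id, fun _ _ => rfl, fun y _ => ?_, fun y _ hy => ?_,
      fun _ _ => Or.inl ⟨rfl, rfl⟩, fun x hx => (hX x hx).1⟩
    · change _ ≤ Function.update m.vlock x _ y
      by_cases h : y = x
      · subst h; rw [Function.update_self]; omega
      · rw [Function.update_of_ne h]
    · change Function.update m.vlock x _ y = _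
      rw [Function.update_of_ne (fun h : y = x => hx (h ▸ hy))]
  have env_next : ∀ x y, Odd (m.vlock x) → x ∉ H → x ∈ pub → y ∉ X →
      Env m pub (setNext m x y) (insert y pub) H X := by
    intro x y h1 h2 h3 h4
    refine ⟨fun _ => id, fun _ => Or.inr, fun _ _ => rfl, fun _ _ => le_rfl, fun _ _ _ => rfl,
      fun z _ => ?_, fun z hz => ?_⟩
    · by_cases h : z = x
      · exact Or.inr (h ▸ ⟨h1, h2, h3⟩)
      · exact Or.inl ⟨Function.update_of_ne h _ _, rfl⟩
    · rintro (rfl | h5)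
      · exact h4 hz
      · exact (hX z hz).1 h5
  have even_notMem : ∀ x, Even (m.vlock x) → x ∉ H := fun x hx h =>
    Nat.not_even_iff_odd.mpr (hH x h).1 hx
  cases hs with
  | iLock_ok v prev pVer x m h' => exact env_lock _ _ h' (even_notMem _ (h' ▸ h.2.2.1.1))
  | rLock_ok v prev pVer curr m h' => exact env_lock _ _ h' (even_notMem _ (h' ▸ h.2.1.2.1.1))
  | rSpinLock_ok prev curr ver m h' => exact env_lock _ _ h' (even_notMem _ (h' ▸ h.2))
  | unlockCas_ok x xs w m h' =>
    exact env_lock _ _ h' fun h3 => (hH _ h3).2 (by simp [holds])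
  | iCreate v prev pVer curr m x hx =>
    have hne : ∀ y ∈ m.alloc, y ≠ x := fun y hy h => hx (h ▸ hy)
    refine ⟨fun _ => Or.inr, fun _ => id, fun y hy => ?_, fun y hy => ?_, fun y hy _ => ?_,
      fun y hy => Or.inl ⟨?_, ?_⟩, fun x hx => (hX x hx).1⟩ <;>
      simp [createNode, hne y hy]
  | iWrite prev x m =>
    obtain ⟨v, -, h1, -⟩ := h
    exact env_next _ _ (hl _ (by simp [holds])) (fun h3 => (hH _ h3).2 (by simp [holds])) h1.1
      fun h3 => (hX x h3).2 rfl
  | rMark prev curr m =>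
    obtain ⟨v, -, -, h1, -⟩ := h
    refine ⟨fun _ => id, fun _ => id, fun _ _ => rfl, fun _ _ => le_rfl, fun _ _ _ => rfl,
      fun z _ => ?_, fun x hx => (hX x hx).1⟩
    by_cases h : z = curr
    · exact Or.inr (h ▸ ⟨hl _ (by simp [holds]), fun h3 => (hH _ h3).2 (by simp [holds]), h1⟩)
    · exact Or.inl ⟨rfl, Function.update_of_ne h _ _⟩
  | rWrite prev curr y m =>
    obtain ⟨⟨v, -, h1, h2, -⟩, -, rfl⟩ := h
    exact env_next _ _ (hl _ (by simp [holds])) (fun h3 => (hH _ h3).2 (by simp [holds])) h1.1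
      fun h3 => (hX _ h3).1 (M.next_pub _ h2)
  | _ => exact env_refl

end Step

/-- The invariant of the configurations: the invariants of the memory and of the local states, the
fact that each lock has at most one holder and each new node at most one owner, and the fact that
a marked node can be reached only while it is about to be unlinked. -/
structure Inv {n : ℕ} (s : GState n) : Prop where
  mem : MemInv s.mem s.pub
  loc : ∀ p, LocInv s.mem s.pub (s.op (s.cur p)) (s.loc p)
  odd : ∀ p, ∀ x ∈ holds (s.loc p), Odd (s.mem.vlock x)
  holds_inj : ∀ p q, ∀ x ∈ holds (s.loc p), x ∈ holds (s.loc q) → p = q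
  priv_inj : ∀ p q, ∀ x ∈ priv (s.loc p), x ∈ priv (s.loc q) → p = q
  marking : ∀ x, Reach s.mem.next x → s.mem.deleted x = true → ∃ p, Marking x (s.loc p)

theorem LocInv.priv {m : VMem} {pub : Set Addr} {o : SetOp} {l : Loc} (h : LocInv m pub o l)
    {x : Addr} (hx : x ∈ priv l) : x ∈ m.alloc ∧ x ∉ pub := by
  cases l with
  | iLock v prev pVer y =>
    simp only [VL.priv, Option.mem_def, Option.some.injEq] at hx
    subst hx
    exact ⟨h.2.2.2.1, h.2.2.2.2.1⟩
  | iWrite prev y =>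
    simp only [VL.priv, Option.mem_def, Option.some.injEq] at hx
    subst hx
    obtain ⟨v, -, -, h1, h2, -⟩ := h
    exact ⟨h1, h2⟩
  | _ => simp [VL.priv] at hx

theorem LocInv.holds_pub {m : VMem} {pub : Set Addr} {o : SetOp} {l : Loc} (h : LocInv m pub o l)
    {x : Addr} (hx : x ∈ holds l) : x ∈ pub := by
  have locked : ∀ {prev curr : Addr}, Locked m pub o prev curr → x ∈ [prev, curr] → x ∈ pub := by
    rintro prev curr ⟨v, -, h1, h2, -⟩ hx
    simp only [List.mem_cons, List.not_mem_nil, or_false] at hx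
    rcases hx with rfl | rfl
    · exact h1.1
    · exact h2
  cases l with
  | iWrite prev y =>
    obtain ⟨v, -, h1, -⟩ := h
    simp only [holds, List.mem_singleton] at hx
    exact hx ▸ h1.1
  | rSpinVer prev curr => exact locked h (List.mem_cons.mpr (Or.inl (List.mem_singleton.mp hx)))
  | rSpinLock prev curr => exact locked h.1 (List.mem_cons.mpr (Or.inl (List.mem_singleton.mp hx)))
  | rMark prev curr => exact locked h hx
  | rNext prev curr => exact locked h.1 hx
  | rWrite prev curr y => exact locked h.1 hx
  | unlockRead y ys => exact h.2 x hx
  | unlockCas y ys w => exact h.2.1 x hx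
  | _ => simp [holds] at hx

theorem Inv.env {n : ℕ} {s : GState n} (I : Inv s) {p q : Fin n} (hq : q ≠ p) {e : Event} {l : Loc}
    {m : VMem} (hs : LStep (s.loc p) s.mem e l m) :
    Env s.mem s.pub m (pubAfter e s.pub) (holds (s.loc q)) (priv (s.loc q)) :=
  env_step I.mem (I.loc p) hs (I.odd p)
    (fun x hx => ⟨I.odd q x hx, fun h => hq (I.holds_inj q p x hx h)⟩)
    fun x hx => ⟨((I.loc q).priv hx).2, fun h => hq (I.priv_inj q p x hx h)⟩

theorem Inv.initial (n : ℕ) : Inv (GState.initial n) where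
  mem := by
    have hr : ∀ x, Reach VMem.initial.next x → x = Addr.head ∨ x = Addr.tail := fun x h =>
      h.induct (Or.inl rfl) fun y _ _ => Or.inr rfl
    constructor
    · exact Or.inl rfl
    · exact Or.inr rfl
    · rfl
    · rfl
    · rfl
    · exact fun _ _ => Or.inr rfl
    · rintro x (rfl | rfl) h
      · exact bot_lt_top
      · exact absurd rfl h
    · exact fun _ => id
    · exact Or.inl rfl
    · exact fun _ _ => Or.inr rfl
    · rintro x (rfl | rfl) -
      · exact Reach.head
      · exact Reach.head.next
  loc := fun _ => trivial
  odd := fun _ x hx => by simp [GState.initial, holds] at hx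
  holds_inj := fun _ _ x hx => by simp [GState.initial, holds] at hx
  priv_inj := fun _ _ x hx => by simp [GState.initial, priv] at hx
  marking := fun x _ h => by simp [GState.initial, VMem.initial] at h

theorem Inv.step {n i : ℕ} {s s' : GState n} {a : OpId n × Event} (I : Inv s)
    (hs : GStep i s a s') : Inv s' := by
  cases hs with
  | invoke p o hp =>
    have hst : holds (start o) = [] ∧ priv (start o) = none ∧ ∀ x, ¬ Marking x (start o) := by
      cases o <;> exact ⟨rfl, rfl, fun _ => id⟩
    have L : ∀ q, q ≠ p → (s.afterInvoke i p o).loc q = s.loc q := fun q hq =>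
      Function.update_of_ne hq _ _
    have Lp : (s.afterInvoke i p o).loc p = start o := Function.update_self _ _ _
    refine ⟨I.mem, fun q => ?_, fun q => ?_, fun q r x => ?_, fun q r x => ?_, fun x h1 h2 => ?_⟩
    · by_cases hq : q = p
      · subst hq
        rw [Lp]
        simp only [GState.afterInvoke, GState.cur, Function.update_self]
        cases o with
        | insert v =>
          exact ⟨rfl, ⟨I.mem.head_pub, by rw [I.mem.val_head]; exact bot_lt_intVal v⟩,
            I.mem.head_pub⟩
        | remove v =>
          exact ⟨rfl, ⟨I.mem.head_pub, by rw [I.mem.val_head]; exact bot_lt_intVal v⟩,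
            I.mem.head_pub⟩
        | contains v => exact ⟨rfl, I.mem.head_pub⟩
      · rw [L q hq]
        have : (s.afterInvoke i p o).op ((s.afterInvoke i p o).cur q) = s.op (s.cur q) := by
          simp [GState.afterInvoke, GState.cur, hq]
        rw [this]
        exact I.loc q
    · by_cases hq : q = p
      · subst hq; rw [Lp, hst.1]; simp
      · rw [L q hq]; exact I.odd q
    · by_cases hq : q = p
      · subst hq; rw [Lp, hst.1]; simp
      · by_cases hr : r = p
        · subst hr; rw [Lp, hst.1]; simp
        · rw [L q hq, L r hr]; exact I.holds_inj q r x
    · by_cases hq : q = p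
      · subst hq; rw [Lp, hst.2.1]; simp
      · by_cases hr : r = p
        · subst hr; rw [Lp, hst.2.1]; simp
        · rw [L q hq, L r hr]; exact I.priv_inj q r x
    · obtain ⟨q, hq⟩ := I.marking x h1 h2
      have hqp : q ≠ p := by
        rintro rfl
        rw [hp] at hq
        exact hq
      exact ⟨q, by rw [L q hqp]; exact hq⟩
  | step p e l m hl =>
    have L : ∀ q, q ≠ p → (s.afterStep i p e l m).loc q = s.loc q := fun q hq =>
      Function.update_of_ne hq _ _
    have Lp : (s.afterStep i p e l m).loc p = l := Function.update_self _ _ _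
    have hH := holds_step (I.loc p) hl (I.odd p)
    have hP := priv_step hl
    have lock_new : ∀ q x, q ≠ p → x ∈ holds l → x ∈ holds (s.loc q) → False := by
      intro q x hq h1 h2
      rcases (hH x h1).2 with h3 | h3
      · exact hq (I.holds_inj q p x h2 h3)
      · exact Nat.not_even_iff_odd.mpr (I.odd q x h2) h3
    have priv_new : ∀ q x, q ≠ p → x ∈ priv l → x ∈ priv (s.loc q) → False := by
      intro q x hq h1 h2
      rcases hP x h1 with h3 | h3
      · exact hq (I.priv_inj q p x h2 h3)
      · exact h3 ((I.loc q).priv h2).1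
    refine ⟨I.mem.step (I.loc p) hl, fun q => ?_, fun q => ?_, fun q r x => ?_, fun q r x => ?_,
      fun x h1 h2 => ?_⟩
    · by_cases hq : q = p
      · subst hq; rw [Lp]; exact (I.loc q).step I.mem hl
      · rw [L q hq]; exact (I.loc q).frame I.mem (I.env hq hl)
    · by_cases hq : q = p
      · subst hq; rw [Lp]; exact fun x hx => (hH x hx).1
      · rw [L q hq]
        intro x hx
        have h1 : x ∈ s.mem.alloc := by
          by_contra h2
          exact h2 (I.mem.pub_alloc _ ((I.loc q).holds_pub hx))
        have h2 := (I.env hq hl).lock_eq x h1 hx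
        change Odd (m.vlock x)
        rw [h2]
        exact I.odd q x hx
    · by_cases hq : q = p
      · subst hq
        by_cases hr : r = q
        · exact fun _ _ => hr.symm
        · rw [Lp, L r hr]; exact fun h1 h2 => (lock_new r x hr h1 h2).elim
      · by_cases hr : r = p
        · subst hr; rw [Lp, L q hq]; exact fun h1 h2 => (lock_new q x hq h2 h1).elim
        · rw [L q hq, L r hr]; exact I.holds_inj q r x
    · by_cases hq : q = p
      · subst hq
        by_cases hr : r = q
        · exact fun _ _ => hr.symm
        · rw [Lp, L r hr]; exact fun h1 h2 => (priv_new r x hr h1 h2).elim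
      · by_cases hr : r = p
        · subst hr; rw [Lp, L q hq]; exact fun h1 h2 => (priv_new q x hq h2 h1).elim
        · rw [L q hq, L r hr]; exact I.priv_inj q r x
    · rcases marking_step I.mem (I.loc p) hl h1 h2 with h3 | ⟨h3, h4, h5⟩
      · exact ⟨p, by rw [Lp]; exact h3⟩
      · obtain ⟨q, hq⟩ := I.marking x h3 h4
        have hqp : q ≠ p := by
          rintro rfl
          exact h5 hq
        exact ⟨q, by rw [L q hqp]; exact hq⟩

theorem IsTrace.inv {n : ℕ} {g : ℕ → GState n} {α : List (OpId n × Event)} (h : IsTrace g α) :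
    ∀ i ≤ α.length, Inv (g i) := by
  induction h with
  | nil h =>
    intro i hi
    obtain rfl : i = 0 := by simpa using hi
    rw [h]; exact Inv.initial n
  | snoc h hs ih =>
    intro i hi
    rw [List.length_append, List.length_singleton] at hi
    rcases Nat.lt_or_eq_of_le hi with h1 | rfl
    · exact ih i (by omega)
    · exact (ih _ le_rfl).step hs

end VL

/-! ### Effects on the represented set -/

namespace VL

theorem absSet_congr {m m' : VMem} (hn : m'.next = m.next)
    (hd : m'.deleted = m.deleted) (hv : m'.val = m.val) : absSet m' = absSet m := by
  unfold absSet
  rw [hn, hd, hv]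

theorem absSet_createNode {m : VMem} {pub : Set Addr} (M : MemInv m pub) {x curr : Addr} {v : ℤ}
    (hx : x ∉ m.alloc) : absSet (createNode m x v curr) = absSet m := by
  ext w
  have key : ∀ y, Reach m.next y → (createNode m x v curr).deleted y = m.deleted y ∧
      (createNode m x v curr).val y = m.val y := by
    intro y hy
    have hne : y ≠ x := fun h => hx (h ▸ M.reach_alloc hy)
    exact ⟨Function.update_of_ne hne _ _, Function.update_of_ne hne _ _⟩
  constructor
  · rintro ⟨y, h1, h2, h3⟩
    have h4 := (reach_createNode M hx).mp h1
    exact ⟨y, h4, (key y h4).1 ▸ h2, (key y h4).2 ▸ h3⟩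
  · rintro ⟨y, h1, h2, h3⟩
    exact ⟨y, (reach_createNode M hx).mpr h1, (key y h1).1.trans h2, (key y h1).2.trans h3⟩

theorem absSet_link {m : VMem} {pub : Set Addr} (M : MemInv m pub) {prev x : Addr} {v : ℤ}
    (hp : Below m pub v prev) (hx : x ∈ m.alloc) (hxp : x ∉ pub) (hv : m.val x = intVal v)
    (hdx : m.deleted x = false) (hd : m.deleted prev = false) (hn : m.next x = m.next prev) :
    v ∉ absSet m ∧ absSet (setNext m prev x) = absSet m ∪ {v} := by
  have hr := M.pub_reach prev hp.1 hd
  have hne : x ≠ prev := fun h => hxp (h ▸ hp.1)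
  refine ⟨M.notMem_absSet_of_gap hr hp.2 ?_, ?_⟩
  · rw [← hv, ← hn]
    exact M.sorted x hx (M.ne_tail_of_eq hv)
  · ext w
    constructor
    · rintro ⟨y, h1, h2, h3⟩
      rcases reach_link hn hne hr h1 with h4 | rfl
      · exact Or.inl ⟨y, h4, h2, h3⟩
      · exact Or.inr (intVal_inj.mp (h3.symm.trans hv))
    · rintro (⟨y, h1, h2, h3⟩ | rfl)
      · exact ⟨y, reach_of_link hn hne h1, h2, h3⟩
      · refine ⟨x, ?_, hdx, hv⟩
        have h1 := (reach_of_link hn hne hr).next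
        rwa [Function.update_self] at h1

theorem absSet_unlink {m : VMem} {pub : Set Addr} {o : SetOp} (M : MemInv m pub) {prev curr : Addr}
    (h : Locked m pub o prev curr) (hd : m.deleted curr = true) :
    absSet (setNext m prev (m.next curr)) = absSet m := by
  obtain ⟨h1, h2, h3, h4, -⟩ := h.reach M
  ext w
  constructor
  · rintro ⟨y, k1, k2, k3⟩
    exact ⟨y, (M.reach_unlink h1 h2 h3 h4 k1).1, k2, k3⟩
  · rintro ⟨y, k1, k2, k3⟩
    refine ⟨y, M.reach_of_unlink h1 h2 h3 h4 k1 ?_, k2, k3⟩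
    rintro rfl
    simp [hd] at k2

theorem absSet_mark {m : VMem} {pub : Set Addr} {v : ℤ} (M : MemInv m pub) {curr : Addr}
    (hr : Reach m.next curr) (hv : m.val curr = intVal v) (hd : m.deleted curr = false) :
    v ∈ absSet m ∧
      absSet { m with deleted := Function.update m.deleted curr true } = absSet m \ {v} := by
  refine ⟨⟨curr, hr, hd, hv⟩, ?_⟩
  ext w
  constructor
  · rintro ⟨y, h1, h2, h3⟩
    have hne : y ≠ curr := by
      rintro rfl
      simp at h2
    refine ⟨⟨y, h1, by simpa [hne] using h2, h3⟩, ?_⟩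
    rintro rfl
    exact hne (M.reach_inj h1 hr (Eq.trans h3 hv.symm))
  · rintro ⟨⟨y, h1, h2, h3⟩, hw⟩
    have hne : y ≠ curr := by
      rintro rfl
      exact hw (intVal_inj.mp (h3.symm.trans hv))
    exact ⟨y, h1, by simpa [hne] using h2, h3⟩

theorem isEffect_eq_false {o : SetOp} {e : Event} (h1 : ∀ x y, e ≠ .writeNext x y)
    (h2 : ∀ x b, e ≠ .writeDel x b) : isEffect o e = false := by
  cases o <;> cases e <;> first | rfl | exact absurd rfl (h1 _ _) | exact absurd rfl (h2 _ _)

/-- An event at which an update takes effect changes the represented set as the update does, in a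
state in which it succeeds; other events do not change the set. -/
theorem absSet_step {m m' : VMem} {pub : Set Addr} {o : SetOp} {l l' : Loc} {e : Event}
    (M : MemInv m pub) (h : LocInv m pub o l) (hs : LStep l m e l' m')
    (hm : ∀ prev curr, l = .rMark prev curr → m.deleted curr = false) :
    (isEffect o e = true ∧ o.succeeds (absSet m) ∧ absSet m' = o.next (absSet m)) ∨
      (isEffect o e = false ∧ absSet m' = absSet m) := by
  cases hs with
  | iWrite prev x m =>
    obtain ⟨v, rfl, h1, h2, h3, h4, h5, h6, h7⟩ := h
    exact Or.inl ⟨rfl, absSet_link M h1 h2 h3 h4 h5 h6 h7⟩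
  | rMark prev curr m =>
    obtain ⟨h1, h2, -⟩ := Locked.reach h M
    obtain ⟨v, rfl, -, -, h4, -⟩ := h
    exact Or.inl ⟨rfl, absSet_mark M (h2 ▸ h1.next) h4 (hm _ _ rfl)⟩
  | rWrite prev curr y m =>
    -- the value of `curr` has left the set when `curr` was marked
    obtain ⟨h1, h2, rfl⟩ := h
    obtain ⟨v, rfl, -⟩ := id h1
    exact Or.inr ⟨rfl, absSet_unlink M h1 h2⟩
  | iCreate v prev pVer curr m x hx =>
    exact Or.inr ⟨isEffect_eq_false (by simp) (by simp), absSet_createNode M hx⟩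
  | _ => exact Or.inr ⟨isEffect_eq_false (by simp) (by simp), absSet_congr rfl rfl rfl⟩

/-- A node that is about to be marked is unmarked: otherwise another process would be about to
unlink it, and would hold the lock of the same predecessor. -/
theorem Inv.not_deleted {n : ℕ} {s : GState n} (I : Inv s) {p : Fin n} {prev curr : Addr}
    (hp : s.loc p = .rMark prev curr) : s.mem.deleted curr = false := by
  by_contra hd
  rw [Bool.not_eq_false] at hd
  have h := I.loc p
  rw [hp] at h
  obtain ⟨h1, h2, h3, h4, -⟩ := Locked.reach h I.mem
  obtain ⟨q, hq⟩ := I.marking curr (h2 ▸ h1.next) hd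
  have key : ∀ prev', Locked s.mem s.pub (s.op (s.cur q)) prev' curr →
      prev' ∈ holds (s.loc q) → False := by
    intro prev' h5 h6
    obtain ⟨k1, k2, k3, -⟩ := h5.reach I.mem
    obtain rfl := I.mem.pred_unique k1 h1 (k2.trans h2.symm) k3 h3
    obtain rfl := I.holds_inj q p _ h6 (by rw [hp]; simp [holds])
    rw [hp] at hq
    exact hq
  have h' := I.loc q
  cases hl : s.loc q with
  | rNext prev' c =>
    rw [hl] at hq h'
    obtain rfl : c = curr := hq
    exact key prev' h'.1 (by rw [hl]; simp [holds])
  | rWrite prev' c y =>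
    rw [hl] at hq h'
    obtain rfl : c = curr := hq
    exact key prev' h'.1 (by rw [hl]; simp [holds])
  | _ => rw [hl] at hq; exact hq

section Step

variable {m m' : VMem} {pub : Set Addr} {o : SetOp} {l l' : Loc} {e : Event}
  (M : MemInv m pub) (h : LocInv m pub o l) (hs : LStep l m e l' m')
include M h hs

omit M h in
theorem alloc_step {x : Addr} (hx : x ∈ m.alloc) : x ∈ m'.alloc ∧ m'.val x = m.val x := by
  cases hs with
  | iCreate v prev pVer curr m y hy =>
    have hne : x ≠ y := fun h => hy (h ▸ hx)
    exact ⟨Or.inr hx, Function.update_of_ne hne _ _⟩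
  | _ => exact ⟨hx, rfl⟩

/-- Only the successor of a reachable node is changed. -/
theorem reach_of_next_ne {x : Addr} (hx : x ∈ m.alloc) (hn : m'.next x ≠ m.next x) :
    Reach m'.next x := by
  cases hs with
  | iCreate v prev pVer curr m y hy =>
    have hne : x ≠ y := fun h => hy (h ▸ hx)
    exact absurd (Function.update_of_ne hne _ _) hn
  | iWrite prev y m =>
    obtain ⟨v, -, h1, h2, h3, h4, h5, h6, h7⟩ := h
    have hxp : x = prev := by
      by_contra h
      exact hn (Function.update_of_ne h _ _)
    subst hxp
    exact reach_of_link h7 (fun h => h3 (h ▸ h1.1)) (M.pub_reach _ h1.1 h6)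
  | rWrite prev curr y m =>
    obtain ⟨h1, h2, rfl⟩ := h
    have hxp : x = prev := by
      by_contra h
      exact hn (Function.update_of_ne h _ _)
    subst hxp
    obtain ⟨k1, k2, k3, k4, k5⟩ := h1.reach M
    exact M.reach_of_unlink k1 k2 k3 k4 k1 fun h => absurd k5 (h ▸ lt_irrefl _)
  | _ => exact absurd rfl hn

/-- A node is not unlinked by the event that marks it. -/
theorem reach_of_mark {x : Addr} (hr : Reach m.next x) (hd : m.deleted x = false)
    (hd' : m'.deleted x = true) : Reach m'.next x := by
  cases hs with
  | iCreate v prev pVer curr m y hy => exact (reach_createNode M hy).mpr hr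
  | iWrite prev y m =>
    obtain ⟨v, -, h1, h2, h3, h4, h5, h6, h7⟩ := h
    exact reach_of_link h7 (fun h => h3 (h ▸ h1.1)) hr
  | rWrite prev curr y m =>
    have hd2 : m.deleted x = true := hd'
    simp [hd] at hd2
  | _ => exact hr

end Step

/-! ### Moments of an execution -/

section Trace

variable {n : ℕ} {g : ℕ → GState n} {α : List (OpId n × Event)}

theorem IsTrace.step (T : IsTrace g α) {i : ℕ} (hi : i < α.length) :
    GStep i (g i) α[i] (g (i + 1)) := by
  induction T with
  | nil h => simp at hi
  | snoc h hs ih =>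
    rw [List.length_append, List.length_singleton] at hi
    rcases Nat.lt_or_eq_of_le (Nat.le_of_lt_succ hi) with h1 | rfl
    · rw [List.getElem_append_left h1]; exact ih h1
    · simpa using hs

/-- The represented set at time `t`. -/
def setAt (g : ℕ → GState n) (t : ℕ) : Set ℤ := absSet (g t).mem

/-- From time `s` to time `i`, the property `P` held at some moment. -/
def Sometime (P : ℕ → Prop) (s i : ℕ) : Prop := ∃ t, s ≤ t ∧ t ≤ i ∧ P t

theorem Sometime.mono {P : ℕ → Prop} {s i j : ℕ} (h : Sometime P s i) (hj : i ≤ j) :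
    Sometime P s j := by
  obtain ⟨t, h1, h2, h3⟩ := h
  exact ⟨t, h1, h2.trans hj, h3⟩

/-- The node `x` was in the list at some moment from `s` to `i`. -/
def Touched (g : ℕ → GState n) (s i : ℕ) (x : Addr) : Prop :=
  Sometime (fun t => Reach (g t).mem.next x) s i

/-- The node `x` was in the list and `y` was its successor, at some moment from `s` to `i`. -/
def Edge (g : ℕ → GState n) (s i : ℕ) (x y : Addr) : Prop :=
  Sometime (fun t => Reach (g t).mem.next x ∧ (g t).mem.next x = y) s i

theorem Edge.touched {s i : ℕ} {x y : Addr} (h : Edge g s i x y) : Touched g s i y := by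
  obtain ⟨t, h1, h2, h3, rfl⟩ := h
  exact ⟨t, h1, h2, h3.next⟩

theorem touched_head {s i : ℕ} (h : s ≤ i) : Touched g s i Addr.head := ⟨i, h, le_rfl, Reach.head⟩

theorem IsTrace.alloc_succ (T : IsTrace g α) {i : ℕ} (hi : i < α.length) {x : Addr}
    (hx : x ∈ (g i).mem.alloc) :
    x ∈ (g (i + 1)).mem.alloc ∧ (g (i + 1)).mem.val x = (g i).mem.val x := by
  obtain ⟨a, hs⟩ : ∃ a, GStep i (g i) a (g (i + 1)) := ⟨_, T.step hi⟩
  generalize g i = s at hs hx ⊢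
  generalize g (i + 1) = s' at hs ⊢
  cases hs with
  | invoke p o hp => exact ⟨hx, rfl⟩
  | step p e l m hl => exact alloc_step hl hx

theorem IsTrace.alloc_mono (T : IsTrace g α) {i j : ℕ} (hij : i ≤ j) (hj : j ≤ α.length) {x : Addr}
    (hx : x ∈ (g i).mem.alloc) :
    x ∈ (g j).mem.alloc ∧ (g j).mem.val x = (g i).mem.val x := by
  induction j, hij using Nat.le_induction with
  | base => exact ⟨hx, rfl⟩
  | succ j _ ih =>
    obtain ⟨h1, h2⟩ := ih (by omega)
    obtain ⟨h3, h4⟩ := T.alloc_succ (i := j) (by omega) h1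
    exact ⟨h3, h4.trans h2⟩

theorem pubAfter_sub {e : Event} {pub : Set Addr} : pub ⊆ pubAfter e pub := by
  cases e <;> first | exact fun _ => id | exact fun _ => Or.inr

theorem IsTrace.pub_mono (T : IsTrace g α) {i j : ℕ} (hij : i ≤ j) (hj : j ≤ α.length) :
    (g i).pub ⊆ (g j).pub := by
  induction j, hij using Nat.le_induction with
  | base => exact fun _ => id
  | succ j _ ih =>
    refine (ih (by omega)).trans ?_
    obtain ⟨a, hs⟩ : ∃ a, GStep j (g j) a (g (j + 1)) := ⟨_, T.step (by omega)⟩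
    generalize g j = s at hs ⊢
    generalize g (j + 1) = s' at hs ⊢
    cases hs with
    | invoke p o hp => exact fun _ => id
    | step p e l m hl => exact pubAfter_sub

variable (T : IsTrace g α)
include T

theorem Touched.pub {s i : ℕ} (hi : i ≤ α.length) {x : Addr} (h : Touched g s i x) :
    x ∈ (g i).pub := by
  obtain ⟨t, -, h2, h3⟩ := h
  exact T.pub_mono h2 hi ((T.inv t (h2.trans hi)).mem.reach_pub h3)

/-- The successor of a node that was in the list at some moment was its successor at some moment
when the node was in the list: a node that has been unlinked keeps its successor. -/
theorem Touched.edge {s i : ℕ} (hi : i ≤ α.length) {x : Addr} (h : Touched g s i x) :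
    Edge g s i x ((g i).mem.next x) := by
  obtain ⟨t, h1, h2, h3⟩ := h
  have key : ∀ i, t ≤ i → i ≤ α.length → Edge g s i x ((g i).mem.next x) := by
    intro i hti
    induction i, hti using Nat.le_induction with
    | base => exact fun _ => ⟨t, h1, le_rfl, h3, rfl⟩
    | succ i hti ih =>
      intro hi
      by_cases hr : Reach (g (i + 1)).mem.next x
      · exact ⟨i + 1, by omega, le_rfl, hr, rfl⟩
      · have hne : (g (i + 1)).mem.next x = (g i).mem.next x := by
          by_contra hne
          have hx := (T.inv i (by omega)).mem.pub_alloc x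
            (Touched.pub T (by omega) ⟨t, h1, hti, h3⟩)
          have I := T.inv i (by omega)
          obtain ⟨a, hs⟩ : ∃ a, GStep i (g i) a (g (i + 1)) := ⟨_, T.step (by omega)⟩
          generalize g i = c at hs hx I hne
          generalize g (i + 1) = c' at hs hr hne
          cases hs with
          | invoke p o hp => exact hne rfl
          | step p e l m hl => exact hr (reach_of_next_ne I.mem (I.loc p) hl hx hne)
        rw [hne]
        exact (ih (by omega)).mono (by omega)
  exact key i h2 hi

/-- If a node was in the list at some moment and is marked now, then its value was missing from the
set at some moment. -/
theorem Touched.notMem_of_deleted {s i : ℕ} (hi : i ≤ α.length) {x : Addr} (h : Touched g s i x)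
    (hd : (g i).mem.deleted x = true) {v : ℤ} (hv : (g i).mem.val x = intVal v) :
    Sometime (fun t => v ∉ setAt g t) s i := by
  obtain ⟨t, h1, h2, h3⟩ := h
  have key : ∀ i, t ≤ i → i ≤ α.length → (g i).mem.deleted x = true →
      (g i).mem.val x = intVal v → Sometime (fun t => v ∉ setAt g t) s i := by
    intro i hti
    induction i, hti using Nat.le_induction with
    | base =>
      exact fun hi hd hv =>
        ⟨t, h1, le_rfl, (T.inv t hi).mem.notMem_absSet_of_deleted h3 hd hv⟩
    | succ i hti ih =>
      intro hi hd hv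
      have hx := Touched.pub T (i := i) (by omega) ⟨t, h1, hti, h3⟩
      have I := T.inv i (by omega)
      have ha := T.alloc_succ (i := i) (by omega) (I.mem.pub_alloc x hx)
      cases hd0 : (g i).mem.deleted x with
      | true => exact (ih (by omega) hd0 (ha.2.symm.trans hv)).mono (by omega)
      | false =>
        -- the node has just been marked, and is still reachable
        refine ⟨i + 1, by omega, le_rfl, (T.inv _ hi).mem.notMem_absSet_of_deleted ?_ hd hv⟩
        have hr := I.mem.pub_reach x hx hd0
        obtain ⟨a, hs⟩ : ∃ a, GStep i (g i) a (g (i + 1)) := ⟨_, T.step (by omega)⟩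
        generalize g i = c at hs hx I hd0 hr
        generalize g (i + 1) = c' at hs hd
        cases hs with
        | invoke p o hp => exact hr
        | step p e l m hl => exact reach_of_mark I.mem (I.loc p) hl hr hd0 hd
  exact key i h2 hi hd hv

/-- If the value of a node was below `v` and that of its successor above, then `v` was missing from
the set at that moment. -/
theorem Edge.notMem_of_gap {s i : ℕ} (hi : i ≤ α.length) {x y : Addr} (h : Edge g s i x y) {v : ℤ}
    (h1 : (g i).mem.val x < intVal v) (h2 : intVal v < (g i).mem.val y) :
    Sometime (fun t => v ∉ setAt g t) s i := by
  obtain ⟨t, k1, k2, k3, rfl⟩ := h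
  have I := T.inv t (k2.trans hi)
  rw [(T.alloc_mono k2 hi (I.mem.reach_alloc k3)).2] at h1
  rw [(T.alloc_mono k2 hi (I.mem.reach_alloc k3.next)).2] at h2
  exact ⟨t, k1, k2, I.mem.notMem_absSet_of_gap k3 h1 h2⟩

theorem Touched.mem_of_not_deleted {s i : ℕ} (hi : i ≤ α.length) {x : Addr} (h : Touched g s i x)
    (hd : (g i).mem.deleted x = false) {v : ℤ} (hv : (g i).mem.val x = intVal v) :
    v ∈ setAt g i :=
  ⟨x, (T.inv i hi).mem.pub_reach x (h.pub T hi) hd, hd, hv⟩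

end Trace

end VL

/-! ### Linearization points -/

namespace VL

section Trace

variable {n : ℕ} {g : ℕ → GState n} {α : List (OpId n × Event)}

/-- A search for `v` has arrived at `curr`: it is the successor, at some moment, of a node with a
value below `v`, unless the search has just started. -/
def Arrived (g : ℕ → GState n) (s i : ℕ) (v : ℤ) (curr : Addr) : Prop :=
  curr = Addr.head ∨ ∃ x, Edge g s i x curr ∧ (g i).mem.val x < intVal v

/-- At some moment, the response `b` of `o` is correct and `o` does not change the set. -/
def ReadOk (g : ℕ → GState n) (s i : ℕ) (o : SetOp) (b : Bool) : Prop :=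
  Sometime (fun t => (b = true ↔ o.succeeds (setAt g t)) ∧ o.next (setAt g t) = setAt g t) s i

/-- What a process that performs `o` knows about the past since time `s`; the time at which the
operation took effect is `eff`. -/
def LocHist (g : ℕ → GState n) (s i : ℕ) (o : SetOp) (eff : Option ℕ) : Loc → Prop
  | .idle => True
  | .cTest v curr => eff = none ∧ Arrived g s i v curr
  | .cNext _ curr => eff = none ∧ Touched g s i curr
  | .cVal v curr => eff = none ∧ Arrived g s i v curr
  | .cDel curr => eff = none ∧ Touched g s i curr
  | .tTest _ v prev curr => eff = none ∧ Touched g s i prev ∧ Arrived g s i v curr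
  | .tNext _ _ curr => eff = none ∧ Touched g s i curr
  | .vVer _ _ prev => eff = none ∧ Touched g s i prev
  | .vDel _ _ prev _ => eff = none ∧ Touched g s i prev
  | .vNext _ _ prev _ => eff = none ∧ Touched g s i prev
  | .vTest _ v prev _ curr => eff = none ∧ Touched g s i prev ∧ Arrived g s i v curr
  | .vCurrVer _ _ prev curr => eff = none ∧ Touched g s i prev ∧ Touched g s i curr
  | .vCurrDel _ _ prev _ curr => eff = none ∧ Touched g s i prev ∧ Touched g s i curr
  | .vCurrNext _ _ _ curr => eff = none ∧ Touched g s i curr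
  | .iDel v prev _ curr => eff = none ∧ Touched g s i prev ∧ Arrived g s i v curr
  | .iVal v prev _ curr => eff = none ∧ Touched g s i prev ∧ Touched g s i curr ∧
      ((g i).mem.val curr = intVal v → Sometime (fun t => v ∈ setAt g t) s i)
  | .iCreate _ prev _ _ => eff = none ∧ Touched g s i prev
  | .iLock _ prev _ _ => eff = none ∧ Touched g s i prev
  | .iWrite _ _ => eff = none
  | .rVal v prev _ curr => eff = none ∧ Touched g s i prev ∧ Arrived g s i v curr
  | .rDel v prev _ curr => eff = none ∧ Touched g s i prev ∧ Arrived g s i v curr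
  | .rLock v prev _ curr => eff = none ∧ Touched g s i prev ∧ Arrived g s i v curr
  | .rSpinVer _ _ => eff = none
  | .rSpinLock _ _ _ => eff = none
  | .rMark _ _ => eff = none
  | .rNext _ _ => eff ≠ none
  | .rWrite _ _ _ => eff ≠ none
  | .unlockRead _ _ => eff ≠ none
  | .unlockCas _ _ _ => eff ≠ none
  | .ret b => eff ≠ none ∧ b = true ∨ eff = none ∧ ReadOk g s i o b

variable (T : IsTrace g α)
include T

omit T in
theorem Arrived.touched {s i : ℕ} (hs : s ≤ i) {v : ℤ} {curr : Addr} (h : Arrived g s i v curr) :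
    Touched g s i curr := by
  rcases h with rfl | ⟨x, h, -⟩
  · exact touched_head hs
  · exact h.touched

theorem Arrived.succ {s i : ℕ} (hi : i < α.length) {v : ℤ} {curr : Addr}
    (h : Arrived g s i v curr) : Arrived g s (i + 1) v curr := by
  rcases h with h | ⟨x, h, hv⟩
  · exact Or.inl h
  · refine Or.inr ⟨x, h.mono (by omega), ?_⟩
    have hx : x ∈ (g i).pub := Touched.pub T hi.le (by
      obtain ⟨t, h1, h2, h3, -⟩ := h
      exact ⟨t, h1, h2, h3⟩)
    rwa [(T.alloc_succ hi ((T.inv i hi.le).mem.pub_alloc x hx)).2]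

theorem LocHist.succ {s i : ℕ} (hi : i < α.length) {o : SetOp} {eff : Option ℕ} {l : Loc}
    (h : LocHist g s i o eff l) : LocHist g s (i + 1) o eff l := by
  have A : ∀ {v curr}, Arrived g s i v curr → Arrived g s (i + 1) v curr := fun h => h.succ T hi
  have B : ∀ {x}, Touched g s i x → Touched g s (i + 1) x := fun h => h.mono (by omega)
  cases l with
  | cTest | cVal => exact ⟨h.1, A h.2⟩
  | cNext | cDel | tNext | vVer | vDel | vNext | vCurrNext | iCreate | iLock => exact ⟨h.1, B h.2⟩
  | tTest | vTest | iDel | rVal | rDel | rLock => exact ⟨h.1, B h.2.1, A h.2.2⟩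
  | vCurrVer | vCurrDel => exact ⟨h.1, B h.2.1, B h.2.2⟩
  | iVal v prev pVer curr =>
    refine ⟨h.1, B h.2.1, B h.2.2.1, fun hv => ?_⟩
    rw [(T.alloc_succ hi ((T.inv i hi.le).mem.pub_alloc _ (h.2.2.1.pub T hi.le))).2] at hv
    exact (h.2.2.2 hv).mono (by omega)
  | ret b => exact h.imp id (And.imp_right fun h => Sometime.mono h (by omega))
  | _ => exact h

/-- The step of a process, as far as its knowledge about the past is concerned. -/
theorem LocHist.step {s i : ℕ} (hi : i < α.length) (hsi : s ≤ i) {o : SetOp} {eff : Option ℕ}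
    {l l' : Loc} {e : Event} {m m' : VMem} (hm : (g i).mem = m)
    (hl : LocInv m (g i).pub o l) (hs : LStep l m e l' m') (h : LocHist g s i o eff l) :
    LocHist g s i o (if isEffect o e = true then some i else eff) l' := by
  have N : ∀ {e : Event}, (∀ x y, e ≠ .writeNext x y) → (∀ x b, e ≠ .writeDel x b) →
      (if isEffect o e = true then some i else eff) = eff := fun h1 h2 => by
    rw [isEffect_eq_false h1 h2]; rfl
  have M := (T.inv i hi.le).mem
  rw [hm] at M
  have next_arrived : ∀ {v x}, Touched g s i x → m.val x < intVal v →
      Arrived g s i v (m.next x) := fun {v x} h1 h2 =>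
    Or.inr ⟨x, by rw [← hm]; exact h1.edge T hi.le, by rw [hm]; exact h2⟩
  have gap : ∀ {v curr}, Arrived g s i v curr → ¬ m.val curr < intVal v → m.val curr ≠ intVal v →
      Sometime (fun t => v ∉ setAt g t) s i := by
    rintro v curr (rfl | ⟨x, h1, h2⟩) h3 h4
    · exact absurd rfl (M.ne_head_of_not_lt h3)
    · exact h1.notMem_of_gap T hi.le h2 (by rw [hm]; exact lt_of_le_of_ne (not_lt.mp h3) h4.symm)
  have deleted : ∀ {v curr}, Touched g s i curr → m.deleted curr = true → m.val curr = intVal v →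
      Sometime (fun t => v ∉ setAt g t) s i := fun h1 h2 h3 =>
    h1.notMem_of_deleted T hi.le (by rw [hm]; exact h2) (by rw [hm]; exact h3)
  have undeleted : ∀ {v curr}, Touched g s i curr → m.deleted curr = false →
      m.val curr = intVal v → v ∈ setAt g i := fun h1 h2 h3 =>
    h1.mem_of_not_deleted T hi.le (by rw [hm]; exact h2) (by rw [hm]; exact h3)
  have remove_false : ∀ {v}, o = .remove v → Sometime (fun t => v ∉ setAt g t) s i →
      ReadOk g s i o false := by
    rintro v rfl ⟨t, h1, h2, h3⟩
    exact ⟨t, h1, h2, by simpa [SetOp.succeeds] using h3, Set.sdiff_singleton_eq_self h3⟩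
  have contains_false : ∀ {v}, o = .contains v → Sometime (fun t => v ∉ setAt g t) s i →
      ReadOk g s i o false := by
    rintro v rfl ⟨t, h1, h2, h3⟩
    exact ⟨t, h1, h2, by simpa [SetOp.succeeds] using h3, rfl⟩
  cases hs with
  | cTest_lt => rw [N (by simp) (by simp)]; exact ⟨h.1, h.2.touched hsi⟩
  | cTest_ge => rw [N (by simp) (by simp)]; exact h
  | cNext => rw [N (by simp) (by simp)]; exact ⟨h.1, next_arrived h.2 hl.2.2⟩
  | cVal_eq => rw [N (by simp) (by simp)]; exact ⟨h.1, h.2.touched hsi⟩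
  | cVal_ne v curr m h' =>
    rw [N (by simp) (by simp)]
    exact Or.inr ⟨h.1, contains_false hl.1 (gap h.2 hl.2.2 h')⟩
  | cDel curr m =>
    rw [N (by simp) (by simp)]
    obtain ⟨v, rfl, h2, h3⟩ := hl
    refine Or.inr ⟨h.1, ?_⟩
    cases hd : m.deleted curr with
    | true => exact contains_false rfl (deleted h.2 hd h3)
    | false => exact ⟨i, hsi, le_rfl, by simpa [SetOp.succeeds] using undeleted h.2 hd h3, rfl⟩
  | tTest_lt => rw [N (by simp) (by simp)]; exact ⟨h.1, h.2.2.touched hsi⟩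
  | tTest_ge => rw [N (by simp) (by simp)]; exact ⟨h.1, h.2.1⟩
  | tNext => rw [N (by simp) (by simp)]; exact ⟨h.1, h.2, next_arrived h.2 hl.2.2⟩
  | vVer => rw [N (by simp) (by simp)]; exact h
  | vDel_true => rw [N (by simp) (by simp)]; exact ⟨h.1, touched_head hsi, Or.inl rfl⟩
  | vDel_false => rw [N (by simp) (by simp)]; exact h
  | vNext => rw [N (by simp) (by simp)]; exact ⟨h.1, h.2, next_arrived h.2 hl.2.1.2⟩
  | vTest_lt => rw [N (by simp) (by simp)]; exact ⟨h.1, h.2.1, h.2.2.touched hsi⟩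
  | vTest_ge k => rw [N (by simp) (by simp)]; cases k <;> exact h
  | vCurrVer => rw [N (by simp) (by simp)]; exact h
  | vCurrDel_true => rw [N (by simp) (by simp)]; exact ⟨h.1, h.2.1⟩
  | vCurrDel_false => rw [N (by simp) (by simp)]; exact ⟨h.1, h.2.2⟩
  | vCurrNext => rw [N (by simp) (by simp)]; exact ⟨h.1, h.2, next_arrived h.2 hl.2.1.2⟩
  | iDel_true => rw [N (by simp) (by simp)]; exact ⟨h.1, h.2.1⟩
  | iDel_false v prev pVer curr m h' =>
    -- if the value turns out to be `v`, then this is the linearization point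
    rw [N (by simp) (by simp)]
    exact ⟨h.1, h.2.1, h.2.2.touched hsi, fun hv =>
      ⟨i, hsi, le_rfl, undeleted (h.2.2.touched hsi) h' (by rwa [hm] at hv)⟩⟩
  | iVal_eq v prev pVer curr m h' =>
    rw [N (by simp) (by simp)]
    obtain ⟨rfl, -⟩ := hl
    obtain ⟨t, h1, h2, h3⟩ := h.2.2.2 (by rw [hm]; exact h')
    exact Or.inr ⟨h.1, t, h1, h2, by simpa [SetOp.succeeds] using h3,
      Set.union_eq_self_of_subset_right (Set.singleton_subset_iff.mpr h3)⟩
  | iVal_ne => rw [N (by simp) (by simp)]; exact ⟨h.1, h.2.1⟩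
  | iCreate => rw [N (by simp) (by simp)]; exact h
  | iLock_ok => rw [N (by simp) (by simp)]; exact h.1
  | iLock_fail => rw [N (by simp) (by simp)]; exact h
  | iWrite prev x m =>
    obtain ⟨v, rfl, -⟩ := hl
    exact Option.some_ne_none i
  | rVal_ne v prev pVer curr m h' =>
    rw [N (by simp) (by simp)]
    exact Or.inr ⟨h.1, remove_false hl.1 (gap h.2.2 hl.2.2.2.2.1 h')⟩
  | rVal_eq => rw [N (by simp) (by simp)]; exact h
  | rDel_true v prev pVer curr m h' =>
    rw [N (by simp) (by simp)]
    exact Or.inr ⟨h.1, remove_false hl.1 (deleted (h.2.2.touched hsi) h' hl.2.2)⟩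
  | rDel_false => rw [N (by simp) (by simp)]; exact h
  | rLock_ok => rw [N (by simp) (by simp)]; exact h.1
  | rLock_fail => rw [N (by simp) (by simp)]; exact ⟨h.1, h.2.1⟩
  | rSpinVer => rw [N (by simp) (by simp)]; exact h
  | rSpinLock_ok => rw [N (by simp) (by simp)]; exact h
  | rSpinLock_fail => rw [N (by simp) (by simp)]; exact h
  | rMark prev curr m =>
    obtain ⟨v, rfl, -⟩ := hl
    exact Option.some_ne_none i
  | rNext => rw [N (by simp) (by simp)]; exact h
  | rWrite prev curr y m =>
    obtain ⟨⟨v, rfl, -⟩, -⟩ := hl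
    exact h
  | unlockRead => rw [N (by simp) (by simp)]; exact h
  | unlockCas_ok x xs w m h' =>
    rw [N (by simp) (by simp)]
    cases xs with
    | nil => exact Or.inl ⟨h, rfl⟩
    | cons => exact h
  | unlockCas_fail x xs w m h' => exact absurd hl.2.2 h'
  | ret => trivial

omit T in
/-- An event at which an update takes effect occurs only once. -/
theorem LocHist.eff_eq_none {s i : ℕ} {o : SetOp} {eff : Option ℕ} {l l' : Loc} {e : Event}
    {m m' : VMem} {pub : Set Addr} (hl : LocInv m pub o l) (hs : LStep l m e l' m')
    (h : LocHist g s i o eff l) (he : isEffect o e = true) : eff = none := by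
  cases hs with
  | iWrite => exact h
  | rMark => exact h
  | rWrite prev curr y m =>
    obtain ⟨⟨v, rfl, -⟩, -⟩ := hl
    simp [isEffect] at he
  | _ => rw [isEffect_eq_false (by simp) (by simp)] at he; simp at he

/-- The invariant of the ghost variables: each operation that has taken effect, at time `eff`, has
succeeded and changed the set accordingly at that time; the set is not changed at other times; each
other operation that has responded, at time `fin`, returned a response that was right at some
moment after its invocation. -/
structure HInv (g : ℕ → GState n) (i : ℕ) : Prop where
  since_le : ∀ p, (g i).since ((g i).cur p) ≤ i
  loc : ∀ p, LocHist g ((g i).since ((g i).cur p)) i ((g i).op ((g i).cur p))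
    ((g i).eff ((g i).cur p)) ((g i).loc p)
  fin_none : ∀ p, (g i).loc p ≠ .idle → (g i).fin ((g i).cur p) = none
  fresh : ∀ p k, (g i).count p < k → (g i).eff (p, k) = none ∧ (g i).fin (p, k) = none
  eff_spec : ∀ π u, (g i).eff π = some u → u < i ∧ (g i).since π ≤ u ∧ (g i).ret π = true ∧
    ((g i).op π).succeeds (setAt g u) ∧ setAt g (u + 1) = ((g i).op π).next (setAt g u)
  eff_inj : ∀ π ρ u, (g i).eff π = some u → (g i).eff ρ = some u → π = ρ
  eff_cover : ∀ u < i, (∃ π, (g i).eff π = some u) ∨ setAt g (u + 1) = setAt g u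
  fin_spec : ∀ π r, (g i).fin π = some r → r < i ∧ (∀ u, (g i).eff π = some u → u < r) ∧
    ((g i).eff π = none → ReadOk g ((g i).since π) r ((g i).op π) ((g i).ret π))

omit T in
theorem HInv.initial (h0 : g 0 = GState.initial n) : HInv g 0 := by
  constructor <;> rw [h0]
  · exact fun _ => le_rfl
  · exact fun _ => trivial
  · exact fun _ _ => rfl
  · exact fun _ _ _ => ⟨rfl, rfl⟩
  · intro π u h; simp [GState.initial] at h
  · intro π ρ u h; simp [GState.initial] at h
  · intro u hu; omega
  · intro π u h; simp [GState.initial] at h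

theorem HInv.succ_invoke {i : ℕ} (hi : i < α.length) (I : HInv g i) {p : Fin n} {o : SetOp}
    (hp : (g i).loc p = .idle) (hg : g (i + 1) = (g i).afterInvoke i p o) : HInv g (i + 1) := by
  have hnew : ∀ π : OpId n, π ≠ (p, (g i).count p + 1) →
      (g (i + 1)).op π = (g i).op π ∧ (g (i + 1)).since π = (g i).since π := by
    intro π hπ
    rw [hg]
    simp [GState.afterInvoke, hπ]
  have hcur : ∀ q, q ≠ p → (g (i + 1)).cur q = (g i).cur q ∧ (g (i + 1)).loc q = (g i).loc q := by
    intro q hq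
    rw [hg]
    simp [GState.afterInvoke, GState.cur, hq]
  have hcur_ne : ∀ q, q ≠ p → (g i).cur q ≠ (p, (g i).count p + 1) := fun q hq h =>
    hq (congrArg Prod.fst h)
  have hcurp : (g (i + 1)).cur p = (p, (g i).count p + 1) ∧ (g (i + 1)).loc p = start o ∧
      (g (i + 1)).since (p, (g i).count p + 1) = i + 1 := by
    rw [hg]; simp [GState.afterInvoke, GState.cur]
  have heff : (g (i + 1)).eff = (g i).eff := by rw [hg]; rfl
  have hfin : (g (i + 1)).fin = (g i).fin := by rw [hg]; rfl
  have hret : (g (i + 1)).ret = (g i).ret := by rw [hg]; rfl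
  obtain ⟨hf1, hf2⟩ := I.fresh p ((g i).count p + 1) (Nat.lt_succ_self _)
  have hset : setAt g (i + 1) = setAt g i := by
    unfold setAt; rw [hg]; rfl
  constructor
  · intro q
    by_cases hq : q = p
    · subst hq; rw [hcurp.1, hcurp.2.2]
    · rw [(hcur q hq).1, (hnew _ (hcur_ne q hq)).2]
      exact (I.since_le q).trans (Nat.le_succ i)
  · intro q
    by_cases hq : q = p
    · subst hq
      rw [hcurp.1, hcurp.2.1, hcurp.2.2, heff, hf1]
      cases o with
      | contains v => exact ⟨rfl, Or.inl rfl⟩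
      | insert v => exact ⟨rfl, touched_head le_rfl, Or.inl rfl⟩
      | remove v => exact ⟨rfl, touched_head le_rfl, Or.inl rfl⟩
    · rw [(hcur q hq).1, (hcur q hq).2, (hnew _ (hcur_ne q hq)).1, (hnew _ (hcur_ne q hq)).2, heff]
      exact (I.loc q).succ T hi
  · intro q hl
    by_cases hq : q = p
    · subst hq; rw [hcurp.1, hfin, hf2]
    · rw [(hcur q hq).2] at hl
      rw [(hcur q hq).1, hfin]
      exact I.fin_none q hl
  · intro q k hk
    rw [heff, hfin]
    refine I.fresh q k (lt_of_le_of_lt ?_ hk)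
    rw [hg]
    by_cases hq : q = p
    · subst hq; simp [GState.afterInvoke]
    · simp [GState.afterInvoke, hq]
  · intro π u h
    rw [heff] at h
    have hπ : π ≠ (p, (g i).count p + 1) := by
      rintro rfl
      rw [hf1] at h; simp at h
    rw [(hnew π hπ).1, (hnew π hπ).2, hret]
    obtain ⟨h1, h2⟩ := I.eff_spec π u h
    exact ⟨h1.trans (Nat.lt_succ_self i), h2⟩
  · rw [heff]; exact I.eff_inj
  · intro u hu
    rw [heff]
    rcases Nat.lt_or_eq_of_le (Nat.le_of_lt_succ hu) with hu | rfl
    · exact I.eff_cover u hu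
    · exact Or.inr hset
  · intro π r h
    rw [hfin] at h
    have hπ : π ≠ (p, (g i).count p + 1) := by
      rintro rfl
      rw [hf2] at h; simp at h
    rw [(hnew π hπ).1, (hnew π hπ).2, hret, heff]
    obtain ⟨h1, h2⟩ := I.fin_spec π r h
    exact ⟨h1.trans (Nat.lt_succ_self i), h2⟩

omit T in
theorem not_step_idle {m m' : VMem} {e : Event} {l' : Loc} : ¬ LStep .idle m e l' m' := by
  intro h; cases h

omit T in
theorem step_idle_iff {l l' : Loc} {m m' : VMem} {e : Event} (hs : LStep l m e l' m') :
    (∃ b, l = .ret b ∧ e = .resp b ∧ l' = .idle) ∨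
      ((∀ b, l ≠ .ret b) ∧ (∀ b, e ≠ .resp b) ∧ (∀ o, e ≠ .inv o) ∧ l' ≠ .idle) := by
  cases hs with
  | ret b m => exact Or.inl ⟨b, rfl, rfl, rfl⟩
  | vTest_ge k => cases k <;> exact Or.inr (by simp [afterValidate])
  | unlockCas_ok x xs => cases xs <;> exact Or.inr (by simp [afterUnlock])
  | unlockCas_fail x xs => cases xs <;> exact Or.inr (by simp [afterUnlock])
  | _ => exact Or.inr (by simp [traversal])

theorem HInv.succ_step {i : ℕ} (hi : i < α.length) (I : HInv g i) {p : Fin n} {e : Event} {l : Loc}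
    {m : VMem} (hs : LStep ((g i).loc p) (g i).mem e l m)
    (hg : g (i + 1) = (g i).afterStep i p e l m) : HInv g (i + 1) := by
  have J := T.inv i hi.le
  have hop : (g (i + 1)).op = (g i).op := by rw [hg]; rfl
  have hsince : (g (i + 1)).since = (g i).since := by rw [hg]; rfl
  have hcount : (g (i + 1)).count = (g i).count := by rw [hg]; rfl
  have hcur : ∀ q, (g (i + 1)).cur q = (g i).cur q := fun q => by rw [hg]; rfl
  have hloc : ∀ q, q ≠ p → (g (i + 1)).loc q = (g i).loc q := by
    intro q hq; rw [hg]; exact Function.update_of_ne hq _ _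
  have hlocp : (g (i + 1)).loc p = l := by rw [hg]; exact Function.update_self _ _ _
  set π₀ := (g i).cur p with hπ₀
  have hold : ∀ π, π ≠ π₀ → (g (i + 1)).eff π = (g i).eff π ∧ (g (i + 1)).ret π = (g i).ret π ∧
      (g (i + 1)).fin π = (g i).fin π := by
    intro π hπ
    rw [hg]
    exact ⟨Function.update_of_ne hπ _ _, Function.update_of_ne hπ _ _, Function.update_of_ne hπ _ _⟩
  have heff : (g (i + 1)).eff π₀ =
      if isEffect ((g i).op π₀) e = true then some i else (g i).eff π₀ := by
    rw [hg]; exact Function.update_self _ _ _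
  have hret : (g (i + 1)).ret π₀ = retAfter ((g i).op π₀) e ((g i).ret π₀) := by
    rw [hg]; exact Function.update_self _ _ _
  have hfin : (g (i + 1)).fin π₀ = finAfter e i ((g i).fin π₀) := by
    rw [hg]; exact Function.update_self _ _ _
  have hidle : (g i).loc p ≠ .idle := fun h => not_step_idle (h ▸ hs)
  have hfin0 : (g i).fin π₀ = none := I.fin_none p hidle
  have hset := absSet_step J.mem (J.loc p) hs fun prev curr h => J.not_deleted h
  have hmem : (g (i + 1)).mem = m := by rw [hg]; rfl
  rw [← hmem, ← hπ₀] at hset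
  change (_ ∧ _ ∧ setAt g (i + 1) = SetOp.next _ (setAt g i)) ∨
    (_ ∧ setAt g (i + 1) = setAt g i) at hset
  have hcur_ne : ∀ q, q ≠ p → (g i).cur q ≠ π₀ := fun q hq h => hq (congrArg Prod.fst h)
  have hL := (I.loc p).step T hi (I.since_le p) rfl (J.loc p) hs
  constructor
  · intro q
    rw [hcur, hsince]
    exact (I.since_le q).trans (Nat.le_succ i)
  · intro q
    by_cases hq : q = p
    · subst hq
      rw [hcur, hsince, hop, hlocp, ← hπ₀, heff]
      exact hL.succ T hi
    · rw [hcur, hsince, hop, hloc q hq, (hold _ (hcur_ne q hq)).1]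
      exact (I.loc q).succ T hi
  · intro q hl
    rw [hcur]
    by_cases hq : q = p
    · subst hq
      rw [hlocp] at hl
      rw [← hπ₀, hfin]
      rcases step_idle_iff hs with ⟨b, -, -, h⟩ | ⟨-, h, -, -⟩
      · exact absurd h hl
      · cases e <;> first | exact hfin0 | exact absurd rfl (h _)
    · rw [hloc q hq] at hl
      rw [(hold _ (hcur_ne q hq)).2.2]
      exact I.fin_none q hl
  · intro q k hk
    rw [hcount] at hk
    have hne : (q, k) ≠ π₀ := by
      intro h
      obtain rfl : q = p := congrArg Prod.fst h
      have : k = (g i).count q := congrArg Prod.snd h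
      omega
    rw [(hold _ hne).1, (hold _ hne).2.2]
    exact I.fresh q k hk
  · intro π u h
    rw [hsince, hop]
    by_cases hπ : π = π₀
    · rw [hπ] at h ⊢
      rw [heff] at h
      rw [hret]
      rcases hset with ⟨h1, h2, h3⟩ | ⟨h1, h2⟩
      · rw [if_pos h1, Option.some.injEq] at h
        subst h
        refine ⟨Nat.lt_succ_self _, I.since_le p, ?_, h2, h3⟩
        rcases step_idle_iff hs with ⟨b, -, rfl, -⟩ | ⟨-, h, -, -⟩
        · rw [isEffect_eq_false (by simp) (by simp)] at h1
          simp at h1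
        · cases e <;> first | exact absurd rfl (h _) | simp [retAfter, h1]
      · rw [if_neg (by simp [h1])] at h
        obtain ⟨k1, k2, k3, k4⟩ := I.eff_spec π₀ u h
        refine ⟨k1.trans (Nat.lt_succ_self i), k2, ?_, k4⟩
        rcases step_idle_iff hs with ⟨b, hb, rfl, -⟩ | ⟨-, h', -, -⟩
        · have h5 := I.loc p
          rw [hb] at h5
          rcases h5 with ⟨-, rfl⟩ | ⟨h5, -⟩
          · rfl
          · rw [← hπ₀, h] at h5
            simp at h5
        · cases e <;> first | exact absurd rfl (h' _) | simp [retAfter, k3]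
    · rw [(hold π hπ).1] at h
      rw [(hold π hπ).2.1]
      obtain ⟨k1, k2⟩ := I.eff_spec π u h
      exact ⟨k1.trans (Nat.lt_succ_self i), k2⟩
  · have key : ∀ ρ u, ρ ≠ π₀ → (g (i + 1)).eff π₀ = some u → (g i).eff ρ = some u → False := by
      intro ρ u hρ h1 h2
      rw [heff] at h1
      split_ifs at h1
      · have := (I.eff_spec ρ u h2).1
        simp only [Option.some.injEq] at h1
        omega
      · exact hρ (I.eff_inj ρ π₀ u h2 h1)
    intro π ρ u h1 h2
    by_cases hπ : π = π₀
    · by_cases hρ : ρ = π₀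
      · rw [hπ, hρ]
      · rw [hπ] at h1
        rw [(hold ρ hρ).1] at h2
        exact (key ρ u hρ h1 h2).elim
    · by_cases hρ : ρ = π₀
      · rw [hρ] at h2
        rw [(hold π hπ).1] at h1
        exact (key π u hπ h2 h1).elim
      · rw [(hold π hπ).1] at h1
        rw [(hold ρ hρ).1] at h2
        exact I.eff_inj π ρ u h1 h2
  · intro u hu
    rcases Nat.lt_or_eq_of_le (Nat.le_of_lt_succ hu) with hu | rfl
    · refine (I.eff_cover u hu).imp_left fun ⟨π, h⟩ => ⟨π, ?_⟩
      by_cases hπ : π = π₀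
      · rw [hπ] at h ⊢
        rw [heff, if_neg]
        · exact h
        · intro he
          have := (I.loc p).eff_eq_none (J.loc p) hs he
          rw [← hπ₀, h] at this
          simp at this
      · rw [(hold π hπ).1]; exact h
    · rcases hset with ⟨h1, -⟩ | ⟨-, h2⟩
      · exact Or.inl ⟨π₀, by rw [heff, if_pos h1]⟩
      · exact Or.inr h2
  · intro π r h
    rw [hsince, hop]
    by_cases hπ : π = π₀
    · rw [hπ] at h ⊢
      rw [hfin] at h
      rcases step_idle_iff hs with ⟨b, hb, rfl, -⟩ | ⟨-, h', -, -⟩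
      · simp only [finAfter, Option.some.injEq] at h
        subst h
        rw [heff, hret, isEffect_eq_false (by simp) (by simp)]
        refine ⟨Nat.lt_succ_self _, fun u hu => (I.eff_spec π₀ u hu).1, fun hn => ?_⟩
        have h5 := I.loc p
        rw [hb] at h5
        rcases h5 with ⟨h5, -⟩ | ⟨-, h5⟩
        · exact absurd hn h5
        · exact h5
      · have : (g i).fin π₀ = some r := by
          cases e <;> first | exact h | exact absurd rfl (h' _)
        rw [hfin0] at this
        simp at this
    · rw [(hold π hπ).2.2] at h
      rw [(hold π hπ).1, (hold π hπ).2.1]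
      obtain ⟨k1, k2⟩ := I.fin_spec π r h
      exact ⟨k1.trans (Nat.lt_succ_self i), k2⟩

theorem IsTrace.hinv (i : ℕ) (hi : i ≤ α.length) : HInv g i := by
  induction i with
  | zero =>
    refine HInv.initial ?_
    clear hi
    induction T with
    | nil h => exact h
    | snoc _ _ ih => exact ih
  | succ i ih =>
    have I := ih (by omega)
    obtain ⟨a, hs⟩ : ∃ a, GStep i (g i) a (g (i + 1)) := ⟨_, T.step (by omega)⟩
    generalize hc : g i = c at hs
    generalize hc' : g (i + 1) = c' at hs
    cases hs with
    | invoke p o hp =>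
      subst hc
      exact I.succ_invoke T hi hp hc'
    | step p e l m hl =>
      subst hc
      exact I.succ_step T hi hl hc'

end Trace

end VL

/-! ### Linearizability from linearization points -/

namespace HL

variable {n : ℕ}

theorem pair_sublist_append {β : Type*} {a b : β} {l₁ l₂ : List β} (ha : a ∈ l₁) (hb : b ∈ l₂) :
    [a, b].Sublist (l₁ ++ l₂) :=
  (List.singleton_sublist.mpr ha).append (List.singleton_sublist.mpr hb)

/-- The set after a sequence of operations. -/
def run (q : Set ℤ) (l : List (SetOp × Bool)) : Set ℤ := l.foldl (fun q a => a.1.next q) q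

theorem legal_append {q : Set ℤ} {l₁ l₂ : List (SetOp × Bool)} :
    SetOp.Legal q (l₁ ++ l₂) ↔ SetOp.Legal q l₁ ∧ SetOp.Legal (run q l₁) l₂ := by
  induction l₁ generalizing q with
  | nil => simp [SetOp.Legal, run]
  | cons a l ih => simp [SetOp.Legal, run, ih, and_assoc]

theorem run_append {q : Set ℤ} {l₁ l₂ : List (SetOp × Bool)} :
    run q (l₁ ++ l₂) = run (run q l₁) l₂ := List.foldl_append

/-- The invocation and the response of an operation. -/
def pair (op : OpId n → SetOp) (ret : OpId n → Bool) (π : OpId n) : List (OpId n × HLEvent) :=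
  [(π, .inv (op π)), (π, .resp (ret π))]

/-- The history of the first `c` operations of the process `p`, all of them complete. -/
def ops (op : OpId n → SetOp) (ret : OpId n → Bool) (p : Fin n) (c : ℕ) :
    List (OpId n × HLEvent) :=
  (List.range c).flatMap fun k => pair op ret (p, k + 1)

theorem ops_succ (op : OpId n → SetOp) (ret : OpId n → Bool) (p : Fin n) (c : ℕ) :
    ops op ret p (c + 1) = ops op ret p c ++ pair op ret (p, c + 1) := by
  simp [ops, List.range_succ]

theorem mem_ops {op : OpId n → SetOp} {ret : OpId n → Bool} {p : Fin n} {c : ℕ} {π : OpId n}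
    {e : HLEvent} (h : (π, e) ∈ ops op ret p c) :
    π.1 = p ∧ 1 ≤ π.2 ∧ π.2 ≤ c ∧ (e = .inv (op π) ∨ e = .resp (ret π)) := by
  simp only [ops, List.mem_flatMap, List.mem_range, pair, List.mem_cons, Prod.mk.injEq,
    List.not_mem_nil, or_false] at h
  obtain ⟨k, hk, ⟨rfl, rfl⟩ | ⟨rfl, rfl⟩⟩ := h
  · exact ⟨rfl, by simp, hk, Or.inl rfl⟩
  · exact ⟨rfl, by simp, hk, Or.inr rfl⟩

theorem resp_mem_ops (op : OpId n → SetOp) (ret : OpId n → Bool) (p : Fin n) {k c : ℕ}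
    (h : k < c) : ((p, k + 1), HLEvent.resp (ret (p, k + 1))) ∈ ops op ret p c := by
  simp only [ops, List.mem_flatMap, List.mem_range, pair]
  exact ⟨k, h, by simp⟩

theorem ops_prefix (op : OpId n → SetOp) (ret : OpId n → Bool) (p : Fin n) {k c : ℕ} (h : k ≤ c) :
    ops op ret p k <+: ops op ret p c := by
  induction c, h using Nat.le_induction with
  | base => exact List.prefix_rfl
  | succ c _ ih => rw [ops_succ]; exact ih.trans (List.prefix_append _ _)

theorem filter_filterMap_key {β : Type*} (key : β → Fin n) (f : Fin n → Option β)
    (hf : ∀ p, ∀ b ∈ f p, key b = p) (p : Fin n) (l : List (Fin n)) (hl : l.Nodup) :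
    (l.filterMap f).filter (fun b => decide (key b = p)) = if p ∈ l then (f p).toList else [] := by
  induction l with
  | nil => simp
  | cons q l ih =>
    rw [List.nodup_cons] at hl
    have ih := ih hl.2
    by_cases hq : p = q
    · subst hq
      rw [if_neg hl.1] at ih
      rw [if_pos List.mem_cons_self]
      cases h : f p with
      | none => rw [List.filterMap_cons_none h, ih]; rfl
      | some b => simp [List.filterMap_cons_some h, ih, hf p b h]
    · simp only [List.mem_cons, hq, false_or]
      cases h : f q with
      | none => rw [List.filterMap_cons_none h, ih]
      | some b => simp [List.filterMap_cons_some h, ih, hf q b h, Ne.symm hq]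

/-- Operations with linearization points. At the times from `0` to `N`, the state of the set is
given by `S`. The first `D p` operations of a process `p` are linearized, the operation `π` at time
`τ π`; it changes the set between the times `τ π - 1` and `τ π` if `e π` is true, and it does not
change the set otherwise. -/
structure Points (op : OpId n → SetOp) (ret : OpId n → Bool) (D : Fin n → ℕ) (S : ℕ → Set ℤ)
    (N : ℕ) (τ : OpId n → ℕ) (e : OpId n → Bool) : Prop where
  zero : S 0 = ∅
  le : ∀ p k, k < D p → τ (p, k + 1) ≤ N
  eff : ∀ p k, k < D p → e (p, k + 1) = true → ret (p, k + 1) = true ∧ ∃ u, τ (p, k + 1) = u + 1 ∧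
    (op (p, k + 1)).succeeds (S u) ∧ S (u + 1) = (op (p, k + 1)).next (S u)
  read : ∀ p k, k < D p → e (p, k + 1) = false →
    (ret (p, k + 1) = true ↔ (op (p, k + 1)).succeeds (S (τ (p, k + 1)))) ∧
      (op (p, k + 1)).next (S (τ (p, k + 1))) = S (τ (p, k + 1))
  inj : ∀ p k q l, k < D p → l < D q → e (p, k + 1) = true → e (q, l + 1) = true →
    τ (p, k + 1) = τ (q, l + 1) → (p, k + 1) = (q, l + 1)
  cover : ∀ u < N, (∃ p k, k < D p ∧ e (p, k + 1) = true ∧ τ (p, k + 1) = u + 1) ∨ S (u + 1) = S u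

section Points

variable {op : OpId n → SetOp} {ret : OpId n → Bool} {D : Fin n → ℕ} {S : ℕ → Set ℤ}
  {N : ℕ} {τ : OpId n → ℕ} {e : OpId n → Bool}

/-- The operations that are linearized. -/
def linOps (D : Fin n → ℕ) : List (OpId n) :=
  (List.finRange n).flatMap fun p => (List.range (D p)).map fun k => (p, k + 1)

theorem mem_linOps {π : OpId n} : π ∈ linOps D ↔ ∃ p k, k < D p ∧ π = (p, k + 1) := by
  simp only [linOps, List.mem_flatMap, List.mem_finRange, true_and, List.mem_map, List.mem_range]
  constructor
  · rintro ⟨p, k, h, rfl⟩; exact ⟨p, k, h, rfl⟩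
  · rintro ⟨p, k, h, rfl⟩; exact ⟨p, k, h, rfl⟩

theorem nodup_linOps (D : Fin n → ℕ) : (linOps D).Nodup := by
  rw [linOps, List.nodup_flatMap]
  refine ⟨fun p _ => List.nodup_range.map fun k l h => by simpa using h, ?_⟩
  refine (List.nodup_finRange n).imp fun {p q} hpq => ?_
  intro π h1 h2
  rw [List.mem_map] at h1 h2
  obtain ⟨k, -, rfl⟩ := h1
  obtain ⟨l, -, h⟩ := h2
  exact hpq (congrArg Prod.fst h).symm

/-- The operations linearized at time `t`: first the one that changes the set. -/
def block (D : Fin n → ℕ) (τ : OpId n → ℕ) (e : OpId n → Bool) (t : ℕ) : List (OpId n) :=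
  (linOps D).filter (fun π => decide (τ π = t) && e π) ++
    (linOps D).filter (fun π => decide (τ π = t) && !e π)

/-- The linearization: the operations in the order of their linearization points. -/
def linearization (D : Fin n → ℕ) (τ : OpId n → ℕ) (e : OpId n → Bool) (N : ℕ) : List (OpId n) :=
  (List.range (N + 1)).flatMap (block D τ e)

theorem mem_block {π : OpId n} {t : ℕ} : π ∈ block D τ e t ↔ π ∈ linOps D ∧ τ π = t := by
  simp only [block, List.mem_append, List.mem_filter, Bool.and_eq_true, decide_eq_true_eq,
    Bool.not_eq_true']
  cases e π <;> simp

theorem mem_linearization (P : Points op ret D S N τ e) {π : OpId n} :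
    π ∈ linearization D τ e N ↔ ∃ p k, k < D p ∧ π = (p, k + 1) := by
  rw [← mem_linOps]
  simp only [linearization, List.mem_flatMap, List.mem_range, mem_block]
  constructor
  · rintro ⟨t, -, h, -⟩; exact h
  · intro h
    obtain ⟨p, k, hk, rfl⟩ := mem_linOps.mp h
    exact ⟨_, Nat.lt_succ_of_le (P.le p k hk), h, rfl⟩

theorem pairwise_linearization :
    (linearization D τ e N).Pairwise fun π ρ => τ π ≤ τ ρ := by
  rw [linearization, List.pairwise_flatMap]
  constructor
  · intro t _
    refine List.pairwise_of_forall_mem_list fun π h1 ρ h2 => ?_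
    rw [(mem_block.mp h1).2, (mem_block.mp h2).2]
  · refine List.pairwise_lt_range.imp fun {s t} hst π h1 ρ h2 => ?_
    rw [(mem_block.mp h1).2, (mem_block.mp h2).2]
    exact hst.le

theorem nodup_linearization : (linearization D τ e N).Nodup := by
  rw [linearization, List.nodup_flatMap]
  constructor
  · intro t _
    refine ((nodup_linOps D).filter _).append ((nodup_linOps D).filter _) fun π h1 h2 => ?_
    simp only [List.mem_filter, Bool.and_eq_true, Bool.not_eq_true'] at h1 h2
    rw [h1.2.2] at h2
    simp at h2
  · refine List.nodup_range.imp fun {s t} hst π h1 h2 => ?_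
    exact hst ((mem_block.mp h1).2.symm.trans (mem_block.mp h2).2)

theorem legal_linearization (P : Points op ret D S N τ e) :
    SetOp.Legal ∅ ((linearization D τ e N).map fun π => (op π, ret π)) := by
  set f : OpId n → SetOp × Bool := fun π => (op π, ret π) with hf
  -- operations that do not change the set
  have reads : ∀ (q : Set ℤ) (l : List (OpId n)),
      (∀ π ∈ l, (ret π = true ↔ (op π).succeeds q) ∧ (op π).next q = q) →
      SetOp.Legal q (l.map f) ∧ run q (l.map f) = q := by
    intro q l
    induction l with
    | nil => exact fun _ => ⟨trivial, rfl⟩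
    | cons π l ih =>
      intro h
      obtain ⟨h1, h2⟩ := h π List.mem_cons_self
      obtain ⟨h3, h4⟩ := ih fun ρ hρ => h ρ (List.mem_cons_of_mem _ hρ)
      refine ⟨⟨h1, ?_⟩, ?_⟩
      · rw [h2]; exact h3
      · change run ((op π).next q) (l.map f) = q
        rw [h2, h4]
  have reads_at : ∀ t, SetOp.Legal (S t)
        (((linOps D).filter (fun π => decide (τ π = t) && !e π)).map f) ∧
      run (S t) (((linOps D).filter (fun π => decide (τ π = t) && !e π)).map f) = S t := by
    refine fun t => reads _ _ fun π hπ => ?_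
    simp only [List.mem_filter, Bool.and_eq_true, decide_eq_true_eq, Bool.not_eq_true'] at hπ
    obtain ⟨h1, rfl, h3⟩ := hπ
    obtain ⟨p, k, hk, rfl⟩ := mem_linOps.mp h1
    exact P.read p k hk h3
  have key : ∀ t ≤ N, SetOp.Legal ∅ (((List.range (t + 1)).flatMap (block D τ e)).map f) ∧
      run ∅ (((List.range (t + 1)).flatMap (block D τ e)).map f) = S t := by
    intro t
    induction t with
    | zero =>
      intro _
      have h0 : (linOps D).filter (fun π => decide (τ π = 0) && e π) = [] := by
        rw [List.filter_eq_nil_iff]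
        intro π hπ h
        simp only [Bool.and_eq_true, decide_eq_true_eq] at h
        obtain ⟨p, k, hk, rfl⟩ := mem_linOps.mp hπ
        obtain ⟨-, u, hu, -⟩ := P.eff p k hk h.2
        omega
      have := reads_at 0
      rw [P.zero] at this
      simpa [block, h0, P.zero] using this
    | succ t ih =>
      intro ht
      obtain ⟨ih1, ih2⟩ := ih (by omega)
      rw [List.range_succ, List.flatMap_append, List.map_append, legal_append, run_append, ih2]
      rw [List.flatMap_singleton, block, List.map_append, legal_append, run_append]
      obtain ⟨r1, r2⟩ := reads_at (t + 1)
      suffices h : SetOp.Legal (S t)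
            (((linOps D).filter (fun π => decide (τ π = t + 1) && e π)).map f) ∧
          run (S t) (((linOps D).filter (fun π => decide (τ π = t + 1) && e π)).map f) =
            S (t + 1) by
        rw [h.2]
        exact ⟨⟨ih1, h.1, r1⟩, r2⟩
      have mem : ∀ π, π ∈ (linOps D).filter (fun π => decide (τ π = t + 1) && e π) ↔
          ∃ p k, k < D p ∧ π = (p, k + 1) ∧ τ π = t + 1 ∧ e π = true := by
        intro π
        simp only [List.mem_filter, Bool.and_eq_true, decide_eq_true_eq, mem_linOps]
        constructor
        · rintro ⟨⟨p, k, h1, h2⟩, h3, h4⟩; exact ⟨p, k, h1, h2, h3, h4⟩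
        · rintro ⟨p, k, h1, h2, h3, h4⟩; exact ⟨⟨p, k, h1, h2⟩, h3, h4⟩
      have nd := (nodup_linOps D).filter (fun π => decide (τ π = t + 1) && e π)
      generalize (linOps D).filter (fun π => decide (τ π = t + 1) && e π) = l at mem nd ⊢
      match l, mem, nd with
      | [], mem, _ =>
        rcases P.cover t (by omega) with ⟨p, k, h1, h2, h3⟩ | h
        · exact absurd ((mem (p, k + 1)).mpr ⟨p, k, h1, rfl, h3, h2⟩) List.not_mem_nil
        · exact ⟨trivial, h.symm⟩
      | [π], mem, _ =>
        obtain ⟨p, k, h1, rfl, h3, h4⟩ := (mem π).mp List.mem_cons_self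
        obtain ⟨h5, u, h6, h7, h8⟩ := P.eff p k h1 h4
        obtain rfl : u = t := by omega
        exact ⟨⟨iff_of_true h5 h7, trivial⟩, h8.symm⟩
      | π :: ρ :: l, mem, nd =>
        obtain ⟨p, k, h1, rfl, h3, h4⟩ := (mem π).mp List.mem_cons_self
        obtain ⟨q, j, k1, rfl, k3, k4⟩ := (mem ρ).mp (List.mem_cons_of_mem _ List.mem_cons_self)
        have := P.inj p k q j h1 k1 h4 k4 (h3.trans k3.symm)
        rw [this] at nd
        simp at nd
  exact (key N le_rfl).1

theorem sequential_eq (l : List (OpId n)) :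
    sequential (l.map fun π => (π, op π, ret π)) = l.flatMap (pair op ret) := by
  rw [sequential, List.flatMap_map]
  rfl

theorem filter_flatMap_pair (p : Fin n) (l : List (OpId n)) :
    (l.flatMap (pair op ret)).filter (fun a => decide (a.1.1 = p)) =
      (l.filter fun π => decide (π.1 = p)).flatMap (pair op ret) := by
  induction l with
  | nil => rfl
  | cons π l ih =>
    rw [List.flatMap_cons, List.filter_append, ih, List.filter_cons]
    by_cases h : π.1 = p <;> simp [pair, h]

open Classical in
/-- A high-level history is linearizable if its operations have linearization points between their
invocations and their responses. The process `p` has completed `d p` operations; it may have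
a pending one, which may be linearized. -/
theorem linearizable_of_points {H : List (OpId n × HLEvent)} {d : Fin n → ℕ}
    (P : Points op ret D S N τ e)
    (hH : ∀ p, (D p = d p ∧ H.filter (fun a => decide (a.1.1 = p)) = ops op ret p (d p)) ∨
      (D p = d p ∧ H.filter (fun a => decide (a.1.1 = p)) =
        ops op ret p (d p) ++ [((p, d p + 1), .inv (op (p, d p + 1)))]) ∨
      (D p = d p + 1 ∧ H.filter (fun a => decide (a.1.1 = p)) =
        ops op ret p (d p) ++ [((p, d p + 1), .inv (op (p, d p + 1)))]))
    (order : ∀ p k q l b o, k < D p → l < D q →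
      [((p, k + 1), HLEvent.resp b), ((q, l + 1), HLEvent.inv o)].Sublist H →
      τ (p, k + 1) < τ (q, l + 1)) :
    Linearizable H := by
  set f : Fin n → Option (OpId n × Bool) := fun p =>
    if d p < D p then some ((p, D p), ret (p, D p)) else none with hf
  set R := (List.finRange n).filterMap f with hR
  set R' := R.map (fun a => (a.1, HLEvent.resp a.2)) with hR'
  set K := (H ++ R').filter fun a => decide (Responded (H ++ R') a.1) with hK
  have hR'p : ∀ p, R'.filter (fun a => decide (a.1.1 = p)) =
      if d p < D p then [((p, D p), .resp (ret (p, D p)))] else [] := by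
    intro p
    have hfp : ∀ q, ∀ b ∈ f q, b.1.1 = q := by
      intro q b hb
      simp only [hf] at hb
      split_ifs at hb
      · simp only [Option.mem_def, Option.some.injEq] at hb
        rw [← hb]
      · simp at hb
    rw [hR', List.filter_map]
    change (R.filter fun b => decide (b.1.1 = p)).map _ = _
    rw [hR, filter_filterMap_key (fun b => b.1.1) f hfp p _ (List.nodup_finRange n),
      if_pos (List.mem_finRange p)]
    simp only [hf]
    split_ifs <;> rfl
  have hHR : ∀ p, (H ++ R').filter (fun a => decide (a.1.1 = p)) = ops op ret p (D p) ∨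
      (D p = d p ∧ (H ++ R').filter (fun a => decide (a.1.1 = p)) =
        ops op ret p (D p) ++ [((p, d p + 1), .inv (op (p, d p + 1)))]) := by
    intro p
    rw [List.filter_append, hR'p]
    rcases hH p with ⟨h1, h2⟩ | ⟨h1, h2⟩ | ⟨h1, h2⟩
    · left; rw [h2, h1, if_neg (lt_irrefl _), List.append_nil]
    · right; rw [h2, h1, if_neg (lt_irrefl _), List.append_nil]; exact ⟨rfl, rfl⟩
    · left; rw [h2, h1, if_pos (Nat.lt_succ_self _), ops_succ, List.append_assoc]; rfl
  have resp_mem : ∀ p k, k < D p → Responded (H ++ R') (p, k + 1) := by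
    intro p k hk
    refine ⟨ret (p, k + 1), ?_⟩
    have h1 := resp_mem_ops op ret p hk
    have h2 : ((p, k + 1), HLEvent.resp (ret (p, k + 1))) ∈
        (H ++ R').filter (fun a => decide (a.1.1 = p)) := by
      rcases hHR p with h | ⟨-, h⟩
      · rw [h]; exact h1
      · rw [h]; exact List.mem_append_left _ h1
    exact (List.mem_filter.mp h2).1
  have resp_lt : ∀ π, Responded (H ++ R') π → 1 ≤ π.2 ∧ π.2 ≤ D π.1 := by
    rintro π ⟨b, hb⟩
    have h2 : (π, HLEvent.resp b) ∈ (H ++ R').filter (fun a => decide (a.1.1 = π.1)) :=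
      List.mem_filter.mpr ⟨hb, by simp⟩
    rcases hHR π.1 with h | ⟨-, h⟩
    · rw [h] at h2
      exact ⟨(mem_ops h2).2.1, (mem_ops h2).2.2.1⟩
    · rw [h] at h2
      rcases List.mem_append.mp h2 with h2 | h2
      · exact ⟨(mem_ops h2).2.1, (mem_ops h2).2.2.1⟩
      · simp at h2
  have hKp : ∀ p, K.filter (fun a => decide (a.1.1 = p)) = ops op ret p (D p) := by
    intro p
    rw [hK, List.filter_comm]
    have h1 : (ops op ret p (D p)).filter (fun a => decide (Responded (H ++ R') a.1)) =
        ops op ret p (D p) := by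
      rw [List.filter_eq_self]
      rintro ⟨⟨q, k⟩, e⟩ ha
      obtain ⟨rfl, h2, h3, -⟩ := mem_ops ha
      obtain ⟨k, rfl⟩ := Nat.exists_eq_add_of_le' h2
      exact decide_eq_true (resp_mem _ k h3)
    rcases hHR p with h | ⟨hd, h⟩
    · rw [h, h1]
    · rw [h, List.filter_append, h1, List.filter_cons_of_neg, List.filter_nil, List.append_nil]
      simp only [decide_eq_true_eq]
      intro hr
      have := (resp_lt _ hr).2
      simp only at this
      omega
  have order' : ∀ p k l, l < D p → k < l → τ (p, k + 1) < τ (p, l + 1) := by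
    intro p k l hl hkl
    refine order p k p l (ret (p, k + 1)) (op (p, l + 1)) (by omega) hl ?_
    refine List.Sublist.trans ?_ (List.filter_sublist (p := fun a => decide (a.1.1 = p)))
    have h1 : ((p, k + 1), HLEvent.resp (ret (p, k + 1))) ∈ ops op ret p l :=
      resp_mem_ops op ret p hkl
    have h2 : ops op ret p l ++ [((p, l + 1), .inv (op (p, l + 1)))] <+:
        ops op ret p (l + 1) := by
      rw [ops_succ]
      exact (List.prefix_append_right_inj _).mpr ⟨[_], rfl⟩
    have h3 := pair_sublist_append h1 (List.mem_singleton_self ((p, l + 1),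
      HLEvent.inv (op (p, l + 1))))
    refine h3.trans (List.IsPrefix.sublist ?_)
    rcases hH p with ⟨k1, k2⟩ | ⟨k1, k2⟩ | ⟨k1, k2⟩
    · rw [k2]
      exact h2.trans (ops_prefix op ret p (by omega))
    · rw [k2]
      exact (h2.trans (ops_prefix op ret p (by omega))).trans (List.prefix_append _ _)
    · rw [k2]
      rcases Nat.lt_or_eq_of_le (show l ≤ d p by omega) with h | rfl
      · exact (h2.trans (ops_prefix op ret p (by omega))).trans (List.prefix_append _ _)
      · exact List.prefix_rfl
  set L := linearization D τ e N with hL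
  have hLp : ∀ p, L.filter (fun π => decide (π.1 = p)) =
      (List.range (D p)).map fun k => (p, k + 1) := by
    intro p
    have hmem : ∀ π, π ∈ L.filter (fun π => decide (π.1 = p)) ↔ ∃ k < D p, π = (p, k + 1) := by
      intro π
      rw [List.mem_filter, mem_linearization P, decide_eq_true_eq]
      constructor
      · rintro ⟨⟨q, k, h1, rfl⟩, rfl⟩; exact ⟨k, h1, rfl⟩
      · rintro ⟨k, h1, rfl⟩; exact ⟨⟨p, k, h1, rfl⟩, rfl⟩
    have : Std.Irrefl (fun π ρ : OpId n => π.2 < ρ.2) := ⟨fun _ => lt_irrefl _⟩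
    refine List.Pairwise.eq_of_mem_iff (r := fun π ρ : OpId n => π.2 < ρ.2) ?_ ?_ fun π => ?_
    · have h1 : (L.filter fun π => decide (π.1 = p)).Pairwise fun π ρ => τ π ≤ τ ρ :=
        pairwise_linearization.filter _
      have h2 : (L.filter fun π => decide (π.1 = p)).Pairwise fun π ρ => π ≠ ρ :=
        nodup_linearization.filter _
      refine List.Pairwise.imp_of_mem ?_ (h1.and h2)
      rintro π ρ h3 h4 ⟨h5, h6⟩
      obtain ⟨k, hk, rfl⟩ := (hmem π).mp h3
      obtain ⟨l, hl, rfl⟩ := (hmem ρ).mp h4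
      by_contra hkl
      have hlk : l < k := by
        rcases Nat.lt_trichotomy k l with h | rfl | h
        · exact absurd (Nat.succ_lt_succ h) hkl
        · exact absurd rfl h6
        · exact h
      exact absurd (order' p l k hk hlk) (not_lt.mpr h5)
    · rw [List.pairwise_map]
      exact List.pairwise_lt_range.imp fun h => Nat.succ_lt_succ h
    · rw [hmem, List.mem_map]
      simp only [List.mem_range]
      constructor
      · rintro ⟨k, hk, rfl⟩; exact ⟨k, hk, rfl⟩
      · rintro ⟨k, hk, rfl⟩; exact ⟨k, hk, rfl⟩
  refine ⟨K, ⟨R, ?_, ?_, rfl⟩, L.map fun π => (π, op π, ret π), ?_, ?_, ?_⟩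
  · rw [hR, List.map_filterMap]
    refine (List.nodup_finRange n).filterMap fun p q π h1 h2 => ?_
    simp only [hf, Option.mem_def, Option.map_eq_some_iff] at h1 h2
    obtain ⟨a, h1, rfl⟩ := h1
    obtain ⟨b, h2, h3⟩ := h2
    split_ifs at h1 h2
    simp only [Option.some.injEq] at h1 h2
    rw [← h1, ← h2] at h3
    exact (congrArg Prod.fst h3).symm
  · intro a ha
    rw [hR, List.mem_filterMap] at ha
    obtain ⟨p, -, h1⟩ := ha
    simp only [hf] at h1
    split_ifs at h1 with hd
    simp only [Option.some.injEq] at h1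
    subst h1
    rcases hH p with ⟨h1, h2⟩ | ⟨h1, h2⟩ | ⟨h1, h2⟩
    · omega
    · omega
    · constructor
      · refine ⟨op (p, d p + 1), ?_⟩
        have : ((p, D p), HLEvent.inv (op (p, d p + 1))) ∈
            H.filter (fun a => decide (a.1.1 = p)) := by
          rw [h2, h1]; simp
        exact (List.mem_filter.mp this).1
      · rintro ⟨b, hb⟩
        have : ((p, D p), HLEvent.resp b) ∈ H.filter (fun a => decide (a.1.1 = p)) :=
          List.mem_filter.mpr ⟨hb, by simp⟩
        rw [h2] at this
        rcases List.mem_append.mp this with h3 | h3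
        · have := (mem_ops h3).2.2.1
          simp only at this
          omega
        · simp at h3
  · intro p
    rw [hKp, sequential_eq, filter_flatMap_pair, hLp, List.flatMap_map]
    rfl
  · rintro π ρ ⟨b, o, hs⟩
    have hKsub : K.Sublist (H ++ R') := List.filter_sublist
    have lin : ∀ π e, (π, e) ∈ K → ∃ p k, k < D p ∧ π = (p, k + 1) := by
      intro π e h
      have h1 := of_decide_eq_true (List.mem_filter.mp h).2
      obtain ⟨h2, h3⟩ := resp_lt π h1
      obtain ⟨k, hk⟩ := Nat.exists_eq_add_of_le' h2
      exact ⟨π.1, k, by omega, Prod.ext rfl hk⟩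
    obtain ⟨p, k, hk, rfl⟩ := lin π _ (hs.subset List.mem_cons_self)
    obtain ⟨q, l, hl, rfl⟩ := lin ρ _ (hs.subset (List.mem_cons_of_mem _ List.mem_cons_self))
    have hsH : [((p, k + 1), HLEvent.resp b), ((q, l + 1), HLEvent.inv o)].Sublist H := by
      obtain ⟨l₁, l₂, h1, h2, h3⟩ := List.sublist_append_iff.mp (hs.trans hKsub)
      rcases List.eq_nil_or_concat l₂ with rfl | ⟨l₂, x, rfl⟩
      · rw [h1, List.append_nil]; exact h2
      · exfalso
        have h4 : x = ((q, l + 1), HLEvent.inv o) := by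
          rw [List.concat_eq_append, ← List.append_assoc] at h1
          have := congrArg List.getLast? h1
          simpa using this.symm
        have h5 : x ∈ R' := h3.subset (by simp)
        rw [h4, hR', List.mem_map] at h5
        obtain ⟨a, -, h6⟩ := h5
        simp at h6
    have hlt := order p k q l b o hk hl hsH
    have m1 : (p, k + 1) ∈ L := (mem_linearization P).mpr ⟨p, k, hk, rfl⟩
    have m2 : (q, l + 1) ∈ L := (mem_linearization P).mpr ⟨q, l, hl, rfl⟩
    obtain ⟨s, t, hst⟩ := List.append_of_mem m2
    have m3 : (p, k + 1) ∈ s := by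
      rw [hst] at m1
      rcases List.mem_append.mp m1 with h | h
      · exact h
      · exfalso
        rcases List.mem_cons.mp h with h | h
        · rw [h] at hlt; exact lt_irrefl _ hlt
        · have h1 : L.Pairwise fun π ρ => τ π ≤ τ ρ := pairwise_linearization
          rw [hst, List.pairwise_append, List.pairwise_cons] at h1
          exact absurd (h1.2.1.1 _ h) (not_le.mpr hlt)
    refine ⟨ret (p, k + 1), op (q, l + 1), ?_⟩
    rw [sequential_eq, hst, List.flatMap_append]
    refine pair_sublist_append ?_ ?_
    · exact List.mem_flatMap.mpr ⟨_, m3, by simp [pair]⟩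
    · exact List.mem_flatMap.mpr ⟨_, List.mem_cons_self, by simp [pair]⟩
  · rw [List.map_map]
    exact legal_linearization P

end Points

end HL

/-! ### The high-level history of an execution -/

namespace VL

variable {n : ℕ} {g : ℕ → GState n} {α : List (OpId n × Event)}

theorem highLevel_append {I : Type} (H K : List (I × Event)) :
    highLevel (H ++ K) = highLevel H ++ highLevel K := List.filterMap_append

theorem exists_getElem?_of_sublist_filterMap {β γ : Type*} {f : β → Option γ} {a b : γ} {l : List β}
    (h : [a, b].Sublist (l.filterMap f)) :
    ∃ (i j : ℕ) (x y : β), i < j ∧ l[i]? = some x ∧ l[j]? = some y ∧ f x = some a ∧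
      f y = some b := by
  induction l with
  | nil => simp at h
  | cons z l ih =>
    have shift : [a, b].Sublist (l.filterMap f) → ∃ (i j : ℕ) (x y : β), i < j ∧
        (z :: l)[i]? = some x ∧
        (z :: l)[j]? = some y ∧ f x = some a ∧ f y = some b := fun h => by
      obtain ⟨i, j, x, y, h1, h2, h3, h4⟩ := ih h
      exact ⟨i + 1, j + 1, x, y, by omega, by simpa using h2, by simpa using h3, h4⟩
    cases hz : f z with
    | none => exact shift (by rwa [List.filterMap_cons_none hz] at h)
    | some c =>
      rw [List.filterMap_cons_some hz] at h
      cases h with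
      | cons _ h => exact shift h
      | cons_cons _ h =>
        obtain ⟨y, hy, hb⟩ := List.mem_filterMap.mp (List.singleton_sublist.mp h)
        obtain ⟨j, hj⟩ := List.mem_iff_getElem?.mp hy
        exact ⟨0, j + 1, z, y, by omega, rfl, by simpa using hj, hz, hb⟩

theorem IsTrace.zero (T : IsTrace g α) : g 0 = GState.initial n := by
  induction T with
  | nil h => exact h
  | snoc _ _ ih => exact ih

/-- The operations of a process are counted from one. -/
theorem IsTrace.eff_zero (T : IsTrace g α) : ∀ i ≤ α.length,
    (∀ p, (g i).loc p ≠ .idle → 0 < (g i).count p) ∧ ∀ p, (g i).eff (p, 0) = none := by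
  intro i
  induction i with
  | zero => rw [T.zero]; exact fun _ => ⟨fun p h => absurd rfl h, fun _ => rfl⟩
  | succ i ih =>
    intro hi
    obtain ⟨ih1, ih2⟩ := ih (by omega)
    obtain ⟨a, hs⟩ : ∃ a, GStep i (g i) a (g (i + 1)) := ⟨_, T.step (by omega)⟩
    generalize g i = s at hs ih1 ih2
    generalize g (i + 1) = s' at hs
    cases hs with
    | invoke p o hp =>
      refine ⟨fun q hq => ?_, ih2⟩
      by_cases h : q = p
      · subst h; simp [GState.afterInvoke]
      · simp only [GState.afterInvoke, ne_eq, h, not_false_eq_true, Function.update_of_ne] at hq ⊢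
        exact ih1 q hq
    | step p e l m hl =>
      have hp := ih1 p fun h => not_step_idle (h ▸ hl)
      refine ⟨fun q hq => ?_, fun q => ?_⟩
      · by_cases h : q = p
        · subst h; exact hp
        · simp only [GState.afterStep, ne_eq, h, not_false_eq_true, Function.update_of_ne] at hq
          exact ih1 q hq
      · have hne : (q, 0) ≠ s.cur p := fun h => by
          have := congrArg Prod.snd h
          simp only at this
          omega
        exact (Function.update_of_ne hne _ _).trans (ih2 q)

/-- The ghost variables record the invocations and the responses. -/
theorem IsTrace.events (T : IsTrace g α) :
    (∀ (j : ℕ) (π : OpId n) (e : Event), α[j]? = some (π, e) → π.2 ≤ (g α.length).count π.1) ∧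
    (∀ (j : ℕ) (π : OpId n) (o : SetOp), α[j]? = some (π, .inv o) →
      (g α.length).since π = j + 1) ∧
    (∀ (j : ℕ) (π : OpId n) (b : Bool), α[j]? = some (π, .resp b) →
      (g α.length).fin π = some j) := by
  induction T with
  | nil h => simp
  | @snoc α a T hs ih =>
    obtain ⟨ih1, ih2, ih3⟩ := ih
    have I := T.hinv α.length le_rfl
    have split : ∀ {j : ℕ} {x : OpId n × Event}, (α ++ [a])[j]? = some x →
        α[j]? = some x ∨ (j = α.length ∧ a = x) := by
      intro j x h
      rcases Nat.lt_trichotomy j α.length with hj | rfl | hj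
      · rw [List.getElem?_append_left hj] at h; exact Or.inl h
      · right; simpa using h
      · rw [List.getElem?_eq_none (by simpa using hj)] at h; simp at h
    simp only [List.length_append, List.length_singleton]
    generalize hc : g α.length = s at hs
    generalize g (α.length + 1) = s' at hs
    cases hs with
    | invoke p o hp =>
      subst hc
      refine ⟨fun j π e h => ?_, fun j π o' h => ?_, fun j π b h => ?_⟩
      · have h1 : ∀ q, (g α.length).count q ≤
            ((g α.length).afterInvoke α.length p o).count q := by
          intro q
          by_cases hq : q = p
          · subst hq; simp [GState.afterInvoke]
          · simp [GState.afterInvoke, hq]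
        rcases split h with h | ⟨rfl, h3⟩
        · exact (ih1 j π e h).trans (h1 _)
        · simp only [Prod.mk.injEq] at h3
          obtain ⟨rfl, -⟩ := h3
          simp [GState.afterInvoke]
      · rcases split h with h | ⟨rfl, h3⟩
        · have hne : π ≠ (p, (g α.length).count p + 1) := by
            rintro rfl
            have := ih1 j _ _ h
            simp at this
          simp only [GState.afterInvoke]
          rw [Function.update_of_ne hne]
          exact ih2 j π o' h
        · simp only [Prod.mk.injEq] at h3
          obtain ⟨rfl, -⟩ := h3
          simp [GState.afterInvoke]
      · rcases split h with h | ⟨rfl, h3⟩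
        · exact ih3 j π b h
        · simp at h3
    | step p e l m hl =>
      subst hc
      refine ⟨fun j π e' h => ?_, fun j π o' h => ?_, fun j π b h => ?_⟩
      · rcases split h with h | ⟨rfl, h3⟩
        · exact ih1 j π e' h
        · simp only [Prod.mk.injEq] at h3
          obtain ⟨rfl, -⟩ := h3
          exact le_rfl
      · rcases split h with h | ⟨rfl, h3⟩
        · exact ih2 j π o' h
        · simp only [Prod.mk.injEq] at h3
          obtain ⟨-, rfl⟩ := h3
          rcases step_idle_iff hl with ⟨b, -, h, -⟩ | ⟨-, -, h, -⟩
          · simp at h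
          · exact absurd rfl (h _)
      · rcases split h with h | ⟨rfl, h3⟩
        · have hne : π ≠ (g α.length).cur p := by
            rintro rfl
            have h1 := ih3 j _ _ h
            rw [I.fin_none p fun h => not_step_idle (h ▸ hl)] at h1
            simp at h1
          simp only [GState.afterStep]
          rw [Function.update_of_ne hne]
          exact ih3 j π b h
        · simp only [Prod.mk.injEq] at h3
          obtain ⟨rfl, rfl⟩ := h3
          simp [GState.afterStep, finAfter]

theorem ops_congr {op op' : OpId n → SetOp} {ret ret' : OpId n → Bool} {p : Fin n} {c : ℕ}
    (h : ∀ k < c, op' (p, k + 1) = op (p, k + 1) ∧ ret' (p, k + 1) = ret (p, k + 1)) :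
    HL.ops op' ret' p c = HL.ops op ret p c := by
  unfold HL.ops HL.pair
  rw [List.flatMap_def, List.flatMap_def]
  congr 1
  refine List.map_congr_left fun k hk => ?_
  rw [(h k (List.mem_range.mp hk)).1, (h k (List.mem_range.mp hk)).2]

/-- Each process performs its operations one after the other. -/
theorem IsTrace.highLevel_filter (T : IsTrace g α) (p : Fin n) :
    ((g α.length).loc p = .idle ∧ (highLevel α).filter (fun a => decide (a.1.1 = p)) =
        HL.ops (g α.length).op (g α.length).ret p ((g α.length).count p)) ∨
    ((g α.length).loc p ≠ .idle ∧ ∃ c, (g α.length).count p = c + 1 ∧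
      (highLevel α).filter (fun a => decide (a.1.1 = p)) =
        HL.ops (g α.length).op (g α.length).ret p c ++
          [((p, c + 1), .inv ((g α.length).op (p, c + 1)))]) := by
  induction T with
  | nil h => left; simp [h, GState.initial, highLevel, HL.ops]
  | @snoc α a T hs ih =>
    simp only [List.length_append, List.length_singleton]
    generalize g α.length = s at hs ih
    generalize g (α.length + 1) = s' at hs
    rw [highLevel_append, List.filter_append]
    cases hs with
    | invoke q o hq =>
      by_cases hqp : q = p
      · subst hqp
        right
        rcases ih with ⟨-, ih⟩ | ⟨ih, -⟩
        · refine ⟨?_, s.count q, by simp [GState.afterInvoke], ?_⟩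
          · cases o <;> simp [GState.afterInvoke, start, traversal]
          · rw [ih]
            congr 1
            · refine (ops_congr fun k hk => ⟨Function.update_of_ne ?_ _ _, rfl⟩).symm
              intro h
              simp only [Prod.mk.injEq, true_and] at h
              omega
            · simp [highLevel, Event.toHL, GState.afterInvoke]
        · exact absurd hq ih
      · have h1 : (highLevel [((q, s.count q + 1), Event.inv o)]).filter
            (fun a => decide (a.1.1 = p)) = [] := by simp [highLevel, Event.toHL, hqp]
        have h2 : ∀ k, (s.afterInvoke α.length q o).op (p, k) = s.op (p, k) := fun k =>
          Function.update_of_ne (fun h => hqp (congrArg Prod.fst h).symm) _ _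
        have h3 : (s.afterInvoke α.length q o).loc p = s.loc p :=
          Function.update_of_ne (Ne.symm hqp) _ _
        have h4 : (s.afterInvoke α.length q o).count p = s.count p :=
          Function.update_of_ne (Ne.symm hqp) _ _
        have h5 : ∀ c, HL.ops (s.afterInvoke α.length q o).op (s.afterInvoke α.length q o).ret p c =
            HL.ops s.op s.ret p c := fun c => ops_congr fun k _ => ⟨h2 _, rfl⟩
        simp only [h1, h2, h3, h4, h5, List.append_nil]
        exact ih
    | step q e l m hl =>
      have h2 : (s.afterStep α.length q e l m).op = s.op := rfl
      have h4 : (s.afterStep α.length q e l m).count = s.count := rfl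
      by_cases hqp : q = p
      · subst hqp
        have h3 : (s.afterStep α.length q e l m).loc q = l := Function.update_self _ _ _
        rcases ih with ⟨ih, -⟩ | ⟨-, c, hc, ih⟩
        · exact absurd hl (ih ▸ not_step_idle)
        · have h5 : HL.ops s.op (s.afterStep α.length q e l m).ret q c =
              HL.ops s.op s.ret q c := by
            refine ops_congr fun k hk => ⟨rfl, Function.update_of_ne ?_ _ _⟩
            intro h
            simp only [GState.cur, Prod.mk.injEq, true_and] at h
            omega
          rw [h2, h3, h4]
          rcases step_idle_iff hl with ⟨b, -, rfl, rfl⟩ | ⟨-, h6, h7, h8⟩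
          · left
            refine ⟨rfl, ?_⟩
            rw [hc, HL.ops_succ, h5, ih, List.append_assoc]
            simp [highLevel, Event.toHL, HL.pair, GState.afterStep, retAfter, GState.cur, hc]
          · right
            refine ⟨h8, c, hc, ?_⟩
            rw [h5, ih]
            have : highLevel [(s.cur q, e)] = [] := by
              cases e <;> first | rfl | exact absurd rfl (h6 _) | exact absurd rfl (h7 _)
            rw [this]; simp
      · have h1 : (highLevel [(s.cur q, e)]).filter (fun a => decide (a.1.1 = p)) = [] := by
          cases e <;> simp [highLevel, Event.toHL, hqp]
        have h3 : (s.afterStep α.length q e l m).loc p = s.loc p :=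
          Function.update_of_ne (Ne.symm hqp) _ _
        have h5 : ∀ c, HL.ops s.op (s.afterStep α.length q e l m).ret p c =
            HL.ops s.op s.ret p c := fun c => ops_congr fun k _ =>
          ⟨rfl, Function.update_of_ne (fun h => hqp (congrArg Prod.fst h).symm) _ _⟩
        rw [h1, h2, h3, h4, List.append_nil]
        simp only [h5]
        exact ih

/-- A completed operation has a response time. -/
theorem IsTrace.fin_ne_none (T : IsTrace g α) {p : Fin n} {c k : ℕ} (hk : k < c)
    (h : HL.ops (g α.length).op (g α.length).ret p c <+:
      (highLevel α).filter (fun a => decide (a.1.1 = p))) :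
    (g α.length).fin (p, k + 1) ≠ none := by
  have h1 := (List.mem_filter.mp (h.subset (HL.resp_mem_ops _ _ p hk))).1
  simp only [highLevel, List.mem_filterMap, Option.map_eq_some_iff] at h1
  obtain ⟨⟨π, e⟩, h2, e', h3, h4⟩ := h1
  simp only [Prod.mk.injEq] at h4
  obtain ⟨rfl, rfl⟩ := h4
  obtain ⟨j, hj⟩ := List.mem_iff_getElem?.mp h2
  cases e <;> simp only [Event.toHL, Option.some.injEq, reduceCtorEq] at h3
  rw [T.events.2.2 j _ _ hj]
  simp

open Classical in
/-- The executions of the Versioned List are linearizable. -/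
theorem IsTrace.linearizable (T : IsTrace g α) : HL.Linearizable (highLevel α) := by
  set s := g α.length with hs
  have I := T.hinv α.length le_rfl
  -- the number of completed operations, and the number of linearized operations
  set d : Fin n → ℕ := fun p => if s.loc p = .idle then s.count p else s.count p - 1 with hd
  set D : Fin n → ℕ := fun p =>
    if s.loc p = .idle ∨ s.eff (s.cur p) ≠ none then s.count p else s.count p - 1 with hD
  have shape : ∀ p, (D p = d p ∧ (highLevel α).filter (fun a => decide (a.1.1 = p)) =
        HL.ops s.op s.ret p (d p)) ∨
      (D p = d p ∧ (highLevel α).filter (fun a => decide (a.1.1 = p)) =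
        HL.ops s.op s.ret p (d p) ++ [((p, d p + 1), .inv (s.op (p, d p + 1)))]) ∨
      ((D p = d p + 1 ∧ (highLevel α).filter (fun a => decide (a.1.1 = p)) =
        HL.ops s.op s.ret p (d p) ++ [((p, d p + 1), .inv (s.op (p, d p + 1)))]) ∧
          s.eff (p, d p + 1) ≠ none) := by
    intro p
    rcases T.highLevel_filter p with ⟨h1, h2⟩ | ⟨h1, c, h2, h3⟩
    · left
      have hdp : d p = s.count p := if_pos h1
      rw [hdp]
      exact ⟨if_pos (Or.inl h1), h2⟩
    · right
      rw [← hs] at h1 h2 h3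
      have hdp : d p = c := by simp [hd, h1, h2]
      rw [hdp]
      by_cases he : s.eff (s.cur p) = none
      · left; exact ⟨by simp [hD, h1, h2, he], h3⟩
      · right; exact ⟨⟨by simp [hD, h2, he], h3⟩, by rwa [GState.cur, h2] at he⟩
  have pre : ∀ p, HL.ops s.op s.ret p (d p) <+:
      (highLevel α).filter (fun a => decide (a.1.1 = p)) := by
    intro p
    rcases shape p with ⟨-, h⟩ | ⟨-, h⟩ | ⟨⟨-, h⟩, -⟩
    · rw [h]
    · rw [h]; exact List.prefix_append _ _
    · rw [h]; exact List.prefix_append _ _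
  have finished : ∀ p k, k < D p → s.eff (p, k + 1) = none →
      ∃ r, s.fin (p, k + 1) = some r := by
    intro p k hk he
    have hkd : k < d p := by
      rcases shape p with ⟨h1, -⟩ | ⟨h1, -⟩ | ⟨⟨h1, -⟩, h2⟩
      · omega
      · omega
      · rcases Nat.lt_or_eq_of_le (show k ≤ d p by omega) with h | rfl
        · exact h
        · exact absurd he h2
    exact Option.ne_none_iff_exists'.mp (T.fin_ne_none hkd (pre p))
  have eff_lt : ∀ (p : Fin n) k, s.eff (p, k) ≠ none → 1 ≤ k → k ≤ D p := by
    intro p k he hk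
    by_contra hlt
    rcases Nat.lt_or_ge (s.count p) k with h | h
    · exact he (I.fresh p k h).1
    · simp only [hD] at hlt
      split_ifs at hlt with h1
      · omega
      · push Not at h1
        have : k = s.count p := by omega
        subst this
        exact he h1.2
  -- the linearization point of an operation that has taken effect is the time after this event, at
  -- which `block` puts it first; for a pending operation without effect, the choice is arbitrary
  set read : ∀ π, s.eff π = none → ∀ r, s.fin π = some r →
      ReadOk g (s.since π) r (s.op π) (s.ret π) :=
    fun π he r hr => (I.fin_spec π r hr).2.2 he
  have points : ∀ π, ∃ t : ℕ, (∀ u, s.eff π = some u → t = u + 1) ∧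
      (s.eff π = none → ∀ r, s.fin π = some r → s.since π ≤ t ∧ t ≤ r ∧
        (s.ret π = true ↔ (s.op π).succeeds (setAt g t)) ∧
          (s.op π).next (setAt g t) = setAt g t) := by
    intro π
    cases he : s.eff π with
    | some u => exact ⟨u + 1, fun v hv => by simpa using hv, fun h => by simp at h⟩
    | none =>
      cases hf : s.fin π with
      | none => exact ⟨0, fun v hv => by simp at hv, fun _ r hr => by simp at hr⟩
      | some r =>
        obtain ⟨t, h1, h2, h3⟩ := read π he r hf
        refine ⟨t, fun v hv => by simp at hv, fun _ r' hr => ?_⟩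
        obtain rfl : r = r' := by simpa using hr
        exact ⟨h1, h2, h3⟩
  choose τ hτ1 hτ2 using points
  have eff_zero := (T.eff_zero α.length le_rfl).2
  refine HL.linearizable_of_points (op := s.op) (ret := s.ret) (D := D) (S := setAt g)
    (N := α.length) (τ := τ) (e := fun π => (s.eff π).isSome) (d := d) ?_
    (fun p => (shape p).imp_right (Or.imp_right And.left)) ?_
  · constructor
    · rw [setAt, T.zero]
      ext v
      simp only [Set.mem_empty_iff_false, iff_false]
      rintro ⟨x, -, -, hx⟩
      have hx' : (if x = Addr.head then ⊥ else ⊤) = intVal v := hx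
      split_ifs at hx'
      · exact absurd hx' (bot_lt_intVal v).ne
      · exact top_ne_intVal v hx'
    · intro p k hk
      cases he : s.eff (p, k + 1) with
      | some u => rw [hτ1 _ u he]; exact (I.eff_spec _ u he).1
      | none =>
        obtain ⟨r, hr⟩ := finished p k hk he
        exact (hτ2 _ he r hr).2.1.trans (I.fin_spec _ r hr).1.le
    · intro p k hk he
      obtain ⟨u, hu⟩ := Option.isSome_iff_exists.mp he
      obtain ⟨h1, h2, h3, h4, h5⟩ := I.eff_spec _ u hu
      exact ⟨h3, u, hτ1 _ u hu, h4, h5⟩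
    · intro p k hk he
      have he' : s.eff (p, k + 1) = none := by simpa using he
      obtain ⟨r, hr⟩ := finished p k hk he'
      exact (hτ2 _ he' r hr).2.2
    · intro p k q l _ _ h1 h2 h3
      obtain ⟨u, hu⟩ := Option.isSome_iff_exists.mp h1
      obtain ⟨v, hv⟩ := Option.isSome_iff_exists.mp h2
      rw [hτ1 _ u hu, hτ1 _ v hv, Nat.add_right_cancel_iff] at h3
      exact I.eff_inj _ _ u hu (h3 ▸ hv)
    · intro u hu
      refine (I.eff_cover u hu).imp_left ?_
      rintro ⟨⟨p, k⟩, h⟩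
      have hne : s.eff (p, k) ≠ none := by rw [h]; simp
      obtain ⟨k, rfl⟩ : ∃ l, k = l + 1 := by
        cases k with
        | zero => exact absurd (eff_zero p) hne
        | succ l => exact ⟨l, rfl⟩
      exact ⟨p, k, eff_lt p (k + 1) hne (by omega), by rw [h]; rfl, hτ1 _ u h⟩
  · intro p k q l b o hk hl hsub
    -- the response occurs before the invocation
    obtain ⟨i, j, hij, hi, hj⟩ : ∃ i j : ℕ, i < j ∧ α[i]? = some ((p, k + 1), Event.resp b) ∧
        α[j]? = some ((q, l + 1), Event.inv o) := by
      obtain ⟨i, j, x, y, h1, h2, h3, h4, h5⟩ := exists_getElem?_of_sublist_filterMap hsub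
      simp only [Option.map_eq_some_iff, Prod.mk.injEq] at h4 h5
      obtain ⟨e, h6, h7, rfl⟩ := h4
      obtain ⟨e', h8, h9, rfl⟩ := h5
      refine ⟨i, j, h1, ?_, ?_⟩
      · obtain ⟨x1, x2⟩ := x
        cases x2 <;>
          simp only [Event.toHL, reduceCtorEq, Option.some.injEq, HLEvent.resp.injEq] at h6
        subst h6
        rw [h2, ← h7]
      · obtain ⟨x1, x2⟩ := y
        cases x2 <;>
          simp only [Event.toHL, reduceCtorEq, Option.some.injEq, HLEvent.inv.injEq] at h8
        subst h8
        rw [h3, ← h9]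
    have hfin := T.events.2.2 i _ _ hi
    have hsince := T.events.2.1 j _ _ hj
    rw [← hs] at hfin hsince
    have h1 : τ (p, k + 1) ≤ i := by
      cases he : s.eff (p, k + 1) with
      | some u => rw [hτ1 _ u he]; exact (I.fin_spec _ i hfin).2.1 u he
      | none => exact (hτ2 _ he i hfin).2.1
    have h2 : j < τ (q, l + 1) := by
      cases he : s.eff (q, l + 1) with
      | some u =>
        rw [hτ1 _ u he]
        have := (I.eff_spec _ u he).2.1
        rw [← hs] at this
        omega
      | none =>
        obtain ⟨r, hr⟩ := finished q l hl he
        have := (hτ2 _ he r hr).1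
        omega
    omega

end VL

/-! ### Executions of the sequential implementation -/

namespace LL

theorem IsHistory.of_append {S T : List (ℕ × Event)} (h : IsHistory (S ++ T)) : IsHistory S := by
  induction T using List.reverseRecOn with
  | nil => simpa using h
  | append_singleton T a ih =>
    refine ih ?_
    rw [← List.append_assoc] at h
    obtain ⟨l, m, k, h⟩ := h
    generalize hS : S ++ T ++ [a] = S' at h
    cases h with
    | initial => simp at hS
    | invoke o h =>
      obtain ⟨h1, -⟩ := List.append_inj' hS rfl
      exact h1 ▸ ⟨_, _, _, h⟩
    | step h hs =>
      obtain ⟨h1, -⟩ := List.append_inj' hS rfl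
      exact h1 ▸ ⟨_, _, _, h⟩

theorem schedule_append {I : Type} (H K : List (I × Event)) :
    schedule (H ++ K) = schedule H ++ schedule K := List.filterMap_append

/-- `S₀` consists of complete inserts other than the operation `k`. -/
def Inserts (S₀ : List (ℕ × Event)) (k : ℕ) : Prop :=
  ∀ a ∈ S₀, a.1 ≠ k ∧ (∃ b, (a.1, Event.resp b) ∈ S₀) ∧
    ∀ o, a.2 = Event.inv o → ∃ v, o = SetOp.insert v

/-- After a sequence of complete inserts, a single operation may have the events `E`. -/
def Realizable (E : List SEvent) : Prop :=
  ∃ S₀ T k, IsHistory (S₀ ++ T) ∧ Inserts S₀ k ∧ (∀ a ∈ T, a.1 = k) ∧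
    (schedule T).map Prod.snd = E

theorem Realizable.of_append {E F : List SEvent} (h : Realizable (E ++ F)) : Realizable E := by
  obtain ⟨S₀, T, k, h1, h2, h3, h4⟩ := h
  obtain ⟨σ₁, σ₂, h5, rfl, rfl⟩ := List.map_eq_append_iff.mp h4
  obtain ⟨T₁, T₂, rfl, rfl, rfl⟩ := List.filterMap_eq_append_iff.mp h5
  rw [← List.append_assoc] at h1
  exact ⟨S₀, T₁, k, h1.of_append, h2, fun a ha => h3 a (List.mem_append_left _ ha), rfl⟩

/-- After `S₀`, the operation `k` may have the events `E` and lead to the given state. -/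
def After (S₀ : List (ℕ × Event)) (k : ℕ) (E : List SEvent) (l : Loc) (m : Mem) : Prop :=
  ∃ T, Exec (S₀ ++ T) l m k ∧ (∀ a ∈ T, a.1 = k) ∧ (schedule T).map Prod.snd = E

theorem After.realizable {S₀ : List (ℕ × Event)} {k : ℕ} {E : List SEvent} {l : Loc} {m : Mem}
    (h : After S₀ k E l m) (hS : Inserts S₀ k) : Realizable E := by
  obtain ⟨T, h1, h2, h3⟩ := h
  exact ⟨S₀, T, k, ⟨_, _, _, h1⟩, hS, h2, h3⟩

theorem After.invoke {S₀ : List (ℕ × Event)} {k : ℕ} {m : Mem} (h : Exec S₀ .idle m k) (o : SetOp) :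
    After S₀ (k + 1) [.inv o] (.readNext o Addr.head) m :=
  ⟨[(k + 1, .inv o)], .invoke o h, by simp, rfl⟩

theorem After.step {S₀ : List (ℕ × Event)} {k : ℕ} {E : List SEvent} {l l' : Loc} {m m' : Mem}
    {e : Event} {s : SEvent} (h : After S₀ k E l m) (hs : LStep l m e l' m')
    (he : e.toSched = some s) : After S₀ k (E ++ [s]) l' m' := by
  obtain ⟨T, h1, h2, h3⟩ := h
  refine ⟨T ++ [(k, e)], ?_, ?_, ?_⟩
  · rw [← List.append_assoc]; exact .step h1 hs
  · intro a ha
    rcases List.mem_append.mp ha with ha | ha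
    · exact h2 a ha
    · rw [List.mem_singleton.mp ha]
  · rw [schedule_append, List.map_append, h3]
    simp [schedule, he]

/-- From `x` on, the list consists of the given nodes, with the given values, and `tail`. -/
def Linked (m : Mem) : Addr → List (Addr × ℤ) → Prop
  | x, [] => m.next x = Addr.tail
  | x, z :: zs => m.next x = z.1 ∧ m.val z.1 = intVal z.2 ∧ Linked m z.1 zs

theorem Linked.congr {m m' : Mem} {x x' : Addr} {zs : List (Addr × ℤ)} (h : Linked m x zs)
    (hx : m'.next x' = m.next x)
    (hz : ∀ z ∈ zs, m'.next z.1 = m.next z.1 ∧ m'.val z.1 = m.val z.1) : Linked m' x' zs := by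
  induction zs generalizing x x' with
  | nil => exact hx.trans h
  | cons z zs ih =>
    obtain ⟨h1, h2⟩ := hz z List.mem_cons_self
    exact ⟨hx.trans h.1, h2.trans h.2.1,
      ih h.2.2 h1 fun w hw => hz w (List.mem_cons_of_mem _ hw)⟩

/-- The nodes of a list can be inserted in reverse order. -/
theorem exists_inserts (zs : List (Addr × ℤ)) (hs : zs.Pairwise fun a b => a.2 < b.2)
    (hn : (zs.map Prod.fst).Nodup) (hh : ∀ z ∈ zs, z.1 ≠ Addr.head ∧ z.1 ≠ Addr.tail) :
    ∃ S₀ m k, Exec S₀ .idle m k ∧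
      (∀ a ∈ S₀, a.1 ≤ k ∧ (∃ b, (a.1, Event.resp b) ∈ S₀) ∧
        ∀ o, a.2 = Event.inv o → ∃ v, o = SetOp.insert v) ∧
      Linked m Addr.head zs ∧ m.val Addr.tail = ⊤ ∧
      ∀ x, x ∈ m.alloc → x = Addr.head ∨ x = Addr.tail ∨ x ∈ zs.map Prod.fst := by
  induction zs with
  | nil =>
    refine ⟨[], Mem.initial, 0, .initial, by simp, rfl, rfl, ?_⟩
    rintro x (rfl | rfl)
    · exact Or.inl rfl
    · exact Or.inr (Or.inl rfl)
  | cons z zs ih =>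
    rw [List.pairwise_cons] at hs
    rw [List.map_cons, List.nodup_cons] at hn
    obtain ⟨hzh, hzt⟩ := hh z List.mem_cons_self
    obtain ⟨S₀, m, k, h1, h2, h3, h4, h5⟩ := ih hs.2 hn.2 fun w hw =>
      hh w (List.mem_cons_of_mem _ hw)
    have hz : z.1 ∉ m.alloc := fun h => by
      rcases h5 _ h with h | h | h
      · exact hzh h
      · exact hzt h
      · exact hn.1 h
    have hlt : intVal z.2 < m.val (m.next Addr.head) := by
      cases zs with
      | nil =>
        rw [show m.next Addr.head = Addr.tail from h3, h4]
        exact WithBot.coe_lt_coe.mpr (WithTop.coe_lt_top _)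
      | cons w ws => rw [h3.1, h3.2.1]; exact VL.intVal_lt.mpr (hs.1 w List.mem_cons_self)
    have e1 := Exec.invoke (.insert z.2) h1
    have e2 := Exec.step e1 (.readNext _ _ _)
    have e3 := Exec.step e2 (.readVal_ge _ _ _ _ hlt.not_gt)
    have hne : decide (m.val (m.next Addr.head) = intVal (arg (.insert z.2))) = false :=
      decide_eq_false hlt.ne'
    rw [hne] at e3
    have e4 := Exec.step e3 (.create _ _ _ _ z.1 hz)
    have e5 := Exec.step e4 (.write _ _ _)
    have e6 := Exec.step e5 (.ret _ _)
    simp only [List.append_assoc, List.cons_append, List.nil_append] at e6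
    refine ⟨_, _, _, e6, ?_, ⟨?_, ?_, ?_⟩, ?_, ?_⟩
    · intro a ha
      rcases List.mem_append.mp ha with ha | ha
      · obtain ⟨k1, ⟨b, k2⟩, k3⟩ := h2 a ha
        exact ⟨by omega, ⟨b, List.mem_append_left _ k2⟩, k3⟩
      · have hk : a.1 = k + 1 := by
          simp only [List.mem_cons, List.not_mem_nil, or_false] at ha
          rcases ha with rfl | rfl | rfl | rfl | rfl | rfl <;> rfl
        refine ⟨hk.le, ⟨true, by rw [hk]; simp⟩, fun o ho => ?_⟩
        simp only [List.mem_cons, List.not_mem_nil, or_false] at ha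
        rcases ha with rfl | rfl | rfl | rfl | rfl | rfl <;> simp only [reduceCtorEq] at ho
        simp only [Event.inv.injEq] at ho
        exact ⟨_, ho.symm⟩
    · simp
    · simp
    · refine h3.congr (by simp [hzh]) fun w hw => ?_
      have k1 : w.1 ≠ Addr.head := (hh w (List.mem_cons_of_mem _ hw)).1
      have k2 : w.1 ≠ z.1 := fun h => hn.1 (h ▸ List.mem_map_of_mem hw)
      simp [k1, k2]
    · simp [hzt.symm, h4]
    · rintro x (rfl | hx)
      · simp
      · rcases h5 x hx with h | h | h
        · exact Or.inl h
        · exact Or.inr (Or.inl h)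
        · exact Or.inr (Or.inr (List.mem_cons_of_mem _ h))

/-- The events of a traversal from `x` along the given nodes. -/
def pathEvents : Addr → List Addr → List SEvent
  | _, [] => []
  | x, y :: ys => .readNext x :: .readVal y :: pathEvents y ys

/-- The end of the path from `x` along the given nodes. -/
def pathEnd : Addr → List Addr → Addr
  | x, [] => x
  | _, y :: ys => pathEnd y ys

theorem pathEvents_concat (x : Addr) (ys : List Addr) (y : Addr) :
    pathEvents x (ys ++ [y]) =
      pathEvents x ys ++ [.readNext (pathEnd x ys), .readVal y] := by
  induction ys generalizing x with
  | nil => rfl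
  | cons z ys ih => simp [pathEvents, pathEnd, ih]

theorem pathEnd_concat (x : Addr) (ys : List Addr) (y : Addr) : pathEnd x (ys ++ [y]) = y := by
  induction ys generalizing x with
  | nil => rfl
  | cons z ys ih => exact ih z

theorem After.walk {S₀ : List (ℕ × Event)} {k : ℕ} {E : List SEvent} {m : Mem} {o : SetOp}
    {x : Addr} {zs rest : List (Addr × ℤ)} (h : After S₀ k E (.readNext o x) m)
    (hl : Linked m x (zs ++ rest)) (hv : ∀ z ∈ zs, z.2 < arg o) :
    After S₀ k (E ++ pathEvents x (zs.map Prod.fst))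
      (.readNext o (pathEnd x (zs.map Prod.fst))) m ∧
      Linked m (pathEnd x (zs.map Prod.fst)) rest := by
  induction zs generalizing x E with
  | nil => exact ⟨by simpa [pathEvents, pathEnd] using h, hl⟩
  | cons z zs ih =>
    obtain ⟨h1, h2, h3⟩ := hl
    have e1 := h.step (.readNext _ _ _) rfl
    rw [h1] at e1
    have hlt : m.val z.1 < intVal (arg o) := by
      rw [h2]; exact VL.intVal_lt.mpr (hv z List.mem_cons_self)
    have e2 := e1.step (.readVal_lt _ _ _ _ hlt) rfl
    have := ih e2 h3 fun w hw => hv w (List.mem_cons_of_mem _ hw)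
    simpa [pathEvents, pathEnd] using this

/-- Nodes can be given values in increasing order, below any bound. -/
theorem exists_values (ys : List Addr) (v : ℤ) : ∃ zs : List (Addr × ℤ), zs.map Prod.fst = ys ∧
    zs.Pairwise (fun a b => a.2 < b.2) ∧ ∀ z ∈ zs, z.2 < v := by
  induction ys using List.reverseRecOn generalizing v with
  | nil => exact ⟨[], rfl, .nil, by simp⟩
  | append_singleton ys y ih =>
    obtain ⟨zs, h1, h2, h3⟩ := ih (v - 1)
    refine ⟨zs ++ [(y, v - 1)], by simp [h1], ?_, fun z hz => ?_⟩
    · rw [List.pairwise_append]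
      refine ⟨h2, List.pairwise_singleton _ _, fun a ha b hb => ?_⟩
      rw [List.mem_singleton.mp hb]
      exact h3 a ha
    · rcases List.mem_append.mp hz with hz | hz
      · have := h3 z hz; omega
      · rw [List.mem_singleton.mp hz]; simp

/-- An operation of the sequential implementation can traverse any distinct nodes `ys`; the nodes
that follow in the list can be chosen. -/
theorem exists_after_path (o : SetOp) (ys : List Addr) (rest : List (Addr × ℤ))
    (hn : (ys ++ rest.map Prod.fst).Nodup)
    (hh : ∀ y ∈ ys ++ rest.map Prod.fst, y ≠ Addr.head ∧ y ≠ Addr.tail)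
    (hs : rest.Pairwise fun a b => a.2 < b.2) (hr : ∀ z ∈ rest, arg o ≤ z.2) :
    ∃ S₀ m k, Inserts S₀ k ∧
      After S₀ k (.inv o :: pathEvents Addr.head ys ++ [.readNext (pathEnd Addr.head ys)])
        (.readVal o (pathEnd Addr.head ys) (m.next (pathEnd Addr.head ys))) m ∧
      Linked m (pathEnd Addr.head ys) rest ∧ m.val Addr.tail = ⊤ ∧
      ∀ x, x ∈ m.alloc → x = Addr.head ∨ x = Addr.tail ∨ x ∈ ys ++ rest.map Prod.fst := by
  obtain ⟨zs, rfl, h2, h3⟩ := exists_values ys (arg o)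
  rw [← List.map_append] at hn hh ⊢
  obtain ⟨S₀, m, k, k1, k2, k3, k4, k5⟩ := exists_inserts (zs ++ rest)
    (List.pairwise_append.mpr ⟨h2, hs, fun a ha b hb => (h3 a ha).trans_le (hr b hb)⟩) hn
    fun z hz => hh z.1 (List.mem_map_of_mem hz)
  obtain ⟨e1, e2⟩ := (After.invoke k1 o).walk k3 h3
  refine ⟨S₀, m, k + 1, fun a ha => ?_, e1.step (.readNext _ _ _) rfl, e2, k4, k5⟩
  obtain ⟨h4, h5, h6⟩ := k2 a ha
  exact ⟨by omega, h5, h6⟩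

section Realizable

variable {o : SetOp} {ys : List Addr} {curr : Addr}

theorem arg_lt_top (o : SetOp) : ¬ (⊤ : NodeVal) < intVal (arg o) := not_top_lt

/-- The local state after the end of the loop can be any of those that the sequential
implementation provides, if the value of `curr` is chosen suitably. -/
theorem exists_afterLoop (found : Bool) (rest : List (Addr × ℤ))
    (hn : (ys ++ curr :: rest.map Prod.fst).Nodup)
    (hh : ∀ y ∈ ys ++ curr :: rest.map Prod.fst, y ≠ Addr.head)
    (ht : ∀ y ∈ ys ++ rest.map Prod.fst, y ≠ Addr.tail)
    (hc : curr = Addr.tail → found = false ∧ rest = [])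
    (hs : rest.Pairwise fun a b => a.2 < b.2) (hr : ∀ z ∈ rest, arg o + 1 < z.2) :
    ∃ S₀ m k, Inserts S₀ k ∧
      After S₀ k (.inv o :: pathEvents Addr.head ys ++
          [.readNext (pathEnd Addr.head ys), .readVal curr])
        (afterLoop o (pathEnd Addr.head ys) curr found) m ∧
      (curr ≠ Addr.tail → Linked m curr rest) ∧
      ∀ x, x ∈ m.alloc → x = Addr.head ∨ x = Addr.tail ∨ x ∈ ys ++ curr :: rest.map Prod.fst := by
  by_cases hct : curr = Addr.tail
  · obtain ⟨rfl, rfl⟩ := hc hct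
    subst hct
    obtain ⟨S₀, m, k, k1, k2, k3, k4, k5⟩ := exists_after_path o ys []
      (by simpa using hn.of_append_left)
      (fun y hy => ⟨hh y (List.mem_append_left _ (by simpa using hy)), ht y hy⟩) .nil (by simp)
    have h1 : m.next (pathEnd Addr.head ys) = Addr.tail := k3
    rw [h1] at k2
    have e := k2.step (.readVal_ge _ _ _ _ (by rw [k4]; exact arg_lt_top o)) rfl
    rw [decide_eq_false (by rw [k4]; exact VL.top_ne_intVal _)] at e
    refine ⟨S₀, m, k, k1, by simpa using e, fun h => absurd rfl h, fun x hx => ?_⟩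
    rcases k5 x hx with h | h | h
    · exact Or.inl h
    · exact Or.inr (Or.inl h)
    · exact Or.inr (Or.inr (List.mem_append_left _ (by simpa using h)))
  · obtain ⟨w, hw1, hw2⟩ : ∃ w : ℤ, arg o ≤ w ∧ w ≤ arg o + 1 ∧ (found = true ↔ w = arg o) := by
      cases found
      · exact ⟨arg o + 1, by omega, le_rfl, by simp⟩
      · exact ⟨arg o, le_rfl, by omega, by simp⟩
    obtain ⟨S₀, m, k, k1, k2, k3, k4, k5⟩ := exists_after_path o ys ((curr, w) :: rest)
      (by simpa using hn) (fun y hy => by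
        refine ⟨hh y (by simpa using hy), ?_⟩
        simp only [List.map_cons, List.mem_append, List.mem_cons] at hy ht
        rcases hy with hy | rfl | hy
        · exact ht y (Or.inl hy)
        · exact hct
        · exact ht y (Or.inr hy))
      (List.pairwise_cons.mpr ⟨fun z hz => hw2.1.trans_lt (hr z hz), hs⟩) (fun z hz => by
        rcases List.mem_cons.mp hz with rfl | hz
        · exact hw1
        · have := hr z hz; omega)
    obtain ⟨h1, h2, h3⟩ := k3
    rw [h1] at k2
    have e := k2.step (.readVal_ge _ _ _ _ (by rw [h2, VL.intVal_lt]; exact not_lt.mpr hw1)) rfl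
    have hf : decide (m.val curr = intVal (arg o)) = found := by
      rw [h2]
      rw [Bool.eq_iff_iff, decide_eq_true_eq, VL.intVal_inj]
      exact hw2.2.symm
    rw [hf] at e
    exact ⟨S₀, m, k, k1, by simpa using e, fun _ => h3, by simpa using k5⟩

theorem realizable_test (hn : (ys ++ [curr]).Nodup)
    (hh : ∀ y ∈ ys ++ [curr], y ≠ Addr.head) (ht : ∀ y ∈ ys, y ≠ Addr.tail) :
    Realizable (.inv o :: pathEvents Addr.head ys ++
      [.readNext (pathEnd Addr.head ys), .readVal curr]) := by
  obtain ⟨S₀, m, k, h1, h2, -⟩ := exists_afterLoop (o := o) (curr := curr) false []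
    hn hh (by simpa using ht) (fun _ => ⟨rfl, rfl⟩) .nil (by simp)
  exact h2.realizable h1

/-- The operation returns without a write. An insert does so only if it finds its value, which is
impossible at `tail`. -/
theorem realizable_read (hn : (ys ++ [curr]).Nodup) (hh : ∀ y ∈ ys ++ [curr], y ≠ Addr.head)
    (ht : ∀ y ∈ ys, y ≠ Addr.tail) (hi : ∀ v, o = .insert v → curr ≠ Addr.tail) :
    Realizable (.inv o :: pathEvents Addr.head ys ++
      [.readNext (pathEnd Addr.head ys), .readVal curr, .resp]) := by
  cases o with
  | insert v =>
    obtain ⟨S₀, m, k, h1, h2, -⟩ := exists_afterLoop (o := .insert v) (curr := curr) true []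
      hn hh (by simpa using ht) (fun h => absurd h (hi v rfl)) .nil (by simp)
    have := (h2.step (.ret _ _) rfl).realizable h1
    simpa using this
  | remove v =>
    obtain ⟨S₀, m, k, h1, h2, -⟩ := exists_afterLoop (o := .remove v) (curr := curr) false []
      hn hh (by simpa using ht) (fun _ => ⟨rfl, rfl⟩) .nil (by simp)
    have := (h2.step (.ret _ _) rfl).realizable h1
    simpa using this
  | contains v =>
    obtain ⟨S₀, m, k, h1, h2, -⟩ := exists_afterLoop (o := .contains v) (curr := curr) false []
      hn hh (by simpa using ht) (fun _ => ⟨rfl, rfl⟩) .nil (by simp)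
    have := (h2.step (.ret _ _) rfl).realizable h1
    simpa using this

theorem realizable_insert {v : ℤ} {x : Addr} (hn : (ys ++ [curr]).Nodup)
    (hh : ∀ y ∈ ys ++ [curr], y ≠ Addr.head) (ht : ∀ y ∈ ys, y ≠ Addr.tail)
    (hx : x ∉ ys ++ [curr]) (hxh : x ≠ Addr.head) (hxt : x ≠ Addr.tail) :
    Realizable (.inv (.insert v) :: pathEvents Addr.head ys ++
      [.readNext (pathEnd Addr.head ys), .readVal curr, .create x v curr,
        .writeNext (pathEnd Addr.head ys) x, .resp]) := by
  obtain ⟨S₀, m, k, h1, h2, -, h4⟩ := exists_afterLoop (o := .insert v) (curr := curr) false []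
    hn hh (by simpa using ht) (fun _ => ⟨rfl, rfl⟩) .nil (by simp)
  have hfree : x ∉ m.alloc := fun h => by
    rcases h4 x h with h | h | h
    · exact hxh h
    · exact hxt h
    · exact hx h
  have e1 := h2.step (.create _ _ _ _ x hfree) rfl
  have e2 := e1.step (.write _ _ _) rfl
  have := (e2.step (.ret _ _) rfl).realizable h1
  simpa using this

theorem realizable_remove {v : ℤ} {y : Addr} (hn : (ys ++ [curr, y]).Nodup)
    (hh : ∀ z ∈ ys ++ [curr, y], z ≠ Addr.head) (ht : ∀ z ∈ ys ++ [curr], z ≠ Addr.tail) :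
    Realizable (.inv (.remove v) :: pathEvents Addr.head ys ++
      [.readNext (pathEnd Addr.head ys), .readVal curr, .readNext curr,
        .writeNext (pathEnd Addr.head ys) y, .resp]) := by
  have hct : curr ≠ Addr.tail := ht curr (by simp)
  obtain ⟨S₀, m, k, h1, h2, h3⟩ : ∃ S₀ m k, Inserts S₀ k ∧
      After S₀ k (.inv (.remove v) :: pathEvents Addr.head ys ++
          [.readNext (pathEnd Addr.head ys), .readVal curr])
        (afterLoop (.remove v) (pathEnd Addr.head ys) curr true) m ∧ m.next curr = y := by
    by_cases hyt : y = Addr.tail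
    · subst hyt
      obtain ⟨S₀, m, k, h1, h2, h3, -⟩ := exists_afterLoop (o := .remove v) (curr := curr)
        (ys := ys) true [] (List.Nodup.sublist (by simp) hn)
        (fun z hz => hh z (by simp at hz ⊢; tauto)) (fun z hz => ht z (by simp at hz ⊢; tauto))
        (fun h => absurd h hct) .nil (by simp)
      exact ⟨S₀, m, k, h1, h2, h3 hct⟩
    · obtain ⟨S₀, m, k, h1, h2, h3, -⟩ := exists_afterLoop (o := .remove v) (curr := curr)
        (ys := ys) true [(y, v + 2)] hn hh (fun z hz => by
          simp only [List.map_cons, List.map_nil, List.mem_append, List.mem_singleton] at hz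
          rcases hz with hz | rfl
          · exact ht z (by simp [hz])
          · exact hyt)
        (fun h => absurd h hct) (List.pairwise_singleton _ _) (by simp [arg])
      exact ⟨S₀, m, k, h1, h2, (h3 hct).1⟩
  have e1 := h2.step (.readTnext _ _ _) rfl
  rw [h3] at e1
  have e2 := e1.step (.write _ _ _) rfl
  have := (e2.step (.ret _ _) rfl).realizable h1
  simpa using this

end Realizable

end LL

/-! ### Histories of single operations -/

/-- Whether the event is an invocation. -/
def SEvent.isInv : SEvent → Bool
  | .inv _ => true
  | _ => false

/-- How the next event `e` of an operation changes the events `E` of this operation in the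
schedule. -/
def eventsAfter (E : List SEvent) (e : Event) : List SEvent :=
  match e with
  | .readVal x _ =>
    if x = Addr.head then E.filter SEvent.isInv
    else E.takeWhile (fun s => decide (s ≠ .readVal x)) ++ [.readVal x]
  | .readNext x _ => E.takeWhile (fun s => decide (s ≠ .readNext x)) ++ [.readNext x]
  | e => E ++ e.toSched.toList

section OpEvents

variable {I : Type} [DecidableEq I]

theorem opEvents_schedule_append (H K : List (I × Event)) (π : I) :
    opEvents (schedule (H ++ K)) π = opEvents (schedule H) π ++ opEvents (schedule K) π := by
  simp [LL.schedule_append, opEvents]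

theorem opEvents_schedule_cons_self (π : I) (e : Event) (H : List (I × Event)) :
    opEvents (schedule ((π, e) :: H)) π = e.toSched.toList ++ opEvents (schedule H) π := by
  cases h : e.toSched <;> simp [schedule, opEvents, h]

theorem opEvents_schedule_cons_of_ne {π : I} {a : I × Event} (h : a.1 ≠ π)
    (H : List (I × Event)) : opEvents (schedule (a :: H)) π = opEvents (schedule H) π := by
  cases h' : a.2.toSched <;> simp [schedule, opEvents, h', h]

theorem opEvents_schedule_filter_self (H : List (I × Event)) (π : I) :
    opEvents (schedule (H.filter fun b => decide (b.1 ≠ π))) π = [] := by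
  induction H with
  | nil => rfl
  | cons a H ih =>
    by_cases h : a.1 = π
    · rw [List.filter_cons_of_neg (by simp [h])]; exact ih
    · rw [List.filter_cons_of_pos (by simp [h]), opEvents_schedule_cons_of_ne h]; exact ih

theorem opEvents_schedule_filter_of_ne {ρ : I} {P : I × Event → Bool}
    (hP : ∀ b, b.1 = ρ → P b = true)
    (H : List (I × Event)) : opEvents (schedule (H.filter P)) ρ = opEvents (schedule H) ρ := by
  induction H with
  | nil => rfl
  | cons a H ih =>
    by_cases hr : a.1 = ρ
    · obtain ⟨ρ', e⟩ := a
      obtain rfl : ρ' = ρ := hr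
      rw [List.filter_cons_of_pos (hP _ rfl), opEvents_schedule_cons_self,
        opEvents_schedule_cons_self, ih]
    · by_cases h : P a = true
      · rw [List.filter_cons_of_pos h, opEvents_schedule_cons_of_ne hr,
          opEvents_schedule_cons_of_ne hr, ih]
      · rw [List.filter_cons_of_neg h, opEvents_schedule_cons_of_ne hr, ih]

theorem Event.sameRead_iff {a e : Event} {s : SEvent} (he : e.toSched = some s)
    (hs : (∃ x w, e = .readVal x w) ∨ ∃ x y, e = .readNext x y) :
    a.sameRead e = true ↔ a.toSched = some s := by
  rcases hs with ⟨x, w, rfl⟩ | ⟨x, w, rfl⟩ <;> cases a <;>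
    simp [Event.sameRead, Event.toSched, ← he]

theorem opEvents_retract_self (H : List (I × Event)) (π : I) {e : Event} {s : SEvent}
    (he : e.toSched = some s) (hs : (∃ x w, e = .readVal x w) ∨ ∃ x y, e = .readNext x y) :
    opEvents (schedule (retract π e H)) π =
      (opEvents (schedule H) π).takeWhile fun s' => decide (s' ≠ s) := by
  induction H with
  | nil => rfl
  | cons a H ih =>
    obtain ⟨ρ, a⟩ := a
    by_cases hr : ρ = π
    · subst hr
      rw [opEvents_schedule_cons_self]
      by_cases h : a.toSched = some s
      · rw [retract, if_pos ⟨rfl, (Event.sameRead_iff he hs).mpr h⟩,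
          opEvents_schedule_filter_self, h]
        simp
      · rw [retract, if_neg (fun h' => h ((Event.sameRead_iff he hs).mp h'.2)),
          opEvents_schedule_cons_self, ih]
        cases h' : a.toSched with
        | none => simp
        | some t =>
          have : t ≠ s := fun h2 => h (h2 ▸ h')
          simp [this]
    · rw [retract, if_neg (fun h => hr h.1), opEvents_schedule_cons_of_ne hr,
        opEvents_schedule_cons_of_ne hr, ih]

theorem opEvents_retract_of_ne (H : List (I × Event)) {π ρ : I} (h : ρ ≠ π) (e : Event) :
    opEvents (schedule (retract π e H)) ρ = opEvents (schedule H) ρ := by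
  induction H with
  | nil => rfl
  | cons a H ih =>
    rw [retract]
    split_ifs with hc
    · have hr : a.1 ≠ ρ := fun h' => h (h'.symm.trans hc.1)
      rw [opEvents_schedule_cons_of_ne hr]
      exact opEvents_schedule_filter_of_ne (fun b hb => by simp [hb, h]) H
    · obtain ⟨a1, a2⟩ := a
      by_cases hr : a1 = ρ
      · subst hr
        rw [opEvents_schedule_cons_self, opEvents_schedule_cons_self, ih]
      · rw [opEvents_schedule_cons_of_ne hr, opEvents_schedule_cons_of_ne hr, ih]

theorem opEvents_filter_isInv (H : List (I × Event)) (π : I) :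
    opEvents (schedule (H.filter fun b => decide (b.1 ≠ π) || b.2.isInv)) π =
      (opEvents (schedule H) π).filter SEvent.isInv := by
  induction H with
  | nil => rfl
  | cons a H ih =>
    obtain ⟨ρ, a⟩ := a
    by_cases hr : ρ = π
    · subst hr
      rw [opEvents_schedule_cons_self]
      have ha : a.toSched.toList.filter SEvent.isInv =
          if a.isInv then a.toSched.toList else [] := by
        cases a <;> rfl
      rw [List.filter_append, ha, ← ih]
      by_cases h : a.isInv = true
      · rw [List.filter_cons_of_pos (by simp [h]), opEvents_schedule_cons_self, if_pos h]
      · rw [List.filter_cons_of_neg (by simp [h]), if_neg h, List.nil_append]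
    · rw [List.filter_cons_of_pos (by simp [hr]), opEvents_schedule_cons_of_ne hr,
        opEvents_schedule_cons_of_ne hr, ih]

/-- The events of an operation depend on the events of this operation only. -/
theorem opEvents_record_self (H : List (I × Event)) (π : I) (e : Event) :
    opEvents (schedule (record H (π, e))) π = eventsAfter (opEvents (schedule H) π) e := by
  have nil : opEvents (schedule ([] : List (I × Event))) π = [] := rfl
  have app : opEvents (schedule (H ++ [(π, e)])) π =
      opEvents (schedule H) π ++ e.toSched.toList := by
    rw [opEvents_schedule_append, opEvents_schedule_cons_self, nil, List.append_nil]
  cases e with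
  | readVal x w =>
    by_cases hx : x = Addr.head
    · simp only [record, eventsAfter, if_pos hx]
      exact opEvents_filter_isInv H π
    · simp only [record, eventsAfter, if_neg hx]
      rw [opEvents_schedule_append, opEvents_schedule_cons_self, nil,
        opEvents_retract_self H π rfl (Or.inl ⟨x, w, rfl⟩)]
      rfl
  | readNext x y =>
    simp only [record, eventsAfter]
    rw [opEvents_schedule_append, opEvents_schedule_cons_self, nil,
      opEvents_retract_self H π rfl (Or.inr ⟨x, y, rfl⟩)]
    rfl
  | inv o => exact app
  | resp b => exact app
  | writeNext x y => exact app
  | create x v y => exact app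
  | _ => exact (List.append_nil _).symm

theorem opEvents_record_of_ne (H : List (I × Event)) {π ρ : I} (h : ρ ≠ π) (e : Event) :
    opEvents (schedule (record H (π, e))) ρ = opEvents (schedule H) ρ := by
  have app : ∀ K : List (I × Event), opEvents (schedule (K ++ [(π, e)])) ρ =
      opEvents (schedule K) ρ := fun K => by
    rw [opEvents_schedule_append, opEvents_schedule_cons_of_ne (Ne.symm h)]
    exact List.append_nil _
  cases e with
  | readVal x w =>
    by_cases hx : x = Addr.head
    · simp only [record, if_pos hx]
      exact opEvents_schedule_filter_of_ne (fun b hb => by simp [hb, h]) H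
    · simp only [record, if_neg hx]
      rw [app, opEvents_retract_of_ne H h]
  | readNext x y =>
    simp only [record]
    rw [app, opEvents_retract_of_ne H h]
  | inv o => exact app H
  | resp b => exact app H
  | writeNext x y => exact app H
  | create x v y => exact app H
  | _ => rfl

/-! ### High-level histories of histories -/

/-- Neither an invocation nor a response. -/
def SEvent.IsLow : SEvent → Prop
  | .inv _ => False
  | .resp => False
  | _ => True

theorem toHL_eq_none {e : Event} (h : ∀ s ∈ e.toSched, s.IsLow) : e.toHL = none := by
  cases e <;> simp_all [Event.toSched, Event.toHL, SEvent.IsLow]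

omit [DecidableEq I] in
theorem highLevel_cons (a : I × Event) (H : List (I × Event)) :
    highLevel (a :: H) = highLevel [a] ++ highLevel H := VL.highLevel_append [a] H

omit [DecidableEq I] in
theorem highLevel_singleton {a : I × Event} (h : a.2.toHL = none) : highLevel [a] = [] := by
  simp [highLevel, h]

omit [DecidableEq I] in
theorem highLevel_filter_of_low {P : I × Event → Bool} {H : List (I × Event)}
    (h : ∀ b ∈ H, P b = false → b.2.toHL = none) : highLevel (H.filter P) = highLevel H := by
  induction H with
  | nil => rfl
  | cons a H ih =>
    rw [List.forall_mem_cons] at h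
    by_cases hP : P a = true
    · rw [List.filter_cons_of_pos hP, highLevel_cons, highLevel_cons a H, ih h.2]
    · rw [List.filter_cons_of_neg hP, highLevel_cons a H, ih h.2,
        highLevel_singleton (h.1 (by simpa using hP)), List.nil_append]

theorem mem_opEvents {H : List (I × Event)} {π : I} {e : Event} (h : (π, e) ∈ H) {s : SEvent}
    (hs : e.toSched = some s) : s ∈ opEvents (schedule H) π := by
  simp only [opEvents, schedule, List.mem_map, List.mem_filter, List.mem_filterMap]
  exact ⟨(π, s), ⟨⟨(π, e), h, by simp [hs]⟩, by simp⟩, rfl⟩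

/-- The first event of an operation, its invocation, is not dropped. -/
theorem highLevel_retract {H : List (I × Event)} {π : I} {e : Event}
    (h : ∀ s ∈ (opEvents (schedule H) π).tail, s.IsLow) :
    highLevel (retract π e H) = highLevel H := by
  induction H with
  | nil => rfl
  | cons a H ih =>
    obtain ⟨ρ, a⟩ := a
    rw [retract]
    split_ifs with hc
    · obtain ⟨rfl, hc⟩ := hc
      have ha : a.toHL = none := by cases a <;> simp_all [Event.sameRead, Event.toHL]
      obtain ⟨t, ht⟩ : ∃ t, a.toSched = some t := by
        cases a <;> simp_all [Event.sameRead, Event.toSched]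
      rw [opEvents_schedule_cons_self, ht] at h
      rw [highLevel_cons, highLevel_singleton ha, List.nil_append]
      refine highLevel_filter_of_low fun b hb hP => toHL_eq_none fun s hs => h s ?_
      obtain ⟨b1, b2⟩ := b
      obtain rfl : b1 = ρ := by simpa using hP
      exact mem_opEvents hb hs
    · rw [highLevel_cons, highLevel_cons (ρ, a) H, ih]
      intro s hs
      by_cases hr : ρ = π
      · subst hr
        rw [opEvents_schedule_cons_self] at h
        cases ht : a.toSched with
        | none => rw [ht] at h; exact h s hs
        | some t => rw [ht] at h; exact h s (List.mem_of_mem_tail hs)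
      · rw [opEvents_schedule_cons_of_ne hr] at h; exact h s hs

/-- The events of an incomplete operation `o`. -/
def Pending (o : SetOp) (E : List SEvent) : Prop := ∃ E', E = .inv o :: E' ∧ ∀ s ∈ E', s.IsLow

theorem Pending.step {o : SetOp} {E : List SEvent} (h : Pending o E) {e : Event}
    (he : e.toHL = none) : Pending o (eventsAfter E e) := by
  obtain ⟨E', rfl, h⟩ := h
  cases e with
  | inv o => simp [Event.toHL] at he
  | resp b => simp [Event.toHL] at he
  | readVal x w =>
    by_cases hx : x = Addr.head
    · refine ⟨E'.filter SEvent.isInv, by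
        rw [eventsAfter, if_pos hx, List.filter_cons_of_pos rfl], fun s hs => ?_⟩
      exact h s (List.mem_filter.mp hs).1
    · refine ⟨E'.takeWhile (fun s => decide (s ≠ .readVal x)) ++ [.readVal x],
        by simp [eventsAfter, hx], fun s hs => ?_⟩
      rcases List.mem_append.mp hs with hs | hs
      · exact h s (List.takeWhile_subset _ hs)
      · rw [List.mem_singleton.mp hs]; trivial
  | readNext x y =>
    refine ⟨E'.takeWhile (fun s => decide (s ≠ .readNext x)) ++ [.readNext x],
      by simp [eventsAfter], fun s hs => ?_⟩
    rcases List.mem_append.mp hs with hs | hs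
    · exact h s (List.takeWhile_subset _ hs)
    · rw [List.mem_singleton.mp hs]; trivial
  | writeNext x y =>
    refine ⟨E' ++ [.writeNext x y], rfl, fun s hs => ?_⟩
    rcases List.mem_append.mp hs with hs | hs
    · exact h s hs
    · rw [List.mem_singleton.mp hs]; trivial
  | create x v y =>
    refine ⟨E' ++ [.create x v y], rfl, fun s hs => ?_⟩
    rcases List.mem_append.mp hs with hs | hs
    · exact h s hs
    · rw [List.mem_singleton.mp hs]; trivial
  | _ => exact ⟨E', List.append_nil _, h⟩

theorem Pending.filter_isInv {o : SetOp} {E : List SEvent} (h : Pending o E) :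
    E.filter SEvent.isInv = [.inv o] := by
  obtain ⟨E', rfl, h⟩ := h
  rw [List.filter_cons_of_pos rfl, List.filter_eq_nil_iff.mpr]
  intro s hs
  have := h s hs
  cases s <;> simp_all [SEvent.IsLow, SEvent.isInv]

/-- The events that are dropped from the history of an incomplete operation are neither
invocations nor responses. -/
theorem highLevel_record {H : List (I × Event)} {π : I} {e : Event}
    (h : e.toHL = none → ∃ o, Pending o (opEvents (schedule H) π)) :
    highLevel (record H (π, e)) = highLevel H ++ highLevel [(π, e)] := by
  have low : e.toHL = none → ∀ s ∈ (opEvents (schedule H) π).tail, s.IsLow := fun he => by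
    obtain ⟨o, E', hE, hl⟩ := h he
    rw [hE]; exact hl
  cases e with
  | readVal x w =>
    by_cases hx : x = Addr.head
    · simp only [record, if_pos hx]
      rw [highLevel_singleton rfl, List.append_nil]
      refine highLevel_filter_of_low fun b hb hP => toHL_eq_none fun s hs => ?_
      obtain ⟨b1, b2⟩ := b
      simp only [ne_eq, decide_not, Bool.or_eq_false_iff, Bool.not_eq_eq_eq_not, Bool.not_false,
        decide_eq_true_eq] at hP
      obtain ⟨rfl, hP⟩ := hP
      obtain ⟨o, E', hE, hl⟩ := h rfl
      have hm := mem_opEvents hb hs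
      rw [hE] at hm
      rcases List.mem_cons.mp hm with rfl | hm
      · cases b2 <;> simp_all [Event.isInv, Event.toSched]
      · exact hl s hm
    · simp only [record, if_neg hx]
      rw [VL.highLevel_append, highLevel_retract (low rfl)]
  | readNext x y =>
    simp only [record]
    rw [VL.highLevel_append, highLevel_retract (low rfl)]
  | inv o => exact VL.highLevel_append _ _
  | resp b => exact VL.highLevel_append _ _
  | writeNext x y => exact VL.highLevel_append _ _
  | create x v y => exact VL.highLevel_append _ _
  | _ => exact (List.append_nil _).symm

end OpEvents

theorem history_concat {I : Type} [DecidableEq I] (α : List (I × Event)) (a : I × Event) :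
    history (α ++ [a]) = record (history α) a := by
  simp [history]

/-! ### The events of an operation of the Versioned List -/

namespace VL

open LL (Realizable pathEvents pathEnd arg)

/-- The operation `o` has the events `E` of a traversal from `head` to the node `x`. -/
inductive Walk (m : VMem) (o : SetOp) : List SEvent → Addr → Prop
  | start : Walk m o [.inv o] Addr.head
  | step {E : List SEvent} {x y : Addr} (h : Walk m o E x) (ha : y ∈ m.alloc)
      (hxy : m.val x < m.val y) (hy : m.val y < intVal (arg o)) :
      Walk m o (E ++ [.readNext x, .readVal y]) y

/-- After a traversal to `x`, the operation has read `x.next`, which was `c`. -/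
def Hop (m : VMem) (o : SetOp) (E : List SEvent) (x c : Addr) : Prop :=
  ∃ E₀, Walk m o E₀ x ∧ E = E₀ ++ [.readNext x] ∧ m.val x < m.val c ∧ c ∈ m.alloc

/-- After a traversal to `x`, the operation has read `x.next`, which was `c`, and `c.val`. -/
def Found (m : VMem) (o : SetOp) (E : List SEvent) (x c : Addr) : Prop :=
  ∃ E₀, Walk m o E₀ x ∧ E = E₀ ++ [.readNext x, .readVal c] ∧ m.val x < m.val c ∧ c ∈ m.alloc

/-- The operation can read `x.next` again, which leads back to the end of a traversal to `x`. -/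
def Back (m : VMem) (o : SetOp) (E : List SEvent) (x : Addr) : Prop :=
  Realizable E ∧ ∃ E₀ J, Walk m o E₀ x ∧ E = E₀ ++ .readNext x :: J

/-- The operation is going to test the value of `c`, either of `head`, which starts a new traversal,
or of the successor of `x`. -/
def Test (m : VMem) (o : SetOp) (E : List SEvent) (x c : Addr) : Prop :=
  (c = Addr.head ∧ Realizable E) ∨ Hop m o E x c

/-- The events `E` of the operation `o` in the schedule, depending on the local state. From the
creation of a node on, only the fact that the remaining events fit a sequential operation is
recorded. -/
def LocSched (m : VMem) (o : SetOp) (E : List SEvent) : Loc → Prop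
  | .idle => Realizable E
  | .cTest _ curr => ∃ x, Test m o E x curr
  | .cNext _ curr => Walk m o E curr
  | .cVal _ curr => ∃ x, Found m o E x curr
  | .cDel curr => ∃ x, Found m o E x curr
  | .tTest _ _ prev curr => Test m o E prev curr
  | .tNext _ _ curr => Walk m o E curr
  | .vVer _ _ prev => Back m o E prev
  | .vDel _ _ prev _ => Back m o E prev
  | .vNext _ _ prev _ => Back m o E prev
  | .vTest _ _ prev _ curr => Hop m o E prev curr
  | .vCurrVer _ _ prev curr => Found m o E prev curr
  | .vCurrDel _ _ prev _ curr => Found m o E prev curr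
  | .vCurrNext _ _ _ curr => Walk m o E curr
  | .iDel _ prev _ curr => Found m o E prev curr
  | .iVal _ prev _ curr => Found m o E prev curr
  | .iCreate _ prev _ curr => Found m o E prev curr
  | .iLock _ prev _ x => Back m o E prev ∧ Realizable (E ++ [.writeNext prev x, .resp])
  | .iWrite prev x => Realizable (E ++ [.writeNext prev x, .resp])
  | .rVal _ prev _ curr => Found m o E prev curr
  | .rDel _ prev _ curr => Found m o E prev curr
  | .rLock _ prev _ curr => Found m o E prev curr
  | .rSpinVer prev curr => Found m o E prev curr
  | .rSpinLock prev curr _ => Found m o E prev curr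
  | .rMark prev curr => Found m o E prev curr
  | .rNext prev curr => Found m o E prev curr
  | .rWrite prev _ y => Realizable (E ++ [.writeNext prev y, .resp])
  | .unlockRead _ _ => Realizable (E ++ [.resp])
  | .unlockCas _ _ _ => Realizable (E ++ [.resp])
  | .ret _ => Realizable (E ++ [.resp])

section

variable {m : VMem} {pub : Set Addr} {o : SetOp} {E : List SEvent} {x c : Addr}

theorem Walk.alloc (h : Walk m o E x) (M : MemInv m pub) : x ∈ m.alloc := by
  cases h with
  | start => exact M.head_alloc
  | step h ha => exact ha

theorem Walk.lt (h : Walk m o E x) (M : MemInv m pub) : m.val x < intVal (arg o) := by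
  cases h with
  | start => rw [M.val_head]; exact bot_lt_intVal _
  | step h ha hxy hy => exact hy

theorem Walk.readVal_le (h : Walk m o E x) : ∀ z, .readVal z ∈ E → m.val z ≤ m.val x := by
  induction h with
  | start => simp
  | step h ha hxy hy ih =>
    intro z hz
    simp only [List.mem_append, List.mem_cons, reduceCtorEq, SEvent.readVal.injEq, false_or,
      List.not_mem_nil, or_false] at hz
    rcases hz with hz | rfl
    · exact (ih z hz).trans hxy.le
    · exact le_rfl

theorem Walk.readNext_lt (h : Walk m o E x) : ∀ z, .readNext z ∈ E → m.val z < m.val x := by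
  induction h with
  | start => simp
  | step h ha hxy hy ih =>
    intro z hz
    simp only [List.mem_append, List.mem_cons, reduceCtorEq, SEvent.readNext.injEq,
      List.not_mem_nil, or_false] at hz
    rcases hz with hz | rfl
    · exact (ih z hz).trans hxy
    · exact hxy

theorem Walk.exists_path (h : Walk m o E x) (M : MemInv m pub) :
    ∃ ys, E = .inv o :: pathEvents Addr.head ys ∧ pathEnd Addr.head ys = x ∧ ys.Nodup ∧
      ∀ y ∈ ys, y ∈ m.alloc ∧ y ≠ Addr.head ∧ y ≠ Addr.tail ∧ m.val y ≤ m.val x := by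
  induction h with
  | start => exact ⟨[], rfl, rfl, .nil, by simp⟩
  | @step E x y h ha hxy hy ih =>
    obtain ⟨ys, rfl, rfl, h1, h2⟩ := ih
    refine ⟨ys ++ [y], by rw [LL.pathEvents_concat]; rfl, LL.pathEnd_concat _ _ _, ?_, ?_⟩
    · refine List.nodup_append.mpr ⟨h1, List.nodup_singleton _, ?_⟩
      rintro a ha b hb rfl
      rw [List.mem_singleton.mp hb] at ha
      exact absurd hxy (not_lt.mpr (h2 _ ha).2.2.2)
    · intro z hz
      rcases List.mem_append.mp hz with hz | hz
      · obtain ⟨k1, k2, k3, k4⟩ := h2 z hz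
        exact ⟨k1, k2, k3, k4.trans hxy.le⟩
      · rw [List.mem_singleton.mp hz]
        exact ⟨ha, M.ne_head_of_gt hxy, M.ne_tail_of_lt hy, le_rfl⟩

/-- The nodes of a traversal and a node of larger value are distinct. -/
theorem Walk.exists_path_concat (h : Walk m o E x) (M : MemInv m pub) (hc : m.val x < m.val c) :
    ∃ ys, E = .inv o :: pathEvents Addr.head ys ∧ pathEnd Addr.head ys = x ∧
      (ys ++ [c]).Nodup ∧ (∀ y ∈ ys ++ [c], y ≠ Addr.head) ∧
      ∀ y ∈ ys, y ∈ m.alloc ∧ y ≠ Addr.tail ∧ m.val y < m.val c := by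
  obtain ⟨ys, h1, h2, h3, h4⟩ := h.exists_path M
  refine ⟨ys, h1, h2, ?_, fun y hy => ?_, fun y hy =>
    ⟨(h4 y hy).1, (h4 y hy).2.2.1, (h4 y hy).2.2.2.trans_lt hc⟩⟩
  · refine List.nodup_append.mpr ⟨h3, List.nodup_singleton _, ?_⟩
    rintro a ha b hb rfl
    rw [List.mem_singleton.mp hb] at ha
    exact absurd hc (not_lt.mpr (h4 _ ha).2.2.2)
  · rcases List.mem_append.mp hy with hy | hy
    · exact (h4 y hy).2.1
    · rw [List.mem_singleton.mp hy]
      exact M.ne_head_of_gt hc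

theorem Found.realizable (h : Found m o E x c) (M : MemInv m pub) : Realizable E := by
  obtain ⟨E₀, hw, rfl, hc, -⟩ := h
  obtain ⟨ys, rfl, rfl, h1, h2, h3⟩ := hw.exists_path_concat M hc
  exact LL.realizable_test h1 h2 fun y hy => (h3 y hy).2.1

/-- Whatever the successor of `x` is, the events of a traversal to `x` can be continued as if it
were `tail`. -/
theorem Walk.found_tail (h : Walk m o E x) (M : MemInv m pub) :
    Found m o (E ++ [.readNext x, .readVal Addr.tail]) x Addr.tail :=
  ⟨E, h, rfl, by rw [M.val_tail]; exact (h.lt M).trans_le le_top, M.tail_alloc⟩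

theorem Walk.realizable (h : Walk m o E x) (M : MemInv m pub) : Realizable E :=
  ((h.found_tail M).realizable M).of_append

theorem Hop.realizable (h : Hop m o E x c) (M : MemInv m pub) : Realizable E := by
  obtain ⟨E₀, hw, rfl, -⟩ := h
  have := (hw.found_tail M).realizable M
  rw [show E₀ ++ [.readNext x, .readVal Addr.tail] =
    (E₀ ++ [.readNext x]) ++ [.readVal Addr.tail] by simp] at this
  exact this.of_append

theorem Test.realizable (h : Test m o E x c) (M : MemInv m pub) : Realizable E :=
  h.elim (fun h => h.2) fun h => h.realizable M

theorem Found.realizable_resp (h : Found m o E x c) (M : MemInv m pub)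
    (hi : ∀ v, o = .insert v → c ≠ Addr.tail) : Realizable (E ++ [.resp]) := by
  obtain ⟨E₀, hw, rfl, hc, -⟩ := h
  obtain ⟨ys, rfl, rfl, h1, h2, h3⟩ := hw.exists_path_concat M hc
  simpa using LL.realizable_read h1 h2 (fun y hy => (h3 y hy).2.1) hi

theorem Found.realizable_create {v : ℤ} {z : Addr} (h : Found m (.insert v) E x c)
    (M : MemInv m pub) (hz : z ∉ m.alloc) :
    Realizable (E ++ [.create z v c] ++ [.writeNext x z, .resp]) := by
  obtain ⟨E₀, hw, rfl, hc, hca⟩ := h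
  obtain ⟨ys, rfl, rfl, h1, h2, h3⟩ := hw.exists_path_concat M hc
  have hz' : z ∉ ys ++ [c] := fun h => by
    rcases List.mem_append.mp h with h | h
    · exact hz (h3 z h).1
    · rw [List.mem_singleton.mp h] at hz
      exact hz hca
  simpa using LL.realizable_insert (v := v) h1 h2 (fun y hy => (h3 y hy).2.1) hz'
    (fun h => hz (h ▸ M.head_alloc)) (fun h => hz (h ▸ M.tail_alloc))

theorem Found.realizable_unlink {v : ℤ} (h : Found m (.remove v) E x c)
    (M : MemInv m pub) (hct : c ≠ Addr.tail) :
    Realizable (E ++ [.readNext c] ++ [.writeNext x (m.next c), .resp]) := by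
  obtain ⟨E₀, hw, rfl, hc, hca⟩ := h
  obtain ⟨ys, rfl, rfl, h1, h2, h3⟩ := hw.exists_path_concat M hc
  have hlt := M.sorted c hca hct
  have hn : (ys ++ [c, m.next c]).Nodup := by
    rw [show ys ++ [c, m.next c] = (ys ++ [c]) ++ [m.next c] by simp]
    refine List.nodup_append.mpr ⟨h1, List.nodup_singleton _, ?_⟩
    rintro a ha b hb rfl
    rw [List.mem_singleton.mp hb] at ha
    rcases List.mem_append.mp ha with ha | ha
    · exact absurd hlt (not_lt.mpr (h3 _ ha).2.2.le)
    · rw [List.mem_singleton.mp ha] at hlt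
      exact absurd hlt (lt_irrefl _)
  have := LL.realizable_remove (v := v) hn
    (fun z hz => by
      rw [show ys ++ [c, m.next c] = (ys ++ [c]) ++ [m.next c] by simp] at hz
      rcases List.mem_append.mp hz with hz | hz
      · exact h2 z hz
      · rw [List.mem_singleton.mp hz]
        exact M.ne_head_of_gt hlt)
    (fun z hz => by
      rcases List.mem_append.mp hz with hz | hz
      · exact (h3 z hz).2.1
      · rwa [List.mem_singleton.mp hz])
  simpa using this

theorem Found.back (h : Found m o E x c) (M : MemInv m pub) : Back m o E x := by
  refine ⟨h.realizable M, ?_⟩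
  obtain ⟨E₀, hw, rfl, -⟩ := h
  exact ⟨E₀, [.readVal c], hw, rfl⟩

theorem Found.walk (h : Found m o E x c) (hc : m.val c < intVal (arg o)) : Walk m o E c := by
  obtain ⟨E₀, hw, rfl, h1, h2⟩ := h
  exact hw.step h2 h1 hc

theorem LocSched.realizable {l : Loc} (h : LocSched m o E l) (M : MemInv m pub) :
    Realizable E := by
  cases l with
  | idle => exact h
  | cTest v curr => obtain ⟨x, h⟩ := h; exact h.realizable M
  | cVal v curr => obtain ⟨x, h⟩ := h; exact h.realizable M
  | cDel curr => obtain ⟨x, h⟩ := h; exact h.realizable M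
  | tTest k v prev curr => exact Test.realizable h M
  | cNext v curr => exact Walk.realizable h M
  | tNext k v curr => exact Walk.realizable h M
  | vCurrNext k v pVer curr => exact Walk.realizable h M
  | vTest k v prev pVer curr => exact Hop.realizable h M
  | vVer k v prev => exact h.1
  | vDel k v prev pVer => exact h.1
  | vNext k v prev pVer => exact h.1
  | iLock v prev pVer x => exact h.1.1
  | iWrite prev x => exact LL.Realizable.of_append h
  | rWrite prev curr y => exact LL.Realizable.of_append h
  | unlockRead x xs => exact LL.Realizable.of_append h
  | unlockCas x xs w => exact LL.Realizable.of_append h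
  | ret b => exact LL.Realizable.of_append h
  | _ => exact Found.realizable h M

/-! ### The effect of steps on the events of an operation -/

theorem takeWhile_eq_of_notMem {s : SEvent} {J : List SEvent} (h : s ∉ E) :
    (E ++ s :: J).takeWhile (fun s' => decide (s' ≠ s)) = E := by
  rw [List.takeWhile_append_of_pos]
  · simp
  · intro t ht
    exact decide_eq_true fun h' => h (h' ▸ ht)

theorem eventsAfter_readNext_of_notMem {y : Addr} (h : .readNext x ∉ E) :
    eventsAfter E (.readNext x y) = E ++ [.readNext x] := by
  rw [eventsAfter, List.takeWhile_eq_self_iff.mpr]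
  intro t ht
  exact decide_eq_true fun h' => h (h' ▸ ht)

/-- The values of the nodes that have been read are at most that of `x`, and those of the nodes
whose successors have been read are smaller; so `x.next` has not been read before. -/
theorem Walk.hop (h : Walk m o E x) (M : MemInv m pub) :
    Hop m o (eventsAfter E (.readNext x (m.next x))) x (m.next x) := by
  rw [eventsAfter_readNext_of_notMem fun h' => lt_irrefl _ (h.readNext_lt x h')]
  exact ⟨E, h, rfl, M.sorted x (h.alloc M) (M.ne_tail_of_lt (h.lt M)), M.next_alloc x (h.alloc M)⟩

/-- To read `x.next` again drops all events after the traversal to `x`. -/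
theorem Back.hop (h : Back m o E x) (M : MemInv m pub) :
    Hop m o (eventsAfter E (.readNext x (m.next x))) x (m.next x) := by
  obtain ⟨-, E₀, J, hw, rfl⟩ := h
  have := hw.hop M
  rw [eventsAfter_readNext_of_notMem fun h' => lt_irrefl _ (hw.readNext_lt x h')] at this
  rw [eventsAfter, takeWhile_eq_of_notMem fun h' => lt_irrefl _ (hw.readNext_lt x h')]
  exact this

theorem Hop.found (h : Hop m o E x c) (M : MemInv m pub) {w : NodeVal} :
    Found m o (eventsAfter E (.readVal c w)) x c := by
  obtain ⟨E₀, hw, rfl, h1, h2⟩ := h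
  refine ⟨E₀, hw, ?_, h1, h2⟩
  rw [eventsAfter, if_neg (M.ne_head_of_gt h1), List.takeWhile_eq_self_iff.mpr]
  · simp
  · intro t ht
    rcases List.mem_append.mp ht with ht | ht
    · exact decide_eq_true fun h' => absurd h1 (not_lt.mpr (hw.readVal_le c (h' ▸ ht)))
    · rw [List.mem_singleton.mp ht]; simp

/-- To read `c.val` again changes nothing. -/
theorem Found.reread (h : Found m o E x c) (M : MemInv m pub) {w : NodeVal} :
    Found m o (eventsAfter E (.readVal c w)) x c := by
  obtain ⟨E₀, hw, rfl, h1, h2⟩ := h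
  have hop : Hop m o (E₀ ++ [.readNext x]) x c := ⟨E₀, hw, rfl, h1, h2⟩
  refine ⟨E₀, hw, ?_, h1, h2⟩
  rw [eventsAfter, if_neg (M.ne_head_of_gt h1),
    show E₀ ++ [.readNext x, .readVal c] = (E₀ ++ [.readNext x]) ++ [.readVal c] by simp,
    takeWhile_eq_of_notMem]
  intro ht
  rcases List.mem_append.mp ht with ht | ht
  · exact absurd h1 (not_lt.mpr (hw.readVal_le c ht))
  · simp at ht

theorem Found.eventsAfter_readNext (h : Found m o E x c) {y : Addr} :
    eventsAfter E (.readNext c y) = E ++ [.readNext c] := by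
  obtain ⟨E₀, hw, rfl, h1, h2⟩ := h
  refine eventsAfter_readNext_of_notMem fun ht => ?_
  simp only [List.mem_append, List.mem_cons, reduceCtorEq, SEvent.readNext.injEq,
    List.not_mem_nil, or_false] at ht
  rcases ht with ht | rfl
  · exact absurd h1 (hw.readNext_lt c ht).not_gt
  · exact lt_irrefl _ h1

/-- To read the value of `head` drops all events but the invocation. -/
theorem Test.walk (h : Test m o E x c) (P : Pending o E) (M : MemInv m pub)
    (hc : m.val c < intVal (arg o)) : Walk m o (eventsAfter E (.readVal c (m.val c))) c := by
  rcases h with ⟨rfl, -⟩ | h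
  · rw [eventsAfter, if_pos rfl, P.filter_isInv]
    exact .start
  · exact (h.found M).walk hc

theorem Test.found (h : Test m o E x c) (M : MemInv m pub)
    (hc : ¬ m.val c < intVal (arg o)) : Found m o (eventsAfter E (.readVal c (m.val c))) x c := by
  rcases h with ⟨rfl, -⟩ | h
  · exact absurd rfl (M.ne_head_of_not_lt hc)
  · exact h.found M

end

section Congr

variable {m m' : VMem} {pub : Set Addr} {o : SetOp} {E : List SEvent} {x c : Addr}
  (M : MemInv m pub) (hm : ∀ x ∈ m.alloc, x ∈ m'.alloc ∧ m'.val x = m.val x)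
include M hm

theorem Walk.congr (h : Walk m o E x) : Walk m' o E x := by
  induction h with
  | start => exact .start
  | step h ha hxy hy ih =>
    refine ih.step (hm _ ha).1 ?_ ?_
    · rwa [(hm _ ha).2, (hm _ (h.alloc M)).2]
    · rwa [(hm _ ha).2]

theorem Hop.congr (h : Hop m o E x c) : Hop m' o E x c := by
  obtain ⟨E₀, hw, h1, h2, h3⟩ := h
  exact ⟨E₀, hw.congr M hm, h1, by rwa [(hm _ h3).2, (hm _ (hw.alloc M)).2], (hm _ h3).1⟩

theorem Found.congr (h : Found m o E x c) : Found m' o E x c := by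
  obtain ⟨E₀, hw, h1, h2, h3⟩ := h
  exact ⟨E₀, hw.congr M hm, h1, by rwa [(hm _ h3).2, (hm _ (hw.alloc M)).2], (hm _ h3).1⟩

theorem Back.congr (h : Back m o E x) : Back m' o E x := by
  obtain ⟨h1, E₀, J, hw, h2⟩ := h
  exact ⟨h1, E₀, J, hw.congr M hm, h2⟩

theorem Test.congr (h : Test m o E x c) : Test m' o E x c := h.imp_right fun h => h.congr M hm

/-- Values of nodes do not change. -/
theorem LocSched.congr {l : Loc} (h : LocSched m o E l) : LocSched m' o E l := by
  cases l with
  | idle => exact h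
  | cTest v curr => obtain ⟨x, h⟩ := h; exact ⟨x, h.congr M hm⟩
  | cVal v curr => obtain ⟨x, h⟩ := h; exact ⟨x, h.congr M hm⟩
  | cDel curr => obtain ⟨x, h⟩ := h; exact ⟨x, h.congr M hm⟩
  | tTest k v prev curr => exact Test.congr M hm h
  | cNext v curr => exact Walk.congr M hm h
  | tNext k v curr => exact Walk.congr M hm h
  | vCurrNext k v pVer curr => exact Walk.congr M hm h
  | vTest k v prev pVer curr => exact Hop.congr M hm h
  | vVer k v prev => exact Back.congr M hm h
  | vDel k v prev pVer => exact Back.congr M hm h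
  | vNext k v prev pVer => exact Back.congr M hm h
  | iLock v prev pVer x => exact ⟨h.1.congr M hm, h.2⟩
  | iWrite prev x => exact h
  | rWrite prev curr y => exact h
  | unlockRead x xs => exact h
  | unlockCas x xs w => exact h
  | ret b => exact h
  | _ => exact Found.congr M hm h

end Congr

theorem arg_opOf (k : Kind) (v : ℤ) : arg (opOf k v) = v := by cases k <;> rfl

theorem eventsAfter_of_toSched {E : List SEvent} {e : Event} (h : e.toSched = none) :
    eventsAfter E e = E := by
  cases e <;> simp_all [eventsAfter, Event.toSched]

/-- The events of an operation after a step of the operation. That the nodes that it reads are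
linked and have increasing values is provided by the invariants of the memory and of the local state. -/
theorem LocSched.step {m m' : VMem} {pub : Set Addr} {o : SetOp} {E : List SEvent} {l l' : Loc}
    {e : Event} (M : MemInv m pub) (L : LocInv m pub o l) (P : Pending o E)
    (hs : LStep l m e l' m') (h : LocSched m o E l) : LocSched m' o (eventsAfter E e) l' := by
  refine LocSched.congr M (fun x hx => alloc_step hs hx) ?_
  cases hs with
  | cTest_lt v curr m hlt =>
    obtain ⟨x, h⟩ := h
    exact h.walk P M (by rw [L.1]; exact hlt)
  | cTest_ge v curr m hge =>
    obtain ⟨x, h⟩ := h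
    exact ⟨x, h.found M (by rw [L.1]; exact hge)⟩
  | cNext v curr m => exact ⟨curr, Or.inr (Walk.hop h M)⟩
  | cVal_eq v curr m hv =>
    obtain ⟨x, h⟩ := h
    exact ⟨x, h.reread M⟩
  | cVal_ne v curr m hv =>
    obtain ⟨x, h⟩ := h
    exact (h.reread M).realizable_resp M fun v hv => by simp [L.1] at hv
  | cDel curr m =>
    rw [eventsAfter_of_toSched rfl]
    obtain ⟨x, h⟩ := h
    obtain ⟨v, L, -⟩ := L
    exact h.realizable_resp M fun v hv => by simp [L] at hv
  | tTest_lt k v prev curr m hlt =>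
    exact Test.walk h P M (by rw [L.1, arg_opOf]; exact hlt)
  | tTest_ge k v prev curr m hge =>
    exact (Test.found h M (by rw [L.1, arg_opOf]; exact hge)).back M
  | tNext k v curr m => exact Or.inr (Walk.hop h M)
  | vVer k v prev m => rw [eventsAfter_of_toSched rfl]; exact h
  | vDel_true k v prev pVer m hd => rw [eventsAfter_of_toSched rfl]; exact Or.inl ⟨rfl, h.1⟩
  | vDel_false k v prev pVer m hd => rw [eventsAfter_of_toSched rfl]; exact h
  | vNext k v prev pVer m => exact Back.hop h M
  | vTest_lt k v prev pVer curr m hlt => exact Hop.found h M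
  | vTest_ge k v prev pVer curr m hge => cases k <;> exact Hop.found h M
  | vCurrVer k v prev curr m => rw [eventsAfter_of_toSched rfl]; exact h
  | vCurrDel_true k v prev pVer curr m hd => rw [eventsAfter_of_toSched rfl]; exact Found.back h M
  | vCurrDel_false k v prev pVer curr m hd =>
    rw [eventsAfter_of_toSched rfl]
    exact Found.walk h (by rw [L.1, arg_opOf]; exact L.2.2.1.2)
  | vCurrNext k v pVer curr m => exact Walk.hop h M
  | iDel_true v prev pVer curr m hd => rw [eventsAfter_of_toSched rfl]; exact Found.back h M
  | iDel_false v prev pVer curr m hd => rw [eventsAfter_of_toSched rfl]; exact h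
  | iVal_eq v prev pVer curr m hv =>
    exact (Found.reread h M).realizable_resp M fun _ _ => M.ne_tail_of_eq hv
  | iVal_ne v prev pVer curr m hv => exact Found.reread h M
  | iCreate v prev pVer curr m x hx =>
    obtain ⟨rfl, -⟩ := L
    have h1 := Found.realizable_create h M hx
    refine ⟨⟨h1.of_append, ?_⟩, h1⟩
    obtain ⟨E₀, hw, rfl, -⟩ := h
    exact ⟨E₀, [.readVal curr, .create x v curr], hw, by simp [eventsAfter, Event.toSched]⟩
  | iLock_ok v prev pVer x m hl => rw [eventsAfter_of_toSched rfl]; exact h.2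
  | iLock_fail v prev pVer x m hl => rw [eventsAfter_of_toSched rfl]; exact h.1
  | iWrite prev x m => simpa [LocSched, eventsAfter, Event.toSched] using h
  | rVal_ne v prev pVer curr m hv =>
    exact (Found.reread h M).realizable_resp M fun v hv => by simp [L.1] at hv
  | rVal_eq v prev pVer curr m hv => exact Found.reread h M
  | rDel_true v prev pVer curr m hd =>
    rw [eventsAfter_of_toSched rfl]
    exact Found.realizable_resp h M fun v hv => by simp [L.1] at hv
  | rDel_false v prev pVer curr m hd => rw [eventsAfter_of_toSched rfl]; exact h
  | rLock_ok v prev pVer curr m hl => rw [eventsAfter_of_toSched rfl]; exact h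
  | rLock_fail v prev pVer curr m hl => rw [eventsAfter_of_toSched rfl]; exact Found.back h M
  | rSpinVer prev curr m => rw [eventsAfter_of_toSched rfl]; exact h
  | rSpinLock_ok prev curr ver m hl => rw [eventsAfter_of_toSched rfl]; exact h
  | rSpinLock_fail prev curr ver m hl => rw [eventsAfter_of_toSched rfl]; exact h
  | rMark prev curr m => rw [eventsAfter_of_toSched rfl]; exact h
  | rNext prev curr m =>
    have hct := (L.1.reach M).2.2.2.1
    obtain ⟨⟨v, rfl, -⟩, -⟩ := L
    rw [Found.eventsAfter_readNext h]
    exact Found.realizable_unlink h M hct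
  | rWrite prev curr y m => simpa [LocSched, eventsAfter, Event.toSched] using h
  | unlockRead x xs m => rw [eventsAfter_of_toSched rfl]; exact h
  | unlockCas_ok x xs w m hl => rw [eventsAfter_of_toSched rfl]; cases xs <;> exact h
  | unlockCas_fail x xs w m hl => rw [eventsAfter_of_toSched rfl]; cases xs <;> exact h
  | ret b m => exact h

end VL

/-! ### Correctness -/

theorem LL.Realizable.exists_history {E : List SEvent} (h : LL.Realizable E) :
    ∃ S, LL.IsHistory S ∧ ∃ k, opEvents (schedule S) k = E := by
  obtain ⟨S₀, T, k, h1, h2, h3, rfl⟩ := h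
  refine ⟨_, h1, k, ?_⟩
  have h4 : opEvents (schedule S₀) k = [] := by
    simp only [opEvents, schedule, List.map_eq_nil_iff, List.filter_eq_nil_iff, List.mem_filterMap]
    rintro _ ⟨a, ha, hs⟩
    obtain ⟨s, -, rfl⟩ := Option.map_eq_some_iff.mp hs
    simpa using (h2 a ha).1
  rw [opEvents_schedule_append, h4, List.nil_append, opEvents, List.filter_eq_self.mpr]
  intro b hb
  obtain ⟨a, ha, hs⟩ := List.mem_filterMap.mp hb
  obtain ⟨s, -, rfl⟩ := Option.map_eq_some_iff.mp hs
  simpa using h3 a ha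

namespace VL

variable {n : ℕ}

/-- The invariant of the history of an execution `α`, in the configuration `s` that it leads to. -/
structure SchedInv (α : List (OpId n × Event)) (s : GState n) : Prop where
  highLevel_eq : highLevel (history α) = highLevel α
  fresh : ∀ π : OpId n, s.count π.1 < π.2 → opEvents (schedule (history α)) π = []
  current : ∀ p, s.loc p ≠ .idle →
    Pending (s.op (s.cur p)) (opEvents (schedule (history α)) (s.cur p)) ∧
    LocSched s.mem (s.op (s.cur p)) (opEvents (schedule (history α)) (s.cur p)) (s.loc p)
  realizable : ∀ π, LL.Realizable (opEvents (schedule (history α)) π)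

theorem locSched_start {m : VMem} {pub : Set Addr} (M : MemInv m pub) (o : SetOp) :
    LocSched m o [.inv o] (start o) := by
  have h := (Walk.start (m := m) (o := o)).realizable M
  cases o with
  | contains v => exact ⟨Addr.head, Or.inl ⟨rfl, h⟩⟩
  | insert v => exact Or.inl ⟨rfl, h⟩
  | remove v => exact Or.inl ⟨rfl, h⟩

theorem SchedInv.step {α : List (OpId n × Event)} {i : ℕ} {s s' : GState n} {a : OpId n × Event}
    (h : SchedInv α s) (I : Inv s) (hs : GStep i s a s') : SchedInv (α ++ [a]) s' := by
  cases hs with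
  | invoke p o hp =>
    have hself : opEvents (schedule (history (α ++ [((p, s.count p + 1), Event.inv o)])))
        (p, s.count p + 1) = [.inv o] := by
      rw [history_concat, opEvents_record_self, h.fresh _ (Nat.lt_succ_self _)]
      rfl
    have hne : ∀ π, π ≠ (p, s.count p + 1) →
        opEvents (schedule (history (α ++ [((p, s.count p + 1), Event.inv o)]))) π =
          opEvents (schedule (history α)) π := fun π hπ => by
      rw [history_concat, opEvents_record_of_ne _ hπ]
    have hw := locSched_start I.mem o
    refine ⟨?_, fun π hπ => ?_, fun q hq => ?_, fun π => ?_⟩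
    · rw [history_concat, highLevel_record (by simp [Event.toHL]), h.highLevel_eq,
        highLevel_append]
    · simp only [GState.afterInvoke] at hπ
      have : π ≠ (p, s.count p + 1) := by
        rintro rfl
        simp at hπ
      rw [hne π this]
      refine h.fresh π (lt_of_le_of_lt ?_ hπ)
      by_cases hq : π.1 = p
      · rw [hq]; simp
      · simp [hq]
    · by_cases hqp : q = p
      · subst hqp
        simp only [GState.cur, GState.afterInvoke, Function.update_self]
        rw [hself]
        exact ⟨⟨[], rfl, by simp⟩, hw⟩
      · have hcur : (q, s.count q) ≠ (p, s.count p + 1) := fun h => hqp (Prod.mk.inj h).1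
        simp only [GState.cur, GState.afterInvoke, Function.update_of_ne hqp,
          Function.update_of_ne hcur] at hq ⊢
        rw [hne _ hcur]
        exact h.current q hq
    · by_cases hπ : π = (p, s.count p + 1)
      · rw [hπ, hself]; exact hw.realizable I.mem
      · rw [hne π hπ]; exact h.realizable π
  | step p e l m hs =>
    have hidle : s.loc p ≠ .idle := fun hi => by
      rw [hi] at hs
      exact not_step_idle hs
    obtain ⟨hP, hL⟩ := h.current p hidle
    have hself := opEvents_record_self (history α) (s.cur p) e
    rw [← history_concat] at hself
    have hne : ∀ π, π ≠ s.cur p → opEvents (schedule (history (α ++ [(s.cur p, e)]))) π =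
        opEvents (schedule (history α)) π := fun π hπ => by
      rw [history_concat, opEvents_record_of_ne _ hπ]
    have hL' := hL.step I.mem (I.loc p) hP hs
    have I' : MemInv m (pubAfter e s.pub) := (I.step (GStep.step (i := i) s p e l m hs)).mem
    refine ⟨?_, fun π hπ => ?_, fun q hq => ?_, fun π => ?_⟩
    · rw [history_concat, highLevel_record fun _ => ⟨_, hP⟩, h.highLevel_eq, highLevel_append]
    · rw [hne π]
      · exact h.fresh π hπ
      · rintro rfl
        exact lt_irrefl _ hπ
    · by_cases hqp : q = p
      · subst hqp
        simp only [GState.cur, GState.afterStep, Function.update_self] at hq ⊢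
        rw [hself]
        refine ⟨hP.step ?_, hL'⟩
        rcases step_idle_iff hs with ⟨b, -, -, h3⟩ | ⟨-, h2, h3, -⟩
        · exact absurd h3 hq
        · cases e <;> simp_all [Event.toHL]
      · have hcur : (q, s.count q) ≠ s.cur p := fun h => hqp (Prod.mk.inj h).1
        simp only [GState.cur, GState.afterStep, Function.update_of_ne hqp] at hq ⊢
        rw [hne _ hcur]
        have := h.current q hq
        exact ⟨this.1, this.2.congr I.mem fun x hx => alloc_step hs hx⟩
    · by_cases hπ : π = s.cur p
      · rw [hπ, hself]; exact hL'.realizable I'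
      · rw [hne π hπ]; exact h.realizable π

theorem IsTrace.schedInv {g : ℕ → GState n} {α : List (OpId n × Event)} (T : IsTrace g α) :
    SchedInv α (g α.length) := by
  induction T with
  | nil h0 =>
    have nil : ∀ π : OpId n, opEvents (schedule (history ([] : List (OpId n × Event)))) π = [] :=
      fun _ => rfl
    refine ⟨rfl, fun π _ => nil π, fun p hp => ?_, fun π => ?_⟩
    · rw [List.length_nil, h0] at hp
      exact absurd rfl hp
    · exact ⟨[], [], 0, ⟨_, _, _, .initial⟩, by simp [LL.Inserts], by simp, rfl⟩
  | snoc T hs ih =>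
    rw [List.length_append, List.length_singleton]
    exact ih.step (T.inv _ le_rfl) hs

end VL

theorem theorem2 (n : ℕ) (α : List (OpId n × Event)) (hα : VL.IsExecution α) :
    IsCorrect (history α) ∧ LocallySerializableAfterInserts (schedule (history α)) := by
  obtain ⟨c, hc⟩ := hα
  obtain ⟨g, T, -⟩ := VL.exists_trace hc
  have h := T.schedInv
  refine ⟨⟨?_, fun π _ => (h.realizable π).exists_history⟩, fun π _ => h.realizable π⟩
  rw [h.highLevel_eq]
  exact T.linearizable
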